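/- Let $X$ be a smooth projective (irreducible) complex curve and let $\delta\in\mathbb{Q}_{>0}$. Let $N$ be a line bundle on $X$. A quadric bundle $(E,Q)$ with values in $N$ is a vector bundle $E$ on $X$, of rank $r$ and degree $d$, with a nonzero morphism $Q:\mathrm{Sym}^2E\to N$. A weighted filtration of $E$ is a nonempty chain $0\subsetneq E_1\subsetneq\dots\subsetneq E_t\subsetneq E$ ($t\ge 1$) of vector subbundles with weights $\alpha_1,\dots,\alpha_t\in\mathbb{Q}_{>0}$. Write $r_k=\mathrm{rk}\,E_k$, $d_k=\deg E_k$, and let $E_{t+1}:=E$, $r_{t+1}:=r$. Put $$P=\sum_{k=1}^t\alpha_k(d\,r_k-r\,d_k),\qquad \gamma=\sum_{k=1}^t\alpha_k(\underbrace{r_k-r,\dots,r_k-r}_{r_k},\underbrace{r_k,\dots,r_k}_{r-r_k}),$$ let $\gamma^{(i)}$ denote the $r_i$-th entry of the vector $\gamma$ ($1\le i\le t+1$), and put $$\mu=-\min\{\gamma^{(i)}+\gamma^{(j)}\;:\;1\le i,j\le t+1,\ Q|_{E_iE_j}\not\equiv 0\}.$$ The quadric bundle $(E,Q)$ is $\delta$-semistable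 (resp. $\delta$-stable) if $P+\delta\mu\ge 0$ (resp. $P+\delta\mu>0$) for every weighted filtration of $E$. A subbundle $F\subset E$ is isotropic if $Q|_{FF}=0$, and proper if $0\ne F\ne E$. (1) Let $(E,Q)$ be an orthogonal bundle, i.e. $N=\mathcal{O}_X$ and $Q$ induces an isomorphism $E\to E^\vee$. Then $\deg F\le 0$ for every proper isotropic subbundle $F$ if and only if $(E,Q)$ is $\delta$-semistable; and $\deg F<0$ for every proper isotropic subbundle $F$ if and only if $(E,Q)$ is $\delta$-stable. (2) More generally, let $(E,Q)$ be a generalized orthogonal bundle, i.e. $N$ is any line bundle and $Q$ induces an isomorphism $E\to E^\vee\otimes N$. Then $\deg F/\mathrm{rk}\,F\le\deg E/\mathrm{rk}\,E$ for every proper isotropic subbundle $F$ if and only if $(E,Q)$ is $\delta$-semistable; and $\deg F/\mathrm{rk}\,F<\deg E/\mathrm{rk}\,E$ for every proper isotropic subbundle $F$ if and only if $(E,Q)$ is $\delta$-stable. -/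

import Mathlib

open AlgebraicGeometry CategoryTheory

noncomputable section

namespace OrthBundle

/-- A smooth projective complex curve: an integral scheme, proper and smooth of relative
dimension `1` over `Spec ℂ`.  (For curves over a field, proper and projective are the same.) -/
structure SmoothProjectiveCurve where
  X : Scheme.{0}
  str : X ⟶ Spec (CommRingCat.of ℂ)
  isIntegral : IsIntegral X
  smooth : SmoothOfRelativeDimension 1 str
  proper : IsProper str

instance (C : SmoothProjectiveCurve) : IsIntegral C.X := C.isIntegral

instance (C : SmoothProjectiveCurve) : IsLocallyNoetherian C.X := by
  have := C.proper
  exact LocallyOfFiniteType.isLocallyNoetherian C.str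

section Sheaves

variable {X : Scheme.{0}}

/-- Restriction of sections of a sheaf of `𝒪_X`-modules. -/
def res (M : X.Modules) {U V : X.Opens} (h : V ≤ U) : Γ(M, U) →+ Γ(M, V) :=
  (M.presheaf.map (homOfLE h).op).hom

/-- Let `S` assign to every open `U` a submodule of `M(U)` (a subsheaf in the applications).
Sections `e₁, …, e_r ∈ S(U)` form a *frame* of `S` over `U` if on every open `V ⊆ U` every section
of `S` is a unique `𝒪(V)`-linear combination of the restrictions of the `eᵢ`, that is, if they
define an isomorphism `𝒪_U^r ≅ S|_U`. -/
def IsFrame (M : X.Modules) (S : ∀ U : X.Opens, Submodule Γ(X, U) Γ(M, U)) {r : ℕ}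
    (U : X.Opens) (e : Fin r → Γ(M, U)) : Prop :=
  (∀ i, e i ∈ S U) ∧
    ∀ (V : X.Opens) (h : V ≤ U), ∀ s ∈ S V,
      ∃! a : Fin r → Γ(X, V), s = ∑ i, a i • res M h (e i)

/-- `HasOrderAt M S U e x n`: the rational section `e₁ ∧ … ∧ e_r` of `det S` given by a frame `e`
of `S` over `U` has order of vanishing `n` at the point `x`.  Explicitly, for a frame `f` of `S`
around `x` and the matrix `A` over `U ∩ V` with `e_j = ∑ᵢ A_{ij} fᵢ`, the rational function
`det A` has order `n` at `x`. -/
def HasOrderAt [IsIntegral X] [IsLocallyNoetherian X] (M : X.Modules)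
    (S : ∀ U : X.Opens, Submodule Γ(X, U) Γ(M, U)) {r : ℕ}
    (U : X.Opens) (e : Fin r → Γ(M, U)) (x : X) (n : ℤ) : Prop :=
  ∃ (V : X.Opens) (_ : x ∈ V) (hη : genericPoint X ∈ U ⊓ V) (f : Fin r → Γ(M, V))
    (A : Matrix (Fin r) (Fin r) Γ(X, U ⊓ V)),
    IsFrame M S V f ∧
    (∀ j, res M inf_le_left (e j) = ∑ i, A i j • res M inf_le_right (f i)) ∧
    Scheme.ord (X.presheaf.germ (U ⊓ V) (genericPoint X) hη A.det : X.functionField) x = n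

/-- `d` is the degree of the divisor of the rational section `e₁ ∧ … ∧ e_r` of `det S`, for some
frame `e₁, …, e_r` of `S` over some nonempty open set. -/
def HasDegree [IsIntegral X] [IsLocallyNoetherian X] (M : X.Modules)
    (S : ∀ U : X.Opens, Submodule Γ(X, U) Γ(M, U)) (r : ℕ) (d : ℤ) : Prop :=
  ∃ (U : X.Opens) (_ : genericPoint X ∈ U) (e : Fin r → Γ(M, U)) (n : X → ℤ),
    IsFrame M S U e ∧ (∀ x, HasOrderAt M S U e x (n x)) ∧
    n.support.Finite ∧ d = ∑ᶠ x, n x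

end Sheaves

variable {C : SmoothProjectiveCurve}

/-- An algebraic vector bundle of rank `rank` on `C`, as a locally free sheaf of modules. -/
structure VectorBundle (C : SmoothProjectiveCurve) where
  sheaf : C.X.Modules
  rank : ℕ
  locallyFree : ∀ x : C.X, ∃ (U : C.X.Opens) (_ : x ∈ U) (e : Fin rank → Γ(sheaf, U)),
    IsFrame sheaf (fun _ => ⊤) U e

/-- A vector subbundle `F ⊆ E` of rank `rank`: a subsheaf of `𝒪`-modules such that, locally, there
is a frame of `E` whose first `rank` members span `F`. -/
structure Subbundle (E : VectorBundle C) where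
  rank : ℕ
  rank_le : rank ≤ E.rank
  sections : ∀ U : C.X.Opens, Submodule Γ(C.X, U) Γ(E.sheaf, U)
  res_mem : ∀ {U V : C.X.Opens} (h : V ≤ U) (s : Γ(E.sheaf, U)),
    s ∈ sections U → res E.sheaf h s ∈ sections V
  mem_of_locally : ∀ (U : C.X.Opens) (s : Γ(E.sheaf, U)),
    (∀ x ∈ U, ∃ (V : C.X.Opens) (h : V ≤ U), x ∈ V ∧ res E.sheaf h s ∈ sections V) →
      s ∈ sections U
  locally_split : ∀ x : C.X, ∃ (U : C.X.Opens) (_ : x ∈ U) (e : Fin E.rank → Γ(E.sheaf, U)),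
    IsFrame E.sheaf (fun _ => ⊤) U e ∧
    ∀ (V : C.X.Opens) (h : V ≤ U),
      sections V =
        Submodule.span Γ(C.X, V) {t | ∃ i : Fin E.rank, i.val < rank ∧ t = res E.sheaf h (e i)}

namespace Subbundle

variable {E : VectorBundle C}

/-- Subbundles are ordered by inclusion. -/
instance : Preorder (Subbundle E) := Preorder.lift (fun F => F.sections)

/-- `E` as a subbundle of itself. -/
def whole (E : VectorBundle C) : Subbundle E where
  rank := E.rank
  rank_le := le_rfl
  sections := fun _ => ⊤
  res_mem := fun _ _ _ => Submodule.mem_top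
  mem_of_locally := fun _ _ _ => Submodule.mem_top
  locally_split := by
    intro x
    obtain ⟨U, hx, e, he⟩ := E.locallyFree x
    refine ⟨U, hx, e, he, fun V h => ?_⟩
    symm
    rw [eq_top_iff]
    intro s _
    obtain ⟨a, ha, -⟩ := he.2 V h s Submodule.mem_top
    rw [ha]
    exact Submodule.sum_mem _ fun i _ =>
      Submodule.smul_mem _ _ (Submodule.subset_span ⟨i, i.isLt, rfl⟩)

/-- The degree of a subbundle: the degree of the divisor of a nonzero rational section of its
determinant. On a smooth projective curve exactly one integer satisfies `HasDegree`. -/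
def degree (F : Subbundle E) : ℤ :=
  Classical.epsilon (HasDegree E.sheaf F.sections F.rank)

/-- Proper subbundle: neither `0` nor `E`. -/
def IsProperSub (F : Subbundle E) : Prop := 0 < F.rank ∧ F.rank < E.rank

end Subbundle

/-- The degree of a vector bundle. -/
def VectorBundle.degree (E : VectorBundle C) : ℤ := (Subbundle.whole E).degree

/-- A line bundle. -/
structure LineBundle (C : SmoothProjectiveCurve) extends VectorBundle C where
  rank_eq_one : rank = 1

/-- `𝒪_X` as a sheaf of modules over itself. -/
def unitSheaf (X : Scheme.{0}) : X.Modules := SheafOfModules.unit _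

/-- The trivial line bundle `𝒪_X`. -/
def structureSheaf (C : SmoothProjectiveCurve) : LineBundle C where
  sheaf := unitSheaf C.X
  rank := 1
  rank_eq_one := rfl
  locallyFree := by
    intro x
    let e : Fin 1 → Γ(unitSheaf C.X, ⊤) := fun _ => (1 : Γ(C.X, ⊤))
    refine ⟨⊤, trivial, e, fun _ => Submodule.mem_top, ?_⟩
    intro V h s _
    have h1 : res (unitSheaf C.X) h (e 0) = (1 : Γ(C.X, V)) :=
      map_one (C.X.presheaf.map (homOfLE h).op).hom
    have h2 : ∀ b : Γ(C.X, V), b • res (unitSheaf C.X) h (e 0) = (b : Γ(C.X, V)) := by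
      intro b
      rw [h1]
      exact mul_one b
    refine ⟨fun _ => (s : Γ(C.X, V)), ?_, ?_⟩
    · refine Eq.trans ?_ (Fin.sum_univ_one _).symm
      exact (h2 s).symm
    · intro a ha
      funext i
      have h3 := ha.trans (Fin.sum_univ_one _)
      rw [Subsingleton.elim i 0]
      exact (h3.trans (h2 (a 0))).symm

/-- A morphism of `𝒪_X`-modules `Sym² E → N`, given by the corresponding symmetric
`𝒪_X`-bilinear morphism of sheaves `E × E → N`. -/
structure SymForm (E N : VectorBundle C) where
  form : ∀ U : C.X.Opens,
    Γ(E.sheaf, U) →ₗ[Γ(C.X, U)] Γ(E.sheaf, U) →ₗ[Γ(C.X, U)] Γ(N.sheaf, U)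
  symm : ∀ (U : C.X.Opens) (s t : Γ(E.sheaf, U)), form U s t = form U t s
  form_res : ∀ {U V : C.X.Opens} (h : V ≤ U) (s t : Γ(E.sheaf, U)),
    form V (res E.sheaf h s) (res E.sheaf h t) = res N.sheaf h (form U s t)

/-- Sections over `U` of the sheaf `ℋom(E, N)`, i.e. morphisms `E|_U → N|_U`.  For vector bundles
`ℋom(E, N) = E^∨ ⊗ N`, and `ℋom(E, 𝒪_X) = E^∨`. -/
@[ext]
structure LocalHom (E N : VectorBundle C) (U : C.X.Opens) where
  app : ∀ V : C.X.Opens, V ≤ U → Γ(E.sheaf, V) →ₗ[Γ(C.X, V)] Γ(N.sheaf, V)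
  app_res : ∀ (V W : C.X.Opens) (hV : V ≤ U) (hW : W ≤ V) (s : Γ(E.sheaf, V)),
    app W (hW.trans hV) (res E.sheaf hW s) = res N.sheaf hW (app V hV s)

namespace SymForm

variable {E N : VectorBundle C} (Q : SymForm E N)

/-- The morphism `E → ℋom(E, N) = E^∨ ⊗ N`, `s ↦ Q(s · -)`, induced by `Q`. -/
def induced (U : C.X.Opens) (s : Γ(E.sheaf, U)) : LocalHom E N U where
  app V hV := Q.form V (res E.sheaf hV s)
  app_res V W hV hW t := by
    have h : res E.sheaf (hW.trans hV) s = res E.sheaf hW (res E.sheaf hV s) := by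
      change (E.sheaf.presheaf.map (homOfLE (hW.trans hV)).op).hom s =
        (E.sheaf.presheaf.map (homOfLE hW).op).hom ((E.sheaf.presheaf.map (homOfLE hV).op).hom s)
      rw [show (homOfLE (hW.trans hV)).op = (homOfLE hV).op ≫ (homOfLE hW).op from rfl,
        Functor.map_comp]
      rfl
    rw [h, Q.form_res]

/-- `Q` induces an isomorphism `E ≅ ℋom(E, N) = E^∨ ⊗ N`. -/
def InducesIso : Prop := ∀ U : C.X.Opens, Function.Bijective (Q.induced U)

/-- The restriction of `Q` to `F G ⊆ Sym² E` is not identically zero. -/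
def NonzeroOn (F G : Subbundle E) : Prop :=
  ∃ (U : C.X.Opens) (s t : Γ(E.sheaf, U)), s ∈ F.sections U ∧ t ∈ G.sections U ∧ Q.form U s t ≠ 0

end SymForm

/-- A quadric bundle `(E, Q)` with `Q : Sym² E → N` nonzero. -/
structure QuadricBundle (N : LineBundle C) where
  E : VectorBundle C
  Q : SymForm E N.toVectorBundle
  ne_zero : Q.NonzeroOn (Subbundle.whole E) (Subbundle.whole E)

/-- A weighted filtration `0 ⊂ E₁ ⊂ ⋯ ⊂ E_t ⊂ E`, `t ≥ 1`, by subbundles, with strict inclusions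
and positive rational weights. -/
structure WeightedFiltration (E : VectorBundle C) where
  length : ℕ
  length_pos : 0 < length
  sub : Fin length → Subbundle E
  strictMono : StrictMono sub
  proper : ∀ i, (sub i).IsProperSub
  weight : Fin length → ℚ
  weight_pos : ∀ i, 0 < weight i

namespace WeightedFiltration

variable {E : VectorBundle C} (𝓔 : WeightedFiltration E)

/-- The terms of the filtration together with `E` itself (the index set `I ∪ {r}`). -/
def extSub (i : Fin (𝓔.length + 1)) : Subbundle E :=
  if h : i.val < 𝓔.length then 𝓔.sub ⟨i.val, h⟩ else Subbundle.whole E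

/-- The `p`-th entry (`1 ≤ p ≤ r`) of the vector
`∑ₖ αₖ (r_k - r, …, r_k - r, r_k, …, r_k)`, with `r_k` entries `r_k - r`. -/
def gammaVec (p : ℕ) : ℚ :=
  ∑ k, 𝓔.weight k *
    (if p ≤ (𝓔.sub k).rank then ((𝓔.sub k).rank : ℚ) - E.rank else ((𝓔.sub k).rank : ℚ))

/-- The number `γ^{(i)}` attached to the term `E_i`: the entry of the vector at `rk E_i`. -/
def gamma (i : Fin (𝓔.length + 1)) : ℚ := 𝓔.gammaVec (𝓔.extSub i).rank

/-- `P = ∑ αᵢ (deg E · rk Eᵢ - rk E · deg Eᵢ)`. -/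
def P : ℚ :=
  ∑ i, 𝓔.weight i * ((E.degree : ℚ) * (𝓔.sub i).rank - (E.rank : ℚ) * (𝓔.sub i).degree)

end WeightedFiltration

namespace QuadricBundle

variable {N : LineBundle C} (B : QuadricBundle N)

open Classical in
/-- Pairs of indices `i, j ∈ I ∪ {r}` such that `Q` restricted to `Eᵢ Eⱼ` is nonzero. -/
def pairs (𝓔 : WeightedFiltration B.E) :
    Finset (Fin (𝓔.length + 1) × Fin (𝓔.length + 1)) :=
  Finset.univ.filter fun p => B.Q.NonzeroOn (𝓔.extSub p.1) (𝓔.extSub p.2)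

theorem pairs_nonempty (𝓔 : WeightedFiltration B.E) : (B.pairs 𝓔).Nonempty := by
  refine ⟨(Fin.last _, Fin.last _), ?_⟩
  have h : 𝓔.extSub (Fin.last _) = Subbundle.whole B.E := by
    simp [WeightedFiltration.extSub]
  simp only [pairs, Finset.mem_filter, Finset.mem_univ, true_and, h]
  exact B.ne_zero

/-- `μ(E_•, α; Q) = - min { γ⁽ⁱ⁾ + γ⁽ʲ⁾ | Q|_{Eᵢ Eⱼ} ≠ 0 }`. -/
def mu (𝓔 : WeightedFiltration B.E) : ℚ :=
  -((B.pairs 𝓔).inf' (B.pairs_nonempty 𝓔) fun p => 𝓔.gamma p.1 + 𝓔.gamma p.2)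

/-- `δ`-semistability of a quadric bundle. -/
def IsDeltaSemistable (δ : ℚ) : Prop :=
  ∀ 𝓔 : WeightedFiltration B.E, 0 ≤ 𝓔.P + δ * B.mu 𝓔

/-- `δ`-stability of a quadric bundle. -/
def IsDeltaStable (δ : ℚ) : Prop :=
  ∀ 𝓔 : WeightedFiltration B.E, 0 < 𝓔.P + δ * B.mu 𝓔

/-- A subbundle `F` is isotropic if `Q` vanishes on `F F`. -/
def IsIsotropic (F : Subbundle B.E) : Prop := ¬ B.Q.NonzeroOn F F

/-- Ramanan semistability: `deg F ≤ 0` for every proper isotropic subbundle `F`. -/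
def IsRamananSemistable : Prop :=
  ∀ F : Subbundle B.E, F.IsProperSub → B.IsIsotropic F → F.degree ≤ 0

/-- Ramanan stability: `deg F < 0` for every proper isotropic subbundle `F`. -/
def IsRamananStable : Prop :=
  ∀ F : Subbundle B.E, F.IsProperSub → B.IsIsotropic F → F.degree < 0

/-- Semistability of a generalized orthogonal bundle: `deg F / rk F ≤ deg E / rk E` for every
proper isotropic subbundle `F`. -/
def IsGenRamananSemistable : Prop :=
  ∀ F : Subbundle B.E, F.IsProperSub → B.IsIsotropic F →
    (F.degree : ℚ) / F.rank ≤ (B.E.degree : ℚ) / B.E.rank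

/-- Stability of a generalized orthogonal bundle: `deg F / rk F < deg E / rk E` for every
proper isotropic subbundle `F`. -/
def IsGenRamananStable : Prop :=
  ∀ F : Subbundle B.E, F.IsProperSub → B.IsIsotropic F →
    (F.degree : ℚ) / F.rank < (B.E.degree : ℚ) / B.E.rank

/-- A generalized orthogonal bundle: `Q` induces an isomorphism `E ≅ E^∨ ⊗ N`. -/
def IsGeneralizedOrthogonal : Prop := B.Q.InducesIso

/-- An orthogonal bundle: `N = 𝒪_X` and `Q` induces an isomorphism `E ≅ E^∨`. -/
def IsOrthogonal (B : QuadricBundle (structureSheaf C)) : Prop := B.Q.InducesIso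

end QuadricBundle

end OrthBundle

end

/-!
The proof passes to the generic fibre. Let `K` be the function field of the curve `X`. The local rings of `X`
are unramified over localizations of `ℂ[t]`, hence principal ideal domains with fraction field `K`. A vector
bundle `E` of rank `r` becomes the vector space `K ^ r` together with a lattice at every point (`gen`,
`lattice`), its subbundles correspond to the subspaces of `K ^ r` (`mem_sections_iff`, `ofSubspace`), and the
degree of a subbundle with generic fibre `W` is `∑ₓ ordₓ det Aₓ`, where `Aₓ` expresses a fixed basis of `W` in
a basis of its lattice at `x` (`degree_eq`).

The degree is independent of the choices because a rational function `f` has as many zeros as poles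
(`finite_support_ord_and_finsum_ord`). If `f` is not constant, then `K` is finite over `ℂ(f)`,
  and the zeros of
`f` on the places of `K`, the valuation rings that contain `ℂ`, are `[K : ℂ(f)]` in number
(`finsum_zeroOrder_eq_finrank`); the same holds for `f⁻¹`. By the valuative criteria these valuation rings
are the local rings of the points of the curve, each occurring once (`place_injective`, `exists_place_eq`); the
generic point corresponds to `K` itself, where `f` has order `0`.

A form `Q` inducing `E ≅ E^∨ ⊗ N` is a nondegenerate symmetric form on `K ^ r` that is unimodular on the
lattices of `E` up to a local generator of `N` (`exists_unimodular`). Comparing Gram determinants gives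
`2 deg E = r deg N` (`two_mul_degree`) and, for two subquotients of dimension `m` dual to each other, the
inequality `deg (W₁/I₁) + deg (W₂/I₂) ≤ m deg N` (`subDegree_sub_add_le`), because their Gram matrices in local
bases are integral, though not always unimodular. Let `ν(W) = r deg W - deg E · rk W` be the slope defect. The
pairing of `W / rad W` with itself yields `ν(W) ≤ ν(rad W)`, and that of `W` with `E / W^⊥` yields
`ν(W) ≤ ν(W^⊥)`.

For a weighted filtration, `P = -∑ αₖ ν(Eₖ)`. The entries of the vector `γ` add up to `0`, so two entries in
opposite positions `p` and `r + 1 - p` have a nonpositive sum; they belong to terms whose ranks add up to more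
than `r`, which cannot be orthogonal, and therefore `μ ≥ 0` (`mu_nonneg`). If `ν ≤ 0` on isotropic subspaces,
then `ν(W) ≤ ν(rad W) ≤ 0` for all `W`, so `P ≥ 0` and `E` is `δ`-semistable. If `ν < 0` on nonzero isotropic
subspaces, consider the smallest term `E₁`: either its radical is not `0` and `P > 0`,
  or `Q` does not vanish on
`E₁ E₁` and `μ > 0`. Conversely, an isotropic `F` is tested by the filtration `F ⊆ F^⊥` with weights `1`, for
which `μ ≤ 0` and `P = -ν(F) - ν(F^⊥) ≤ -2 ν(F)` (`exists_weightedFiltration`). The statement on orthogonal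
bundles is the case `N = 𝒪_X`, in which `deg E = 0`.
-/

open AlgebraicGeometry CategoryTheory

noncomputable section

namespace OrthBundle

/-! ### Unramified algebras over principal ideal domains -/

open IsLocalRing in
/-- In an unramified local algebra the maximal ideal is generated by the maximal ideal of the base,
localized at its inverse image. -/
theorem isPrincipal_maximalIdeal_of_formallyUnramified (P S : Type*) [CommRing P] [IsPrincipalIdealRing P]
    [CommRing S] [IsLocalRing S] [Algebra P S] [Algebra.FormallyUnramified P S]
    [Algebra.EssFiniteType P S] : (maximalIdeal S).IsPrincipal := by
  let p := (maximalIdeal S).under P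
  have hp : p.IsPrime := inferInstance
  have hu : ∀ y : p.primeCompl, IsUnit (algebraMap P S y) := by
    intro y
    by_contra h
    exact y.2 ((mem_maximalIdeal _).2 h)
  let φ : Localization.AtPrime p →+* S := IsLocalization.lift hu
  algebraize [φ]
  have : IsScalarTower P (Localization.AtPrime p) S :=
    IsScalarTower.of_algebraMap_eq fun x => (IsLocalization.lift_eq hu x).symm
  have : Algebra.FormallyUnramified (Localization.AtPrime p) S := .of_restrictScalars P _ _
  have : Algebra.EssFiniteType (Localization.AtPrime p) S := .of_comp P _ _
  have : IsLocalHom (algebraMap (Localization.AtPrime p) S) := by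
    refine ((local_hom_TFAE (algebraMap (Localization.AtPrime p) S)).out 0 2 rfl rfl).mpr ?_
    rw [← Localization.AtPrime.map_eq_maximalIdeal, Ideal.map_map, ← IsScalarTower.algebraMap_eq]
    exact Ideal.map_le_iff_le_comap.2 le_rfl
  rw [← Algebra.FormallyUnramified.map_maximalIdeal (R := Localization.AtPrime p),
    ← Localization.AtPrime.map_eq_maximalIdeal, Ideal.map_map]
  have := (IsPrincipalIdealRing.principal p)
  infer_instance

theorem isPrincipalIdealRing_mvPolynomial_fin_one (k : Type*) [Field k] : IsPrincipalIdealRing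
    (MvPolynomial (Fin 1) k) :=
  IsPrincipalIdealRing.of_surjective (MvPolynomial.uniqueAlgEquiv k (Fin 1)).symm.toRingEquiv.toRingHom
    (MvPolynomial.uniqueAlgEquiv k (Fin 1)).symm.surjective

theorem isPrincipalIdealRing_of_isLocalRing (S : Type*) [CommRing S] [IsDomain S] [IsLocalRing S]
    [IsNoetherianRing S]
   (h : (IsLocalRing.maximalIdeal S).IsPrincipal) : IsPrincipalIdealRing S := by
  by_cases hS : IsField S
  · let := hS.toField
    infer_instance
  · have : IsDiscreteValuationRing S := ((IsDiscreteValuationRing.TFAE S hS).out 0 4).mpr h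
    exact IsDiscreteValuationRing.toIsPrincipalIdealRing

open IntermediateField in
/-- A field that is unramified and essentially of finite type over `k[T]` is finite over the field
generated by the image of `T`. -/
theorem exists_finiteDimensional_adjoin (k K : Type*) [Field k] [Field K] [Algebra k K]
    [Algebra (MvPolynomial (Fin 1) k) K] [IsScalarTower k (MvPolynomial (Fin 1) k) K]
    [Algebra.FormallyUnramified (MvPolynomial (Fin 1) k) K]
    [Algebra.EssFiniteType (MvPolynomial (Fin 1) k) K] : ∃ t : K, FiniteDimensional k⟮t⟯ K := by
  let P := MvPolynomial (Fin 1) k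
  let t : K := algebraMap P K (MvPolynomial.X 0)
  refine ⟨t, ?_⟩
  let ψ : P →ₐ[k] k⟮t⟯ := MvPolynomial.aeval fun _ => ⟨t, mem_adjoin_simple_self k t⟩
  let _ : Algebra P k⟮t⟯ := ψ.toRingHom.toAlgebra
  have h : (IsScalarTower.toAlgHom k P K) = (IsScalarTower.toAlgHom k k⟮t⟯ K).comp ψ := by
    ext i
    simp [ψ, t, P, Subsingleton.elim i 0]
  have : IsScalarTower P k⟮t⟯ K := IsScalarTower.of_algebraMap_eq fun x => DFunLike.congr_fun h x
  have : Algebra.FormallyUnramified k⟮t⟯ K := .of_restrictScalars P _ _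
  have : Algebra.EssFiniteType k⟮t⟯ K := .of_comp P _ _
  exact Algebra.FormallyUnramified.finite_of_free _ _

open IntermediateField in
/-- In a function field of one variable every transcendental element can take the place of the
variable. -/
theorem finiteDimensional_adjoin_of_transcendental {k K : Type*} [Field k] [Field K] [Algebra k K] {t f : K}
    (ht : FiniteDimensional k⟮t⟯ K) (hf : Transcendental k f) : FiniteDimensional k⟮f⟯ K := by
  have h1 : Algebra.IsAlgebraic (Algebra.adjoin k {t}) K :=
    isAlgebraic_adjoin_iff_top.1 inferInstance
  have h2 : Algebra.trdeg k K ≤ 1 := by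
    simpa using Algebra.IsAlgebraic.trdeg_le_cardinalMk k ({t} : Set K)
  have h3 : AlgebraicIndependent k (fun _ : Unit => f) :=
    algebraicIndependent_unique_type_iff.2 hf
  have h4 := h3.isTranscendenceBasis_of_lift_trdeg_le_of_finite (by simpa using h2)
  have h5 : Algebra.IsAlgebraic k⟮f⟯ K := by
    have := h4.isAlgebraic
    rw [Set.range_const] at this
    exact isAlgebraic_adjoin_iff_top.2 this
  have h6 : FiniteDimensional k⟮f⟯ k⟮f⟯⟮t⟯ :=
    adjoin.finiteDimensional (Algebra.IsIntegral.isIntegral t)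
  have hle : k⟮t⟯ ≤ (k⟮f⟯⟮t⟯).restrictScalars k := by
    rw [adjoin_simple_le_iff]
    exact mem_adjoin_simple_self _ t
  let _ : Algebra k⟮t⟯ k⟮f⟯⟮t⟯ := (inclusion hle).toRingHom.toAlgebra
  have : IsScalarTower k⟮t⟯ k⟮f⟯⟮t⟯ K := IsScalarTower.of_algebraMap_eq fun x => rfl
  have : FiniteDimensional k⟮f⟯⟮t⟯ K := Module.Finite.of_restrictScalars_finite k⟮t⟯ _ _
  exact Module.Finite.trans (k⟮f⟯⟮t⟯) K

/-! ### Zeros of an element of a field on its places -/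

universe u

theorem ringOrd_ringEquiv {R S : Type*} [CommRing R] [CommRing S] (e : R ≃+* S) (a : R) :
    Ring.ord S (e a) = Ring.ord R a := by
  algebraize [e.toRingHom]
  let _ : Module R (S ⧸ Ideal.span {e a}) := Module.compHom _ e.toRingHom
  have : IsScalarTower R S (S ⧸ Ideal.span {e a}) := IsScalarTower.of_algebraMap_smul fun r x => rfl
  have h1 : Module.length R (S ⧸ Ideal.span {e a}) = Module.length S (S ⧸ Ideal.span {e a}) :=
    Module.length_eq_of_surjective e.surjective
  rw [Ring.ord, Ring.ord, ← h1]
  have h : Ideal.span {e a} = (Ideal.span {a}).map e.toRingHom := by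
    rw [Ideal.map_span]; simp
  let q : (R ⧸ Ideal.span {a}) ≃+* (S ⧸ Ideal.span {e a}) := Ideal.quotientEquiv _ _ e h
  refine (LinearEquiv.length_eq (R := R) { q with map_smul' := ?_ }).symm
  intro r x
  obtain ⟨x, rfl⟩ := Ideal.Quotient.mk_surjective x
  exact congrArg (Ideal.Quotient.mk _) (map_mul e r x)

section Places

variable {A K : Type*} [CommRing A] [IsDedekindDomain A] [Field K] [Algebra A K] [IsFractionRing A K]

/-- The elements of `K` integral at a place `V` containing the Dedekind domain `A` are the fractions
whose denominators do not vanish at `V`. -/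
theorem exists_eq_div_of_mem_valuationSubring (V : ValuationSubring K)
    (q : Ideal A) [q.IsPrime] (hq : ∀ a : A, a ∈ q ↔ algebraMap A K a ∈ V.nonunits) (hq0 : q ≠ ⊥)
      {z : K} (hz : z ∈ V) :
    ∃ a s : A, s ∉ q ∧ z * algebraMap A K s = algebraMap A K a := by
  by_cases hz0 : z = 0
  · exact ⟨0, 1, (Ideal.ne_top_iff_one _).1 (Ideal.IsPrime.ne_top ‹_›), by simp [hz0]⟩
  let L := Localization.AtPrime q
  have hle : q.primeCompl ≤ nonZeroDivisors A := q.primeCompl_le_nonZeroDivisors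
  let φ : L →+* K := IsLocalization.lift (M := q.primeCompl) (g := algebraMap A K) fun y =>
    (IsFractionRing.to_map_ne_zero_of_mem_nonZeroDivisors (hle y.2)).isUnit
  algebraize [φ]
  have : IsScalarTower A L K :=
    IsScalarTower.of_algebraMap_eq fun x => (IsLocalization.lift_eq _ x).symm
  have : IsFractionRing L K := IsFractionRing.isFractionRing_of_isDomain_of_isLocalization q.primeCompl L K
  have : IsDiscreteValuationRing L :=
    IsLocalization.AtPrime.isDiscreteValuationRing_of_dedekind_domain A hq0 L
  have key : ∀ y : L, ∃ a s : A, s ∉ q ∧ algebraMap L K y * algebraMap A K s = algebraMap A K a := by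
    intro y
    obtain ⟨⟨a, s⟩, hs⟩ := IsLocalization.surj q.primeCompl y
    refine ⟨a, s, s.2, ?_⟩
    rw [IsScalarTower.algebraMap_apply A L K, IsScalarTower.algebraMap_apply A L K, ← map_mul, hs]
  obtain ⟨y, hy⟩ | ⟨y, hy⟩ := ValuationRing.isInteger_or_isInteger L z
  · rw [← hy]; exact key y
  · obtain ⟨a, s, hs, h⟩ := key y
    rw [hy] at h
    have hs0 : algebraMap A K s ≠ 0 :=
      IsFractionRing.to_map_ne_zero_of_mem_nonZeroDivisors (hle hs)
    refine ⟨s, a, fun ha => hs ?_, by rw [← h]; field_simp⟩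
    rw [hq] at ha ⊢
    have : algebraMap A K s = z * algebraMap A K a := by rw [← h]; field_simp
    rw [this]
    rw [ValuationSubring.mem_nonunits_iff] at ha ⊢
    rw [map_mul]
    exact (mul_le_mul' ((V.valuation_le_one_iff z).2 hz) le_rfl).trans_lt (by rwa [one_mul])

/-- A valuation ring containing the Dedekind domain `A`, with nonzero center `q`, is the
localization of `A` at `q`. -/
theorem isLocalization_atPrime_valuationSubring (V : ValuationSubring K) [Algebra A V] [IsScalarTower A V K]
    (q : Ideal A) [q.IsPrime] (hq : ∀ a : A, a ∈ q ↔ algebraMap A K a ∈ V.nonunits) (hq0 : q ≠ ⊥) :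
    IsLocalization.AtPrime V q := by
  have hco : ∀ a : A, ((algebraMap A V a : V) : K) = algebraMap A K a := fun a =>
    (IsScalarTower.algebraMap_apply A V K a).symm
  refine ⟨?_, ?_, ?_⟩
  · intro s
    by_contra h
    exact s.2 ((hq _).2 (by rw [← hco]; exact V.coe_mem_nonunits_iff.2 h))
  · intro z
    obtain ⟨a, s, hs, h⟩ := exists_eq_div_of_mem_valuationSubring V q hq hq0 z.2
    refine ⟨⟨a, ⟨s, hs⟩⟩, Subtype.ext ?_⟩
    simpa [hco] using h
  · intro x y h
    refine ⟨1, ?_⟩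
    have : algebraMap A K x = algebraMap A K y := by rw [← hco, ← hco, h]
    simp [IsFractionRing.injective A K this]

end Places

/-- Valuation rings containing a Dedekind domain are determined by their center, if that is not
zero. -/
theorem valuationSubring_le_of_center_eq {A K : Type*} [CommRing A] [IsDedekindDomain A] [Field K]
    [Algebra A K] [IsFractionRing A K] {V W : ValuationSubring K} (hW : ∀ a : A, algebraMap A K a ∈ W)
    (q : Ideal A) [q.IsPrime] (hq0 : q ≠ ⊥) (hqV : ∀ a : A, a ∈ q ↔ algebraMap A K a ∈ V.nonunits)
    (hqW : ∀ a : A, a ∈ q ↔ algebraMap A K a ∈ W.nonunits) : V ≤ W := by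
  intro z hz
  obtain ⟨a, s, hs, h⟩ := exists_eq_div_of_mem_valuationSubring V q hqV hq0 hz
  have h1 : W.valuation (algebraMap A K s) = 1 :=
    le_antisymm ((W.valuation_le_one_iff _).2 (hW s))
      (not_lt.1 fun h => hs ((hqW s).2 (W.mem_nonunits_iff.2 h)))
  rw [← W.valuation_le_one_iff]
  have := congrArg W.valuation h
  rw [map_mul, h1, mul_one] at this
  rw [this, W.valuation_le_one_iff]
  exact hW a

/-- The order of vanishing at a place of an element of the field, with value `0` for elements that
have a pole. -/
def zeroOrder {K : Type*} [Field K] (V : ValuationSubring K) (f : K) : ℕ :=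
  open Classical in if h : f ∈ V then (Ring.ord V ⟨f, h⟩).toNat else 0

/-- Let `A` be a Dedekind domain, finite over `R` and with fraction field `K`, and let `(f)` be a
maximal ideal of `R` with algebraically closed residue field. The places of `K` above `(f)` are the
localizations of `A` at the primes above `(f)`, so the claim is the formula `∑ eᵢ fᵢ = n` with all
`fᵢ = 1`. -/
theorem finsum_zeroOrder_eq_finrank_of_isDedekindDomain {k R : Type u} {A K : Type*} [Field k]
    [IsAlgClosed k] [CommRing R] [IsDomain R]
    [CommRing A] [IsDedekindDomain A] [Field K] [Algebra k R] [Algebra k K] [Algebra R A]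
      [Algebra A K] [Algebra R K]
    [IsScalarTower k R K] [IsScalarTower R A K] [IsIntegralClosure A R K]
    [IsFractionRing A K] [Module.Finite R A] [Module.Free R A]
    {f : R} (hf0 : algebraMap R K f ≠ 0) (hadj : Algebra.adjoin k {f} = ⊤) (hu : ¬ IsUnit f) :
    {V : ValuationSubring K | (∀ c : k, algebraMap k K c ∈ V) ∧ algebraMap R K f ∈ V.nonunits}.Finite ∧
    ∑ᶠ V ∈ {V : ValuationSubring K | (∀ c : k, algebraMap k K c ∈ V) ∧ algebraMap R K f ∈ V.nonunits},
      zeroOrder V (algebraMap R K f) = Module.finrank R A := by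
  let p : Ideal R := Ideal.span {f}
  have hp1 : p ≠ ⊤ := fun h => hu (Ideal.span_singleton_eq_top.1 h)
  have hp0 : p ≠ ⊥ := fun h => hf0 (by rw [Ideal.span_singleton_eq_bot.1 h, map_zero])
  have hfp : f ∈ p := Ideal.mem_span_singleton_self f
  have : Nontrivial (R ⧸ p) := Ideal.Quotient.nontrivial_iff.2 hp1
  -- the residue field of `(f)` is `k`, because `f` generates `R`
  have hsurj : Function.Bijective (algebraMap k (R ⧸ p)) := by
    refine ⟨(algebraMap k (R ⧸ p)).injective, fun y => ?_⟩
    obtain ⟨y, rfl⟩ := Ideal.Quotient.mk_surjective y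
    have : Algebra.adjoin k {f} ≤ (⊥ : Subalgebra k (R ⧸ p)).comap (Ideal.Quotient.mkₐ k p) := by
      rw [Algebra.adjoin_le_iff, Set.singleton_subset_iff]
      change Ideal.Quotient.mk p f ∈ (⊥ : Subalgebra k (R ⧸ p))
      rw [Ideal.Quotient.eq_zero_iff_mem.2 hfp]
      exact zero_mem _
    rw [hadj] at this
    exact Algebra.mem_bot.1 (this (Algebra.mem_top : y ∈ ⊤))
  have hpm : p.IsMaximal := Ideal.Quotient.maximal_of_isField _
    ((RingEquiv.ofBijective _ hsurj).symm.toMulEquiv.isField (Field.toIsField k))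
  have hfin : (p.primesOver A).Finite := Algebra.QuasiFinite.finite_primesOver p
  -- residue fields above `(f)` are algebraic over `k`, hence equal to it
  have hin : ∀ q ∈ p.primesOver A, q.inertiaDeg R = 1 := by
    rintro q ⟨hq, hqp⟩
    have : q.IsMaximal := Ideal.IsMaximal.of_liesOver_isMaximal q p
    rw [Ideal.inertiaDeg_eq_of_isMaximal p q]
    let _ : Field (R ⧸ p) := Ideal.Quotient.field p
    have : IsAlgClosed (R ⧸ p) := IsAlgClosed.of_ringEquiv k _ (RingEquiv.ofBijective _ hsurj)
    have hb : Function.Bijective (algebraMap (R ⧸ p) (A ⧸ q)) :=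
      IsAlgClosed.algebraMap_bijective_of_isIntegral
    rw [← (LinearEquiv.ofBijective (Algebra.linearMap (R ⧸ p) (A ⧸ q)) hb).finrank_eq]
    exact Module.finrank_self _
  let S := {V : ValuationSubring K | (∀ c : k, algebraMap k K c ∈ V) ∧ algebraMap R K f ∈ V.nonunits}
  have hRV : ∀ V ∈ S, ∀ a : R, algebraMap R K a ∈ V := by
    rintro V ⟨hk, hV⟩ a
    have ha : a ∈ Algebra.adjoin k {f} := hadj ▸ Algebra.mem_top
    induction ha using Algebra.adjoin_induction with
    | mem x hx => rw [Set.mem_singleton_iff.1 hx]; exact V.nonunits_subset hV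
    | algebraMap c => rw [← IsScalarTower.algebraMap_apply]; exact hk c
    | add x y _ _ hx hy => rw [map_add]; exact add_mem hx hy
    | mul x y _ _ hx hy => rw [map_mul]; exact mul_mem hx hy
  -- valuation rings are integrally closed, so a place that contains `R` contains `A`
  have hAV : ∀ V ∈ S, ∀ a : A, algebraMap A K a ∈ V := by
    intro V hV a
    let φ : R →+* V := (algebraMap R K).codRestrict V.toSubring (hRV V hV)
    algebraize [φ]
    have : IsScalarTower R V K := IsScalarTower.of_algebraMap_eq fun x => rfl
    have h1 : IsIntegral R (algebraMap A K a) :=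
      (IsIntegralClosure.isIntegral R K a).map (IsScalarTower.toAlgHom R A K)
    obtain ⟨y, hy⟩ := (IsIntegrallyClosed.isIntegral_iff (R := V)).1 (h1.tower_top (A := V))
    rw [← hy]
    exact y.2
  -- the center of a place on `A`
  let c : ValuationSubring K → Ideal A := fun V => open Classical in
    if h : ∀ a : A, algebraMap A K a ∈ V then
      (IsLocalRing.maximalIdeal V).comap ((algebraMap A K).codRestrict V.toSubring h) else ⊤
  have hc' : ∀ V : ValuationSubring K, (∀ a : A, algebraMap A K a ∈ V) → (c V).IsPrime ∧
      ∀ a : A, a ∈ c V ↔ algebraMap A K a ∈ V.nonunits := by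
    intro V hV
    simp only [c, dif_pos hV]
    refine ⟨Ideal.comap_isPrime _ _, fun a => ?_⟩
    rw [Ideal.mem_comap]
    exact (V.coe_mem_nonunits_iff).symm
  have hcp : ∀ V ∈ S, (c V).IsPrime := fun V hV => (hc' V (hAV V hV)).1
  have hc : ∀ V ∈ S, ∀ a : A, a ∈ c V ↔ algebraMap A K a ∈ V.nonunits :=
    fun V hV => (hc' V (hAV V hV)).2
  have hfA : algebraMap A K (algebraMap R A f) = algebraMap R K f :=
    (IsScalarTower.algebraMap_apply R A K f).symm
  have hfc : ∀ V ∈ S, algebraMap R A f ∈ c V := fun V hV => by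
    rw [hc V hV, hfA]
    exact hV.2
  have hc0 : ∀ V ∈ S, c V ≠ ⊥ := by
    intro V hV h
    have h1 := hfc V hV
    rw [h, Ideal.mem_bot] at h1
    exact hf0 (by rw [← hfA, h1, map_zero])
  have hlies : ∀ V ∈ S, (c V).LiesOver p := by
    intro V hV
    have := hcp V hV
    refine ⟨hpm.eq_of_le (Ideal.IsPrime.ne_top inferInstance) ?_⟩
    exact (Ideal.span_singleton_le_iff_mem _).2 (hfc V hV)
  have hbij : Set.BijOn c S (p.primesOver A) := by
    refine ⟨fun V hV => ⟨hcp V hV, hlies V hV⟩, fun V hV W hW h => ?_, ?_⟩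
    · have := hcp V hV
      exact le_antisymm
        (valuationSubring_le_of_center_eq (hAV W hW) (c V) (hc0 V hV) (hc V hV) (h ▸ hc W hW))
        (valuationSubring_le_of_center_eq (hAV V hV) (c V) (hc0 V hV) (h ▸ hc W hW) (hc V hV))
    · rintro q ⟨hq, hqp⟩
      have hq0 : q ≠ ⊥ := Ideal.ne_bot_of_liesOver_of_ne_bot hp0 q
      let v : IsDedekindDomain.HeightOneSpectrum A := ⟨q, hq, hq0⟩
      let V := (v.valuation K).valuationSubring
      have hV : ∀ a : A, algebraMap A K a ∈ V := fun a => v.valuation_le_one a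
      have hqV : ∀ a : A, algebraMap A K a ∈ V.nonunits ↔ a ∈ q := by
        intro a
        rw [← v.valuation_lt_one_iff_mem (K := K), ValuationSubring.mem_nonunits_iff]
        exact ((v.valuation K).isEquiv_valuation_valuationSubring.lt_one_iff_lt_one).symm
      refine ⟨V, ⟨fun x => ?_, ?_⟩, ?_⟩
      · rw [IsScalarTower.algebraMap_apply k R K, IsScalarTower.algebraMap_apply R A K]
        exact hV _
      · rw [← hfA, hqV, ← Ideal.mem_of_liesOver q p]
        exact hfp
      · ext a
        rw [(hc' V hV).2, hqV]
  -- as `f` generates the prime of `R`, its order at a place is the ramification index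
  have hord : ∀ V ∈ S, zeroOrder V (algebraMap R K f) = (c V).ramificationIdx R := by
    intro V hV
    have := hcp V hV
    have := hlies V hV
    have hfV : algebraMap R K f ∈ V := hRV V hV f
    let φ : A →+* V := (algebraMap A K).codRestrict V.toSubring (hAV V hV)
    algebraize [φ]
    have : IsScalarTower A V K := IsScalarTower.of_algebraMap_eq fun x => rfl
    have := isLocalization_atPrime_valuationSubring V (c V) (hc V hV) (hc0 V hV)
    let e := IsLocalization.algEquiv (c V).primeCompl (Localization.AtPrime (c V)) V
    rw [zeroOrder, dif_pos hfV, Ideal.ramificationIdx_eq p, Ideal.map_span, Set.image_singleton]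
    change _ = (Ring.ord _ _).toNat
    rw [← ringOrd_ringEquiv e.toRingEquiv]
    congr 2
    apply Subtype.ext
    rw [IsScalarTower.algebraMap_apply R A (Localization.AtPrime (c V))]
    have : e (algebraMap A _ (algebraMap R A f)) = algebraMap A V (algebraMap R A f) := e.commutes _
    exact hfA.symm.trans (congrArg Subtype.val this).symm
  refine ⟨hfin.of_injOn hbij.mapsTo hbij.injOn, ?_⟩
  rw [finsum_mem_eq_of_bijOn c hbij (g := fun q => q.ramificationIdx R) hord]
  have := hfin.fintype
  rw [← Ideal.sum_ramification_inertia_eq_finrank p A, finsum_mem_eq_finite_toFinset_sum _ hfin]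
  rw [← Finset.sum_coe_sort]
  refine Finset.sum_bij' (fun x _ => ⟨x.1, hfin.mem_toFinset.1 x.2⟩)
    (fun x _ => ⟨x.1, hfin.mem_toFinset.2 x.2⟩) (by simp) (by simp) (by simp) (by simp) ?_
  intro x _
  simp [hin x.1 (hfin.mem_toFinset.1 x.2)]

open IntermediateField algebraAdjoinAdjoin in
/-- The zeros of `f`, counted with multiplicity, are as many as the degree of `K` over `k(f)`. -/
theorem finsum_zeroOrder_eq_finrank {k K : Type u} [Field k] [IsAlgClosed k] [CharZero k] [Field K]
    [Algebra k K]
    {f : K} (hf : Transcendental k f) [FiniteDimensional k⟮f⟯ K] :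
    {V : ValuationSubring K | (∀ c : k, algebraMap k K c ∈ V) ∧ f ∈ V.nonunits}.Finite ∧
    ∑ᶠ V ∈ {V : ValuationSubring K | (∀ c : k, algebraMap k K c ∈ V) ∧ f ∈ V.nonunits}, zeroOrder V f =
      Module.finrank k⟮f⟯ K := by
  let R := Algebra.adjoin k {f}
  let e : Polynomial k ≃ₐ[k] R := Polynomial.algEquivOfTranscendental k f hf
  have hPID : IsPrincipalIdealRing R :=
      IsPrincipalIdealRing.of_surjective e.toRingEquiv.toRingHom e.surjective
  let A := integralClosure R K
  let F := k⟮f⟯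
  have : CharZero F := charZero_of_injective_algebraMap (algebraMap k F).injective
  have : IsDedekindDomain A := integralClosure.isDedekindDomain R F K
  have : IsFractionRing A K := IsIntegralClosure.isFractionRing_of_finite_extension R F K A
  have : Module.Finite R A := IsIntegralClosure.finite R F K A
  have : Module.Free R A := IsIntegralClosure.module_free R F K A
  have hrank : Module.finrank R A = Module.finrank F K := IsIntegralClosure.rank R F K A
  let f' : R := ⟨f, Algebra.self_mem_adjoin_singleton k f⟩
  have hf0 : f ≠ 0 := fun h => hf (h ▸ isAlgebraic_zero)
  have hef : e Polynomial.X = f' := by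
    apply Subtype.ext
    simp [e, f', Polynomial.algEquivOfTranscendental]
  rw [← hrank]
  refine finsum_zeroOrder_eq_finrank_of_isDedekindDomain (f := f') hf0 ?_ ?_
  · rw [← hef, ← Set.image_singleton, ← AlgEquiv.coe_toAlgHom, ← AlgHom.map_adjoin, Polynomial.adjoin_X,
      Algebra.map_top, AlgHom.range_eq_top]
    exact e.surjective
  · intro h
    rw [← hef] at h
    exact Polynomial.not_isUnit_X ((MulEquiv.isUnit_map e).1 h)

/-- A nonconstant function has as many zeros as poles, counted with multiplicity. -/
theorem finsum_zeroOrder_eq_finsum_zeroOrder_inv {k K : Type u} [Field k] [IsAlgClosed k]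
    [CharZero k] [Field K] [Algebra k K]
    {f : K} (hf : Transcendental k f) [FiniteDimensional (IntermediateField.adjoin k {f}) K] :
    ∑ᶠ V ∈ {V : ValuationSubring K | (∀ c : k, algebraMap k K c ∈ V) ∧ f ∈ V.nonunits}, zeroOrder V f =
    ∑ᶠ V ∈ {V : ValuationSubring K | (∀ c : k, algebraMap k K c ∈ V) ∧ f⁻¹ ∈ V.nonunits},
      zeroOrder V f⁻¹ := by
  have hf' : Transcendental k f⁻¹ := fun h => hf (inv_inv f ▸ h.inv)
  have he : IntermediateField.adjoin k {f⁻¹} = IntermediateField.adjoin k {f} := by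
    refine le_antisymm ?_ ?_
    · rw [IntermediateField.adjoin_simple_le_iff]
      exact inv_mem (IntermediateField.mem_adjoin_simple_self k f)
    · rw [IntermediateField.adjoin_simple_le_iff]
      simpa using inv_mem (IntermediateField.mem_adjoin_simple_self k f⁻¹)
  have : FiniteDimensional (IntermediateField.adjoin k {f⁻¹}) K := he ▸ ‹_›
  rw [(finsum_zeroOrder_eq_finrank hf).2, (finsum_zeroOrder_eq_finrank hf').2, he]

/-! ### Local rings and places of a curve -/

namespace SmoothProjectiveCurve

variable (C : SmoothProjectiveCurve)

/-- The ring homomorphism from the scalars to the global functions. -/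
def scalars : CommRingCat.of ℂ ⟶ Γ(C.X, ⊤) := (Scheme.ΓSpecIso (CommRingCat.of ℂ)).inv ≫ C.str.appTop

/-- The local rings of the curve are algebras over the scalars. At the generic point this is the
structure of `ℂ`-algebra on the function field. -/
instance (x : C.X) : Algebra ℂ (C.X.presheaf.stalk x) :=
  (C.scalars ≫ C.X.presheaf.germ ⊤ x (TopologicalSpace.Opens.mem_top x)).hom.toAlgebra

instance (x : C.X) : IsScalarTower ℂ (C.X.presheaf.stalk x) C.X.functionField := by
  refine IsScalarTower.of_algebraMap_eq' ?_
  change (C.scalars ≫ C.X.presheaf.germ ⊤ _ (TopologicalSpace.Opens.mem_top _)).hom =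
    ((C.scalars ≫ C.X.presheaf.germ ⊤ x (TopologicalSpace.Opens.mem_top x)) ≫
      C.X.presheaf.stalkSpecializes _).hom
  rw [Category.assoc, C.X.presheaf.germ_stalkSpecializes]

theorem toSpecΓ_comp_specMap_scalars : C.X.toSpecΓ ≫ Spec.map C.scalars = C.str := by
  rw [scalars, Spec.map_comp, ← Category.assoc, ← Scheme.toSpecΓ_naturality]
  simp

theorem fromSpecStalk_comp_str (x : C.X) :
    C.X.fromSpecStalk x ≫ C.str = Spec.map (CommRingCat.ofHom (algebraMap ℂ (C.X.presheaf.stalk x))) := by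
  rw [← toSpecΓ_comp_specMap_scalars, Scheme.fromSpecStalk_toSpecΓ_assoc, ← Spec.map_comp]
  rfl

/-- A standard smooth neighborhood of a point, with the scalars as the base ring: the only nonempty
open subset of `Spec ℂ` is the whole of it. -/
theorem exists_isStandardSmooth (x : C.X) : ∃ (V : C.X.Opens) (_ : IsAffineOpen V) (_ : x ∈ V),
    RingHom.IsStandardSmoothOfRelativeDimension 1
      (C.scalars ≫ C.X.presheaf.map (homOfLE le_top).op : CommRingCat.of ℂ ⟶ Γ(C.X, V)).hom := by
  have := C.smooth
  obtain ⟨U, hU, V, hV, hx, e, h⟩ := this.exists_isStandardSmoothOfRelativeDimension x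
  -- the base `Spec ℂ` has only one point
  have hUt : U = ⊤ := by
    ext y
    simp only [TopologicalSpace.Opens.coe_top, Set.mem_univ, iff_true]
    have : Subsingleton (Spec (CommRingCat.of ℂ)) := inferInstanceAs (Subsingleton (PrimeSpectrum ℂ))
    rw [Subsingleton.elim y (C.str x)]
    exact e hx
  subst hUt
  exact ⟨V, hV, hx, RingHom.isStandardSmoothOfRelativeDimension_respectsIso.2 (C.str.appLE ⊤ V e).hom
    (Scheme.ΓSpecIso (CommRingCat.of ℂ)).commRingCatIsoToRingEquiv.symm h⟩

theorem exists_etale (x : C.X) : ∃ (V : C.X.Opens) (_ : IsAffineOpen V) (_ : x ∈ V)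
    (g : MvPolynomial (Fin 1) ℂ →+* Γ(C.X, V)), g.Etale ∧
      g.comp MvPolynomial.C = (C.scalars ≫ C.X.presheaf.map (homOfLE le_top).op).hom := by
  obtain ⟨V, hV, hx, h⟩ := C.exists_isStandardSmooth x
  obtain ⟨g, hg, hg'⟩ := h.exists_etale_mvPolynomial
  exact ⟨V, hV, hx, g, hg', hg⟩

/-- The local ring at a point is unramified over `ℂ[T]`, as the curve is étale over the affine line
near the point. -/
theorem exists_formallyUnramified (x : C.X) : ∃ _ : Algebra (MvPolynomial (Fin 1) ℂ) (C.X.presheaf.stalk x),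
    IsScalarTower ℂ (MvPolynomial (Fin 1) ℂ) (C.X.presheaf.stalk x) ∧
    Algebra.FormallyUnramified (MvPolynomial (Fin 1) ℂ) (C.X.presheaf.stalk x) ∧
    Algebra.EssFiniteType (MvPolynomial (Fin 1) ℂ) (C.X.presheaf.stalk x) := by
  obtain ⟨V, hV, hx, g, hg, hgC⟩ := C.exists_etale x
  let _ : Algebra (MvPolynomial (Fin 1) ℂ) Γ(C.X, V) := g.toAlgebra
  have : Algebra.Etale (MvPolynomial (Fin 1) ℂ) Γ(C.X, V) := RingHom.etale_algebraMap.1 hg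
  let _ : Algebra Γ(C.X, V) (C.X.presheaf.stalk x) := (C.X.presheaf.germ V x hx).hom.toAlgebra
  have := hV.isLocalization_stalk ⟨x, hx⟩
  let _ : Algebra (MvPolynomial (Fin 1) ℂ) (C.X.presheaf.stalk x) :=
    ((C.X.presheaf.germ V x hx).hom.comp g).toAlgebra
  have : IsScalarTower (MvPolynomial (Fin 1) ℂ) Γ(C.X, V) (C.X.presheaf.stalk x) :=
    IsScalarTower.of_algebraMap_eq fun _ => rfl
  have : Algebra.FormallyUnramified Γ(C.X, V) (C.X.presheaf.stalk x) :=
    .of_isLocalization (hV.primeIdealOf ⟨x, hx⟩).asIdeal.primeCompl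
  have : Algebra.EssFiniteType Γ(C.X, V) (C.X.presheaf.stalk x) :=
    .of_isLocalization _ (hV.primeIdealOf ⟨x, hx⟩).asIdeal.primeCompl
  refine ⟨inferInstance, ?_, .comp _ Γ(C.X, V) _, .comp _ Γ(C.X, V) _⟩
  refine IsScalarTower.of_algebraMap_eq' ?_
  change (C.scalars ≫ C.X.presheaf.germ ⊤ x (TopologicalSpace.Opens.mem_top x)).hom =
    ((C.X.presheaf.germ V x hx).hom.comp g).comp MvPolynomial.C
  rw [RingHom.comp_assoc, hgC, ← C.X.presheaf.germ_res (homOfLE le_top) x hx]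
  rfl

/-- The local rings of the curve, also that of the generic point, are principal ideal domains. -/
instance (x : C.X) : IsPrincipalIdealRing (C.X.presheaf.stalk x) := by
  obtain ⟨_, -, _, _⟩ := C.exists_formallyUnramified x
  have := isPrincipalIdealRing_mvPolynomial_fin_one ℂ
  exact isPrincipalIdealRing_of_isLocalRing _
    (isPrincipal_maximalIdeal_of_formallyUnramified (MvPolynomial (Fin 1) ℂ) _)

theorem exists_finiteDimensional_adjoin :
  ∃ t : C.X.functionField, FiniteDimensional (IntermediateField.adjoin ℂ {t}) C.X.functionField := by
  obtain ⟨_, _, _, _⟩ := C.exists_formallyUnramified (genericPoint C.X)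
  exact OrthBundle.exists_finiteDimensional_adjoin ℂ C.X.functionField

theorem mem_or_inv_mem_range (x : C.X) (z : C.X.functionField) :
    z ∈ (algebraMap (C.X.presheaf.stalk x) C.X.functionField).range ∨
      z⁻¹ ∈ (algebraMap (C.X.presheaf.stalk x) C.X.functionField).range :=
  ValuationRing.isInteger_or_isInteger (C.X.presheaf.stalk x) z

/-- The local ring of a point of the curve as a valuation ring of the function field. -/
def place (x : C.X) : ValuationSubring C.X.functionField :=
  ValuationSubring.ofSubring (algebraMap (C.X.presheaf.stalk x) C.X.functionField).range
    (C.mem_or_inv_mem_range x)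

theorem algebraMap_mem_place (x : C.X) (c : ℂ) : algebraMap ℂ C.X.functionField c ∈ C.place x := by
  rw [IsScalarTower.algebraMap_apply ℂ (C.X.presheaf.stalk x)]
  exact ⟨_, rfl⟩

/-- The local ring of a point is isomorphic to the corresponding valuation ring. -/
def stalkEquivPlace (x : C.X) : C.X.presheaf.stalk x ≃+* C.place x :=
  RingEquiv.ofBijective ((algebraMap (C.X.presheaf.stalk x) C.X.functionField).codRestrict
    (C.place x).toSubring fun a => ⟨a, rfl⟩)
    ⟨fun _ _ h => IsFractionRing.injective (C.X.presheaf.stalk x) C.X.functionField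
      (congrArg Subtype.val h), fun ⟨_, a, ha⟩ => ⟨a, Subtype.ext ha⟩⟩

theorem fromSpecStalk_eq_specMap_algebraMap (x : C.X) :
    C.X.fromSpecStalk (genericPoint C.X) =
      Spec.map (CommRingCat.ofHom (algebraMap (C.X.presheaf.stalk x) C.X.functionField)) ≫
        C.X.fromSpecStalk x :=
  (Scheme.SpecMap_stalkSpecializes_fromSpecStalk (genericPoint_specializes x)).symm

/-- The inclusion of the scalars into a valuation ring of the function field that contains them. -/
def scalarsTo {V : ValuationSubring C.X.functionField} (hV : ∀ c : ℂ, algebraMap ℂ C.X.functionField c ∈ V) :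
    ℂ →+* V := (algebraMap ℂ C.X.functionField).codRestrict V.toSubring hV

/-- A valuation ring of the function field that contains the scalars gives a square for the
valuative criterion. -/
def valuativeCommSq (V : ValuationSubring C.X.functionField)
    (hV : ∀ c : ℂ, algebraMap ℂ C.X.functionField c ∈ V) :
    ValuativeCommSq C.str where
  R := V
  K := C.X.functionField
  i₁ := C.X.fromSpecStalk (genericPoint C.X)
  i₂ := Spec.map (CommRingCat.ofHom (C.scalarsTo hV))
  commSq := ⟨by
    rw [C.fromSpecStalk_comp_str, ← Spec.map_comp]
    rfl⟩

/-- The points of a separated curve are determined by their local rings in the function field. -/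
theorem place_injective : Function.Injective C.place := by
  intro x y h
  have := C.proper
  -- both points are images of the closed point under a lift in the valuative square of `C.place y`
  let S := C.valuativeCommSq (C.place y) (C.algebraMap_mem_place y)
  have hu : Subsingleton S.commSq.LiftStruct := IsSeparated.valuativeCriterion C.str S
  have key : ∀ z (hz : C.place z = C.place y), ∃ l : S.commSq.LiftStruct,
      l.l (IsLocalRing.closedPoint (C.place y)) = z := by
    intro z hz
    let φ : C.X.presheaf.stalk z ≃+* C.place y := (C.stalkEquivPlace z).trans (RingEquiv.subringCongr
      (congrArg ValuationSubring.toSubring hz))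
    have hφ : IsLocalHom (CommRingCat.ofHom φ.toRingHom).hom := ⟨fun _ ha => (MulEquiv.isUnit_map φ).1 ha⟩
    refine ⟨⟨Spec.map (CommRingCat.ofHom φ.toRingHom) ≫ C.X.fromSpecStalk z, ?_, ?_⟩, ?_⟩
    · change _ = C.X.fromSpecStalk (genericPoint C.X)
      rw [C.fromSpecStalk_eq_specMap_algebraMap z, ← Category.assoc, ← Spec.map_comp]
      rfl
    · rw [Category.assoc, C.fromSpecStalk_comp_str, ← Spec.map_comp]
      change _ = Spec.map (CommRingCat.ofHom (C.scalarsTo _))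
      congr 2
      ext c
      apply Subtype.ext
      exact (IsScalarTower.algebraMap_apply ℂ (C.X.presheaf.stalk z) C.X.functionField c).symm
    · exact (congrArg (C.X.fromSpecStalk z) (IsLocalRing.comap_closedPoint φ.toRingHom)).trans
        Scheme.fromSpecStalk_closedPoint
  obtain ⟨l, hl⟩ := key x h
  obtain ⟨l', hl'⟩ := key y rfl
  exact hl.symm.trans ((congrArg (fun l => l.l (IsLocalRing.closedPoint (C.place y)))
    (Subsingleton.elim l l')).trans hl')

/-- On a proper curve every valuation ring of the function field that contains the scalars
dominates, and hence equals, the local ring of a point. -/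
theorem exists_place_eq (V : ValuationSubring C.X.functionField)
    (hV : ∀ c : ℂ, algebraMap ℂ C.X.functionField c ∈ V) :
    ∃ x, C.place x = V := by
  have hp := C.proper
  let S := C.valuativeCommSq V hV
  rw [IsProper.eq_valuativeCriterion] at hp
  -- the lift provided by properness sends the closed point to the center of `V` on the curve
  obtain ⟨⟨l⟩⟩ := hp.1.1.1.existence S
  have hl : Spec.map (CommRingCat.ofHom (algebraMap V C.X.functionField)) ≫ l.l =
    C.X.fromSpecStalk (genericPoint C.X) := l.fac_left
  let f : Spec (CommRingCat.of V) ⟶ C.X := l.l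
  let x : C.X := f (IsLocalRing.closedPoint V)
  let φ : C.X.presheaf.stalk x →+* V := (Scheme.stalkClosedPointTo f).hom
  have hφloc : IsLocalHom φ := Scheme.isLocalHom_stalkClosedPointTo' f
  have hφ : ∀ a, (φ a : C.X.functionField) = algebraMap _ _ a := by
    have h1 : Spec.map (Scheme.stalkClosedPointTo f) ≫ C.X.fromSpecStalk x = f :=
      Scheme.Spec_stalkClosedPointTo_fromSpecStalk f
    have h2 : Spec.map (Scheme.stalkClosedPointTo f ≫ CommRingCat.ofHom (algebraMap V C.X.functionField)) =
        Spec.map (CommRingCat.ofHom (algebraMap (C.X.presheaf.stalk x) C.X.functionField)) := by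
      rw [← cancel_mono (C.X.fromSpecStalk x), ← C.fromSpecStalk_eq_specMap_algebraMap x, Spec.map_comp,
        Category.assoc, h1]
      exact hl
    intro a
    exact congrArg (fun g => g.hom a) (Spec.map_injective h2)
  refine ⟨x, le_antisymm ?_ ?_⟩
  · rintro z ⟨a, rfl⟩
    change algebraMap _ _ a ∈ V
    rw [← hφ]
    exact (φ a).2
  · intro z hz
    by_contra hzx
    obtain ⟨a, ha⟩ := (C.mem_or_inv_mem_range x z).resolve_left hzx
    have hz0 : z ≠ 0 := fun h => hzx (h ▸ zero_mem _)
    have hu : IsUnit (φ a) := by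
      refine IsUnit.of_mul_eq_one ⟨z, hz⟩ (Subtype.ext ?_)
      change (φ a : C.X.functionField) * z = 1
      rw [hφ, ha, inv_mul_cancel₀ hz0]
    obtain ⟨b, hb⟩ := (isUnit_of_map_unit φ a hu).exists_right_inv
    refine hzx ⟨b, ?_⟩
    have := congrArg (algebraMap (C.X.presheaf.stalk x) C.X.functionField) hb
    rw [map_mul, ha, map_one, inv_mul_eq_one₀ hz0] at this
    exact this.symm

end SmoothProjectiveCurve

/-! ### The divisor of a rational function -/

theorem zeroOrder_eq_zero_of_inv_mem {K : Type*} [Field K] {V : ValuationSubring K} {f : K}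
    (hf : f ≠ 0) (h : f⁻¹ ∈ V) :
    zeroOrder V f = 0 := by
  unfold zeroOrder
  split_ifs with hfV
  · have hu : IsUnit (⟨f, hfV⟩ : V) := IsUnit.of_mul_eq_one ⟨f⁻¹, h⟩ (Subtype.ext (mul_inv_cancel₀ hf))
    rw [Ring.ord_of_isUnit hu]
    rfl
  · rfl

namespace SmoothProjectiveCurve

variable (C : SmoothProjectiveCurve)

theorem coheight_eq_one_of_not_isField {x : C.X} (h : ¬ IsField (C.X.presheaf.stalk x)) :
    Order.coheight x = 1 := by
  have : ringKrullDim (C.X.presheaf.stalk x) = 1 := IsPrincipalIdealRing.ringKrullDim_eq_one _ h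
  rw [ringKrullDim_stalk_eq_coheight] at this
  exact_mod_cast this

theorem coheight_ne_one_of_isField {x : C.X} (h : IsField (C.X.presheaf.stalk x)) :
    Order.coheight x ≠ 1 := by
  have : ringKrullDim (C.X.presheaf.stalk x) = 0 := ringKrullDim_eq_zero_of_isField h
  rw [ringKrullDim_stalk_eq_coheight] at this
  intro h1
  rw [h1] at this
  exact absurd this (by decide)

/-- The order of a regular germ. At the generic point, where the local ring is a field, both sides
are `0`. -/
theorem ord_algebraMap_eq_zeroOrder {x : C.X} {a : C.X.presheaf.stalk x} (ha : a ≠ 0) :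
    Scheme.ord (algebraMap _ C.X.functionField a) x =
      zeroOrder (C.place x) (algebraMap _ C.X.functionField a) := by
  have hz : zeroOrder (C.place x) (algebraMap _ C.X.functionField a) =
      (Ring.ord (C.X.presheaf.stalk x) a).toNat := by
    rw [zeroOrder, dif_pos ⟨a, rfl⟩]
    exact congrArg ENat.toNat (ringOrd_ringEquiv (C.stalkEquivPlace x) a)
  rw [hz]
  by_cases hF : IsField (C.X.presheaf.stalk x)
  · rw [Scheme.ord_eq_zero_of_coheight_neq_one (C.coheight_ne_one_of_isField hF)]
    obtain ⟨b, hb⟩ := hF.mul_inv_cancel ha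
    rw [Ring.ord_of_isUnit (IsUnit.of_mul_eq_one b hb)]
    rfl
  · have hc := C.coheight_eq_one_of_not_isField hF
    have : Ring.KrullDimLE 1 (C.X.presheaf.stalk x) := krullDimLE_of_coheight_le hc.le
    have ha' : algebraMap _ C.X.functionField a ≠ 0 := by
      simpa using ha
    have ha0 : a ∈ nonZeroDivisors (C.X.presheaf.stalk x) := mem_nonZeroDivisors_of_ne_zero ha
    rw [Scheme.ord_eq_iff hc ha']
    change Ring.ordFrac (C.X.presheaf.stalk x) _ = _
    rw [Ring.ordFrac_eq_ord _ ha]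
    exact Ring.ordMonoidWithZeroHom_eq_coe _ ha0 (ENat.natCast_toNat (Ring.ord_ne_top ha0)).symm

theorem ord_algebraMap_nonneg {x : C.X} (a : C.X.presheaf.stalk x) :
    0 ≤ Scheme.ord (algebraMap _ C.X.functionField a) x := by
  by_cases ha : a = 0
  · simp [ha]
  · rw [C.ord_algebraMap_eq_zeroOrder ha]
    exact Int.natCast_nonneg _

theorem ord_one (x : C.X) : Scheme.ord (1 : C.X.functionField) x = 0 := by
  have := Scheme.ord_mul (x := x) (one_ne_zero (α := C.X.functionField)) one_ne_zero
  rw [mul_one] at this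
  omega

theorem ord_inv {f : C.X.functionField} (hf : f ≠ 0) (x : C.X) : Scheme.ord f⁻¹ x = - Scheme.ord f x := by
  have := Scheme.ord_mul (x := x) hf (inv_ne_zero hf)
  rw [mul_inv_cancel₀ hf, C.ord_one] at this
  omega

theorem ord_algebraMap_of_isUnit {x : C.X} {a : C.X.presheaf.stalk x} (ha : IsUnit a) :
    Scheme.ord (algebraMap _ C.X.functionField a) x = 0 := by
  obtain ⟨b, hb⟩ := ha.exists_right_inv
  have ha0 : algebraMap _ C.X.functionField a ≠ 0 := by simpa using ha.ne_zero
  have hb0 : algebraMap _ C.X.functionField b ≠ 0 := by simpa using right_ne_zero_of_mul_eq_one hb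
  have := Scheme.ord_mul (x := x) ha0 hb0
  rw [← map_mul, hb, map_one, C.ord_one] at this
  have h1 := C.ord_algebraMap_nonneg a
  have h2 := C.ord_algebraMap_nonneg b
  omega

/-- The order at a point is the order of the zero minus the order of the pole; at most one of them
is not `0`. -/
theorem ord_eq_zeroOrder_sub {f : C.X.functionField} (hf : f ≠ 0) (x : C.X) :
    Scheme.ord f x = (zeroOrder (C.place x) f : ℤ) - zeroOrder (C.place x) f⁻¹ := by
  rcases C.mem_or_inv_mem_range x f with ⟨a, ha⟩ | ⟨a, ha⟩
  · have h : zeroOrder (C.place x) f⁻¹ = 0 :=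
      zeroOrder_eq_zero_of_inv_mem (inv_ne_zero hf) (by rw [inv_inv]; exact ⟨a, ha⟩)
    have ha0 : a ≠ 0 := by rintro rfl; exact hf (by rw [← ha, map_zero])
    rw [h, ← ha, C.ord_algebraMap_eq_zeroOrder ha0]
    simp
  · have h : zeroOrder (C.place x) f = 0 := zeroOrder_eq_zero_of_inv_mem hf ⟨a, ha⟩
    have ha0 : a ≠ 0 := by rintro rfl; exact inv_ne_zero hf (by rw [← ha, map_zero])
    have := C.ord_algebraMap_eq_zeroOrder ha0
    rw [ha, C.ord_inv hf] at this
    rw [h]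
    push_cast
    omega

open Classical in
/-- The zeros of `f` on the curve are those on the places of the function field, which correspond to
the points of the curve. -/
theorem finite_support_and_finsum_zeroOrder_place {f : C.X.functionField} (hf : Transcendental ℂ f)
    [FiniteDimensional (IntermediateField.adjoin ℂ {f}) C.X.functionField] :
    (Function.support fun x => zeroOrder (C.place x) f).Finite ∧
    ∑ᶠ x, zeroOrder (C.place x) f =
      ∑ᶠ V ∈ {V : ValuationSubring C.X.functionField |
        (∀ c : ℂ, algebraMap ℂ C.X.functionField c ∈ V) ∧ f ∈ V.nonunits},
        zeroOrder V f := by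
  have hf0 : f ≠ 0 := fun h => hf (h ▸ isAlgebraic_zero)
  have hsupp : ∀ x, zeroOrder (C.place x) f ≠ 0 → f ∈ (C.place x).nonunits := by
    intro x hx
    by_contra h
    refine hx (zeroOrder_eq_zero_of_inv_mem hf0 ?_)
    rw [ValuationSubring.mem_nonunits_iff, not_lt] at h
    rw [← ValuationSubring.valuation_le_one_iff, map_inv₀]
    exact inv_le_one_of_one_le₀ h
  have hfin := (finsum_zeroOrder_eq_finrank hf).1
  have hmaps : Set.MapsTo C.place (Function.support fun x => zeroOrder (C.place x) f)
      {V | (∀ c : ℂ, algebraMap ℂ C.X.functionField c ∈ V) ∧ f ∈ V.nonunits} :=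
    fun x hx => ⟨C.algebraMap_mem_place x, hsupp x hx⟩
  refine ⟨Set.Finite.of_injOn hmaps C.place_injective.injOn hfin, ?_⟩
  have h1 : {V : ValuationSubring C.X.functionField |
      (∀ c : ℂ, algebraMap ℂ C.X.functionField c ∈ V) ∧ f ∈ V.nonunits} =
      C.place '' {x | f ∈ (C.place x).nonunits} := by
    ext V
    constructor
    · rintro ⟨h1, h2⟩
      obtain ⟨x, rfl⟩ := C.exists_place_eq V h1
      exact ⟨x, h2, rfl⟩
    · rintro ⟨x, hx, rfl⟩
      exact ⟨C.algebraMap_mem_place x, hx⟩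
  rw [h1, finsum_mem_image C.place_injective.injOn]
  refine finsum_congr fun x => ?_
  rw [finsum_eq_if]
  split_ifs with h
  · rfl
  · by_contra h2
    exact h (hsupp x h2)

/-- The divisor of a nonzero rational function is finite and has degree `0`. A function that is
algebraic over `ℂ` is constant and a unit everywhere. -/
theorem finite_support_ord_and_finsum_ord {f : C.X.functionField} (hf : f ≠ 0) :
    (Function.support (Scheme.ord f)).Finite ∧ ∑ᶠ x, Scheme.ord f x = 0 := by
  by_cases ht : Transcendental ℂ f
  · obtain ⟨t, _⟩ := C.exists_finiteDimensional_adjoin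
    have : FiniteDimensional (IntermediateField.adjoin ℂ {f}) C.X.functionField :=
      finiteDimensional_adjoin_of_transcendental ‹_› ht
    have ht' : Transcendental ℂ f⁻¹ := fun h => ht (inv_inv f ▸ h.inv)
    have : FiniteDimensional (IntermediateField.adjoin ℂ {f⁻¹}) C.X.functionField :=
      finiteDimensional_adjoin_of_transcendental ‹_› ht'
    obtain ⟨h1, h2⟩ := C.finite_support_and_finsum_zeroOrder_place ht
    obtain ⟨h1', h2'⟩ := C.finite_support_and_finsum_zeroOrder_place ht'
    have h3 : Scheme.ord f = fun x => ((zeroOrder (C.place x) f : ℤ) - zeroOrder (C.place x) f⁻¹) :=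
      funext fun x => C.ord_eq_zeroOrder_sub hf x
    have g1 : (Function.support fun x => (zeroOrder (C.place x) f : ℤ)).Finite := by
      refine h1.subset fun x hx => ?_
      simpa using hx
    have g1' : (Function.support fun x => (zeroOrder (C.place x) f⁻¹ : ℤ)).Finite := by
      refine h1'.subset fun x hx => ?_
      simpa using hx
    rw [h3]
    refine ⟨(g1.union g1').subset (Function.support_sub _ _), ?_⟩
    rw [finsum_sub_distrib g1 g1', sub_eq_zero]
    have h4 := (h2.trans (finsum_zeroOrder_eq_finsum_zeroOrder_inv ht)).trans h2'.symm
    have c1 := (Nat.castAddMonoidHom ℤ).map_finsum h1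
    have c2 := (Nat.castAddMonoidHom ℤ).map_finsum h1'
    exact c1.symm.trans ((congrArg (Nat.castAddMonoidHom ℤ) h4).trans c2)
  · have hi : IsIntegral ℂ f := (not_not.1 ht).isIntegral
    have hc : ∃ c : ℂ, algebraMap ℂ C.X.functionField c = f := by
      have h := IsAlgClosed.degree_eq_one_of_irreducible ℂ (minpoly.irreducible hi)
      exact minpoly.degree_eq_one_iff.1 h
    obtain ⟨c, rfl⟩ := hc
    have hc0 : IsUnit c := isUnit_iff_ne_zero.2 fun h => hf (by rw [h, map_zero])
    have h0 : Scheme.ord (algebraMap ℂ C.X.functionField c) = 0 := by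
      funext x
      rw [IsScalarTower.algebraMap_apply ℂ (C.X.presheaf.stalk x)]
      exact C.ord_algebraMap_of_isUnit (hc0.map _)
    rw [h0]
    simp

end SmoothProjectiveCurve

/-! ### Lattices in vector spaces and their determinants -/

section Lattice

open Module

variable {R K V ι κ : Type*} [CommRing R] [Field K]
  [AddCommGroup V] [Module K V] [Module R V]

/-- For an `R`-lattice `L` in a `K`-vector space and a `K`-subspace `W`, the family `f` is an
`R`-basis of `L ∩ W` and a `K`-basis of `W`. -/
structure IsLatticeBasis (L : Submodule R V) (W : Submodule K V) (f : ι → V) : Prop where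
  linearIndependent : LinearIndependent K f
  span_eq : Submodule.span K (Set.range f) = W
  mem_span : ∀ v ∈ L, v ∈ W → v ∈ Submodule.span R (Set.range f)
  mem : ∀ i, f i ∈ L

namespace IsLatticeBasis

variable {L : Submodule R V} {W I : Submodule K V} {f : ι → V}

theorem mem_subspace (hf : IsLatticeBasis L W f) (i : ι) : f i ∈ W := by
  rw [← hf.span_eq]
  exact Submodule.subset_span ⟨i, rfl⟩

theorem finrank_eq_card [Fintype ι] (hf : IsLatticeBasis L W f) : finrank K W = Fintype.card ι := by
  rw [← hf.span_eq]
  exact finrank_span_eq_card hf.linearIndependent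

theorem comp_equiv (hf : IsLatticeBasis L W f) (e : κ ≃ ι) : IsLatticeBasis L W (f ∘ e) where
  linearIndependent := hf.linearIndependent.comp e e.injective
  span_eq := by rw [e.surjective.range_comp, hf.span_eq]
  mem_span v hv hv' := by rw [e.surjective.range_comp]; exact hf.mem_span v hv hv'
  mem i := hf.mem (e i)

theorem exists_coeff [Fintype ι] (hf : IsLatticeBasis L W f) {v : V} (hv : v ∈ L) (hv' : v ∈ W) :
    ∃ a : ι → R, v = ∑ i, a i • f i := by
  obtain ⟨a, ha⟩ := (Submodule.mem_span_range_iff_exists_fun R).1 (hf.mem_span v hv hv')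
  exact ⟨a, ha.symm⟩

theorem exists_coeff_field [Fintype ι] (hf : IsLatticeBasis L W f) {v : V} (hv' : v ∈ W) :
    ∃ a : ι → K, v = ∑ i, a i • f i := by
  rw [← hf.span_eq] at hv'
  obtain ⟨a, ha⟩ := (Submodule.mem_span_range_iff_exists_fun K).1 hv'
  exact ⟨a, ha.symm⟩

theorem exists_matrix [Fintype ι] (hf : IsLatticeBasis L W f) {b : κ → V} (hb : ∀ j, b j ∈ W) :
    ∃ A : Matrix ι κ K, ∀ j, b j = ∑ i, A i j • f i := by
  choose a ha using fun j => hf.exists_coeff_field (hb j)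
  exact ⟨fun i j => a j i, ha⟩

end IsLatticeBasis

/-- Coefficients with respect to linearly independent vectors are unique. -/
theorem coeff_ext [Fintype ι] {f : ι → V} (hf : LinearIndependent K f) {a b : ι → K}
    (h : ∑ i, a i • f i = ∑ i, b i • f i) : a = b := by
  funext i
  have h0 : ∑ i, (a i - b i) • f i = 0 := by
    simp only [sub_smul, Finset.sum_sub_distrib, h, sub_self]
  exact sub_eq_zero.1 (Fintype.linearIndependent_iff.1 hf _ h0 i)

theorem sum_smul_sum_smul [Fintype ι] [Fintype κ] {ρ : Type*} {f : ι → V} {g : κ → V} {h : ρ → V}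
    {A : Matrix ι κ K} {B : Matrix κ ρ K}
    (hA : ∀ j, g j = ∑ i, A i j • f i) (hB : ∀ j, h j = ∑ i, B i j • g i) (j : ρ) :
    h j = ∑ i, (A * B) i j • f i := by
  rw [hB]
  simp only [hA, Finset.smul_sum, Matrix.mul_apply, Finset.sum_smul, smul_smul]
  rw [Finset.sum_comm]
  simp only [mul_comm]

theorem matrix_ext [Fintype ι] {f : ι → V} (hf : LinearIndependent K f) {A B : Matrix ι κ K}
    (h : ∀ j, ∑ i, A i j • f i = ∑ i, B i j • f i) : A = B := by
  ext i j
  exact congrFun (coeff_ext hf (h j)) i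

theorem eq_one_of_sum_smul_eq [Fintype ι] [DecidableEq ι] {f : ι → V} (hf : LinearIndependent K f)
    {A : Matrix ι ι K} (h : ∀ j, f j = ∑ i, A i j • f i) : A = 1 := by
  refine matrix_ext hf fun j => ?_
  rw [← h]
  simp [Matrix.one_apply]

theorem det_ne_zero_of_linearIndependent [Fintype ι] [DecidableEq ι] {f b : ι → V}
    (hb : LinearIndependent K b) {A : Matrix ι ι K} (h : ∀ j, b j = ∑ i, A i j • f i) : A.det ≠ 0 := by
  intro h0
  obtain ⟨v, hv, hAv⟩ := Matrix.exists_mulVec_eq_zero_iff.2 h0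
  refine hv (funext (Fintype.linearIndependent_iff.1 hb v ?_))
  simp only [h, Finset.smul_sum, smul_smul]
  rw [Finset.sum_comm]
  simp only [← Finset.sum_smul]
  refine Finset.sum_eq_zero fun i _ => ?_
  have := congrFun hAv i
  simp only [Matrix.mulVec, dotProduct, Pi.zero_apply] at this
  rw [← zero_smul K (f i), ← this]
  simp only [mul_comm]

variable [Algebra R K] [IsScalarTower R K V]

/-- The matrix relating two bases of the same lattice is invertible over `R`. -/
theorem IsLatticeBasis.exists_isUnit_det_eq [Fintype ι] [DecidableEq ι] {L : Submodule R V}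
    {W : Submodule K V}
    {f f' : ι → V} (hinj : Function.Injective (algebraMap R K)) (hf : IsLatticeBasis L W f)
      (hf' : IsLatticeBasis L W f') {A : Matrix ι ι K}
    (h : ∀ j, f' j = ∑ i, A i j • f i) : ∃ u : R, IsUnit u ∧ algebraMap R K u = A.det := by
  choose a ha using fun j => hf.exists_coeff (hf'.mem j) (hf'.mem_subspace j)
  choose b hb using fun j => hf'.exists_coeff (hf.mem j) (hf.mem_subspace j)
  let A' : Matrix ι ι R := fun i j => a j i
  let B' : Matrix ι ι R := fun i j => b j i
  have h1 : A = A'.map (algebraMap R K) := by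
    refine matrix_ext hf.linearIndependent fun j => ?_
    rw [← h, ha]
    exact Finset.sum_congr rfl fun i _ => (algebraMap_smul K (a j i) (f i)).symm
  have h2 : ∀ j, f j = ∑ i, (B'.map (algebraMap R K)) i j • f' i := fun j => by
    rw [hb]
    exact Finset.sum_congr rfl fun i _ => (algebraMap_smul K (b j i) (f' i)).symm
  have h3 : A * B'.map (algebraMap R K) = 1 :=
    eq_one_of_sum_smul_eq hf.linearIndependent (sum_smul_sum_smul h h2)
  refine ⟨A'.det, IsUnit.of_mul_eq_one B'.det (hinj ?_), ?_⟩
  · rw [map_mul, RingHom.map_det, RingHom.map_det, RingHom.mapMatrix_apply, RingHom.mapMatrix_apply,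
      ← h1, ← Matrix.det_mul, h3,
      Matrix.det_one, map_one]
  · rw [RingHom.map_det, h1, RingHom.mapMatrix_apply]

/-- A lattice over a principal ideal domain has a basis adapted to a given flag of two subspaces. -/
theorem exists_isLatticeBasis_sum [IsDomain R] [IsPrincipalIdealRing R] [IsFractionRing R K]
    [FiniteDimensional K V] [Fintype ι] [Fintype κ]
    {L : Submodule R V} (hL : L.FG) (hLV : ∀ v : V, ∃ r : R, r ≠ 0 ∧ r • v ∈ L)
    {I W : Submodule K V} (hIW : I ≤ W) (hι : Fintype.card ι = finrank K I)
    (hκ : Fintype.card ι + Fintype.card κ = finrank K W) :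
    ∃ f : ι ⊕ κ → V, IsLatticeBasis L W f ∧ IsLatticeBasis L I (f ∘ Sum.inl) := by
  have hV : IsTorsionFree R V := IsTorsionFree.trans_faithfulSMul R K V
  have span_eq : ∀ {ρ : Type _} (g : ρ → V) (U : Submodule K V), (∀ i, g i ∈ U) →
      (∀ v ∈ L, v ∈ U → v ∈ Submodule.span R (Set.range g)) → Submodule.span K (Set.range g) = U := by
    intro ρ g U hg hs
    refine le_antisymm (Submodule.span_le.2 (Set.range_subset_iff.2 hg)) fun v hv => ?_
    obtain ⟨r, hr, hrv⟩ := hLV v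
    have h1 : r • v ∈ Submodule.span K (Set.range g) := by
      refine Submodule.span_le_restrictScalars R K _ (hs _ hrv ?_)
      rw [← algebraMap_smul K r v]
      exact U.smul_mem _ hv
    rw [← algebraMap_smul K r v] at h1
    exact (Submodule.smul_mem_iff _ (by simpa using hr)).1 h1
  -- `M / N` embeds in `V / I`, so it is torsion-free and finite, hence free, and `N` splits off
  let M : Submodule R V := L ⊓ W.restrictScalars R
  let N : Submodule R M := (I.restrictScalars R).comap M.subtype
  have : Module.Finite R L := Module.Finite.iff_fg.2 hL
  have : IsNoetherian R L := inferInstance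
  have hMfg : M.FG := by
    have h1 : (M.comap L.subtype).FG := IsNoetherian.noetherian _
    have h2 := h1.map L.subtype
    rwa [Submodule.map_comap_subtype, inf_of_le_right inf_le_left] at h2
  have : Module.Finite R M := Module.Finite.iff_fg.2 hMfg
  have : IsNoetherian R M := inferInstance
  have : Module.Finite R N := inferInstance
  have : IsTorsionFree R (M ⧸ N) := by
    refine IsTorsionFree.of_smul_eq_zero fun r m h => ?_
    obtain ⟨m, rfl⟩ := N.mkQ_surjective m
    by_cases hr : r = 0
    · exact Or.inl hr
    · right
      rw [← map_smul, Submodule.mkQ_apply, Submodule.Quotient.mk_eq_zero] at h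
      rw [Submodule.mkQ_apply, Submodule.Quotient.mk_eq_zero]
      have h' : algebraMap R K r • (m : V) ∈ I := by
        rw [algebraMap_smul]; exact h
      exact (Submodule.smul_mem_iff I (by simpa using hr)).1 h'
  let bN := Free.chooseBasis R N
  let bQ := Free.chooseBasis R (M ⧸ N)
  let b := Basis.sumQuot bN bQ
  let g : _ → V := fun i => (b i : V)
  have hg : IsLatticeBasis L W g := by
    have hs : ∀ v ∈ L, v ∈ W → v ∈ Submodule.span R (Set.range g) := by
      intro v hv hv'
      have h1 := b.mem_span ⟨v, hv, hv'⟩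
      have h2 := Submodule.mem_map_of_mem (f := M.subtype) h1
      rwa [Submodule.map_span, ← Set.range_comp] at h2
    refine ⟨(LinearIndependent.iff_fractionRing R K).1 (b.linearIndependent.map' M.subtype M.ker_subtype),
      span_eq g W (fun i => (b i).2.2) hs, hs, fun i => (b i).2.1⟩
  have hgI : IsLatticeBasis L I (g ∘ Sum.inl) := by
    have hg' : g ∘ Sum.inl = fun i => ((bN i : M) : V) := by
      funext i
      exact congrArg Subtype.val (Basis.sumQuot_inl bN bQ i)
    have hmem : ∀ i, (g ∘ Sum.inl) i ∈ I := fun i => by rw [hg']; exact (bN i).2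
    have hs : ∀ v ∈ L, v ∈ I → v ∈ Submodule.span R (Set.range (g ∘ Sum.inl)) := by
      intro v hv hv'
      have h1 := bN.mem_span ⟨⟨v, hv, hIW hv'⟩, hv'⟩
      have h2 := Submodule.mem_map_of_mem (f := M.subtype ∘ₗ N.subtype) h1
      rw [Submodule.map_span, ← Set.range_comp] at h2
      rw [hg']
      exact h2
    exact ⟨hg.linearIndependent.comp _ Sum.inl_injective, span_eq _ I hmem hs, hs, fun i => hg.mem _⟩
  have hc1 := hgI.finrank_eq_card
  have hc2 := hg.finrank_eq_card
  rw [Fintype.card_sum] at hc2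
  let e1 : ι ≃ _ := Fintype.equivOfCardEq (hι.trans hc1)
  let e2 : κ ≃ _ := Fintype.equivOfCardEq
      (by omega : Fintype.card κ = Fintype.card (Free.ChooseBasisIndex R (M ⧸ N)))
  exact ⟨g ∘ (e1.sumCongr e2), hg.comp_equiv _, hgI.comp_equiv e1⟩

end Lattice

section Gram

variable {K V ι ι₁ ι₂ κ : Type*} [Field K] [AddCommGroup V] [Module K V]
  [Fintype ι] [Fintype ι₁] [Fintype ι₂] [Fintype κ]

/-- If the first parts of two bases span the same subspace, the matrix relating the bases is block
triangular. -/
theorem toBlocks₂₁_eq_zero {f b : ι ⊕ κ → V} (hf : LinearIndependent K f)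
    (hbI : ∀ i, b (Sum.inl i) ∈ Submodule.span K (Set.range (f ∘ Sum.inl)))
    {A : Matrix (ι ⊕ κ) (ι ⊕ κ) K} (h : ∀ j, b j = ∑ i, A i j • f i) : A.toBlocks₂₁ = 0 := by
  ext k i
  obtain ⟨a, ha⟩ := (Submodule.mem_span_range_iff_exists_fun K).1 (hbI i)
  have h1 : (fun l => A l (Sum.inl i)) = Sum.elim a 0 := by
    refine coeff_ext hf ?_
    rw [← h, ← ha]
    simp
  exact congrFun h1 (Sum.inr k)

theorem det_eq_mul_of_adapted [DecidableEq ι] [DecidableEq κ] {f b : ι ⊕ κ → V} (hf : LinearIndependent K f)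
    (hbI : ∀ i, b (Sum.inl i) ∈ Submodule.span K (Set.range (f ∘ Sum.inl)))
    {A : Matrix (ι ⊕ κ) (ι ⊕ κ) K} (h : ∀ j, b j = ∑ i, A i j • f i) :
    A.det = A.toBlocks₁₁.det * A.toBlocks₂₂.det ∧
      ∀ j, b (Sum.inl j) = ∑ i, A.toBlocks₁₁ i j • f (Sum.inl i) := by
  have h0 := toBlocks₂₁_eq_zero hf hbI h
  constructor
  · conv_lhs => rw [← Matrix.fromBlocks_toBlocks A, h0, Matrix.det_fromBlocks_zero₂₁]
  · intro j
    rw [h, Fintype.sum_sum_type]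
    have : ∀ k, A (Sum.inr k) (Sum.inl j) = 0 := fun k => congrFun (congrFun h0 k) j
    simp [this, Matrix.toBlocks₁₁]

/-- If the first parts of the families pair to zero with everything, the Gram matrix of the second
parts changes with the second diagonal blocks only. -/
theorem gram_eq (β : V →ₗ[K] V →ₗ[K] K) {f₁ b₁ : ι₁ ⊕ κ → V} {f₂ b₂ : ι₂ ⊕ κ → V}
    {A₁ : Matrix (ι₁ ⊕ κ) (ι₁ ⊕ κ) K} {A₂ : Matrix (ι₂ ⊕ κ) (ι₂ ⊕ κ) K}
    (h₁ : ∀ j, b₁ j = ∑ i, A₁ i j • f₁ i) (h₂ : ∀ j, b₂ j = ∑ i, A₂ i j • f₂ i)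
    (hz₁ : ∀ i j, β (f₁ (Sum.inl i)) (f₂ j) = 0) (hz₂ : ∀ i j, β (f₁ i) (f₂ (Sum.inl j)) = 0) :
    (Matrix.of fun j k => β (b₁ (Sum.inr j)) (b₂ (Sum.inr k))) =
      A₁.toBlocks₂₂.transpose * (Matrix.of fun j k => β (f₁ (Sum.inr j)) (f₂ (Sum.inr k))) *
        A₂.toBlocks₂₂ := by
  ext j k
  rw [Matrix.of_apply, h₁, h₂]
  simp only [Fintype.sum_sum_type, map_add, map_sum, map_smul]
  simp only [LinearMap.add_apply, LinearMap.sum_apply, LinearMap.smul_apply, hz₁, hz₂, mul_zero,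
    Finset.sum_const_zero, zero_add, smul_eq_mul, Matrix.mul_apply, Matrix.transpose_apply, Matrix.toBlocks₂₂,
    Matrix.of_apply, Finset.mul_sum, Finset.sum_mul]
  refine Finset.sum_congr rfl fun i _ => Finset.sum_congr rfl fun l _ => ?_
  ring

end Gram

/-! ### The generic fibre of a vector bundle and of a subbundle -/

section Restriction

variable {X : Scheme.{0}}

/-- Restriction of functions. -/
def resFun {U V : X.Opens} (h : V ≤ U) : Γ(X, U) →+* Γ(X, V) := (X.presheaf.map (homOfLE h).op).hom

theorem mem_inf_of_mem {U V : X.Opens} {x : X} (hU : x ∈ U) (hV : x ∈ V) : x ∈ U ⊓ V := ⟨hU, hV⟩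

theorem res_smul (M : X.Modules) {U V : X.Opens} (h : V ≤ U) (a : Γ(X, U)) (s : Γ(M, U)) :
    res M h (a • s) = resFun h a • res M h s :=
  M.map_smul (homOfLE h) a s

theorem res_res (M : X.Modules) {U V W : X.Opens} (h : V ≤ U) (h' : W ≤ V) (s : Γ(M, U)) :
    res M h' (res M h s) = res M (h'.trans h) s := by
  change _ = (M.presheaf.map ((homOfLE h).op ≫ (homOfLE h').op)).hom s
  rw [Functor.map_comp]
  rfl

theorem res_self (M : X.Modules) {U : X.Opens} (s : Γ(M, U)) : res M le_rfl s = s := by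
  change (M.presheaf.map (𝟙 _)).hom s = s
  rw [CategoryTheory.Functor.map_id]
  rfl

theorem res_sum_smul (M : X.Modules) {U V W : X.Opens} (h : V ≤ U) (h' : W ≤ V) {ι : Type*} [Fintype ι]
    (a : ι → Γ(X, V)) (e : ι → Γ(M, U)) :
    res M h' (∑ i, a i • res M h (e i)) = ∑ i, resFun h' (a i) • res M (h'.trans h) (e i) := by
  simp only [map_sum, res_smul, res_res]

/-- A section of a sheaf of modules that vanishes locally is zero. -/
theorem eq_zero_of_locally (M : X.Modules) {U : X.Opens} (s : Γ(M, U))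
    (h : ∀ x ∈ U, ∃ (V : X.Opens) (h : V ≤ U), x ∈ V ∧ res M h s = 0) : s = 0 := by
  choose V hV hx hs using h
  refine TopCat.Sheaf.eq_of_locally_eq' ⟨_, M.isSheaf⟩ (fun x : U => V x.1 x.2) U
    (fun x => homOfLE (hV x.1 x.2)) ?_ s 0 ?_
  · intro x hxU
    exact TopologicalSpace.Opens.mem_iSup.2 ⟨⟨x, hxU⟩, hx x hxU⟩
  · intro x
    exact (hs x.1 x.2).trans (map_zero (res M (hV x.1 x.2))).symm

namespace IsFrame

variable {M : X.Modules} {S : ∀ U : X.Opens, Submodule Γ(X, U) Γ(M, U)} {r : ℕ} {U : X.Opens}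
  {e : Fin r → Γ(M, U)}

theorem eq_zero (he : IsFrame M S U e) {V : X.Opens} (h : V ≤ U) {a : Fin r → Γ(X, V)}
    (ha : ∑ i, a i • res M h (e i) = 0) : a = 0 := by
  obtain ⟨b, -, hb⟩ := he.2 V h 0 (Submodule.zero_mem _)
  rw [hb a ha.symm]
  refine (hb 0 ?_).symm
  simp

theorem ext (he : IsFrame M S U e) {V : X.Opens} (h : V ≤ U) {a b : Fin r → Γ(X, V)}
    (hab : ∑ i, a i • res M h (e i) = ∑ i, b i • res M h (e i)) : a = b := by
  rw [← sub_eq_zero]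
  refine he.eq_zero h ?_
  simp only [Pi.sub_apply, sub_smul, Finset.sum_sub_distrib, hab, sub_self]

end IsFrame

end Restriction

namespace SmoothProjectiveCurve

variable {C : SmoothProjectiveCurve}

theorem genericPoint_mem {U : C.X.Opens} {x : C.X} (hx : x ∈ U) : genericPoint C.X ∈ U :=
  ((genericPoint_spec C.X).mem_open_set_iff U.isOpen).2 ⟨x, trivial, hx⟩

/-- The rational function defined by a function on a nonempty open set. -/
def toField {U : C.X.Opens} (hU : genericPoint C.X ∈ U) : Γ(C.X, U) →+* C.X.functionField :=
  (C.X.presheaf.germ U (genericPoint C.X) hU).hom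

theorem toField_injective {U : C.X.Opens} (hU : genericPoint C.X ∈ U) : Function.Injective (toField hU) :=
  germ_injective_of_isIntegral C.X _ hU

theorem toField_resFun {U V : C.X.Opens} (h : V ≤ U) (hV : genericPoint C.X ∈ V) (a : Γ(C.X, U)) :
    toField hV (resFun h a) = toField (h hV) a :=
  C.X.presheaf.germ_res_apply (homOfLE h) _ hV a

theorem algebraMap_germ {U : C.X.Opens} {x : C.X} (hx : x ∈ U) (a : Γ(C.X, U)) :
    algebraMap (C.X.presheaf.stalk x) C.X.functionField (C.X.presheaf.germ U x hx a) =
      toField (genericPoint_mem hx) a :=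
  C.X.presheaf.germ_stalkSpecializes_apply hx _ a

/-- Finitely many germs are represented on a common neighborhood. -/
theorem exists_germ_eq {ι : Type*} [Finite ι] {x : C.X} (c : ι → C.X.presheaf.stalk x)
    {U : C.X.Opens} (hx : x ∈ U) :
    ∃ (V : C.X.Opens) (_ : V ≤ U) (hV : x ∈ V) (a : ι → Γ(C.X, V)),
      ∀ i, C.X.presheaf.germ V x hV (a i) = c i := by
  have := Fintype.ofFinite ι
  choose V hV a ha using fun i => C.X.presheaf.exists_germ_eq (c i)
  have hxW : x ∈ U ⊓ Finset.univ.inf V := by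
    refine mem_inf_of_mem hx ?_
    change x ∈ ((Finset.univ.inf V : C.X.Opens) : Set C.X)
    rw [TopologicalSpace.Opens.coe_finset_inf, Finset.inf_set_eq_iInter]
    exact Set.mem_iInter₂.2 fun i _ => hV i
  have hle : ∀ i, U ⊓ Finset.univ.inf V ≤ V i := fun i =>
    inf_le_right.trans (Finset.inf_le (Finset.mem_univ i))
  refine ⟨_, inf_le_left, hxW, fun i => resFun (hle i) (a i), fun i => ?_⟩
  exact (C.X.presheaf.germ_res_apply (homOfLE (hle i)) x hxW (a i)).trans (ha i)

theorem exists_toField_eq {ι : Type*} [Finite ι] (c : ι → C.X.functionField) {U : C.X.Opens}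
    (hU : genericPoint C.X ∈ U) :
    ∃ (V : C.X.Opens) (_ : V ≤ U) (hV : genericPoint C.X ∈ V) (a : ι → Γ(C.X, V)),
      ∀ i, toField hV (a i) = c i :=
  exists_germ_eq c hU

end SmoothProjectiveCurve

open SmoothProjectiveCurve

variable {C : SmoothProjectiveCurve}

namespace VectorBundle

variable (E : VectorBundle C)

/-- A nonempty open set over which `E` is trivial. -/
def trivOpen : C.X.Opens := (E.locallyFree (genericPoint C.X)).choose

theorem genericPoint_mem_trivOpen : genericPoint C.X ∈ E.trivOpen :=
  (E.locallyFree (genericPoint C.X)).choose_spec.choose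

/-- A rational frame of `E`. -/
def ratFrame : Fin E.rank → Γ(E.sheaf, E.trivOpen) :=
  (E.locallyFree (genericPoint C.X)).choose_spec.choose_spec.choose

theorem isFrame_ratFrame : IsFrame E.sheaf (fun _ => ⊤) E.trivOpen E.ratFrame :=
  (E.locallyFree (genericPoint C.X)).choose_spec.choose_spec.choose_spec

theorem exists_coords {U : C.X.Opens} (s : Γ(E.sheaf, U)) :
    ∃ a : Fin E.rank → Γ(C.X, U ⊓ E.trivOpen),
      res E.sheaf inf_le_left s = ∑ i, a i • res E.sheaf inf_le_right (E.ratFrame i) :=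
  (E.isFrame_ratFrame.2 _ inf_le_right _ Submodule.mem_top).exists

/-- The vector of coordinates, in the rational frame, of a section of `E` over a nonempty open set.
The space `Fin E.rank → C.X.functionField` is thus identified with the generic fibre of `E`. -/
def gen {U : C.X.Opens} (hU : genericPoint C.X ∈ U) (s : Γ(E.sheaf, U)) : Fin E.rank → C.X.functionField :=
  fun i => toField (U := U ⊓ E.trivOpen) (mem_inf_of_mem hU E.genericPoint_mem_trivOpen)
    ((E.exists_coords s).choose i)

/-- The coordinates may be computed over any smaller nonempty open set. -/
theorem gen_eq_of_res_eq {U V : C.X.Opens} (hU : genericPoint C.X ∈ U) (hV : genericPoint C.X ∈ V)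
    (h : V ≤ U) (h' : V ≤ E.trivOpen) {s : Γ(E.sheaf, U)} {a : Fin E.rank → Γ(C.X, V)}
    (ha : res E.sheaf h s = ∑ i, a i • res E.sheaf h' (E.ratFrame i)) :
    E.gen hU s = fun i => toField hV (a i) := by
  have h1 := congrArg (res E.sheaf (le_inf h h')) (E.exists_coords s).choose_spec
  rw [res_res, res_sum_smul, ha] at h1
  have h2 := E.isFrame_ratFrame.ext h' h1
  funext i
  rw [h2, toField_resFun]
  rfl

theorem gen_res {U V : C.X.Opens} (h : V ≤ U) (hV : genericPoint C.X ∈ V) (s : Γ(E.sheaf, U)) :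
    E.gen hV (res E.sheaf h s) = E.gen (h hV) s := by
  obtain ⟨a, ha⟩ := E.exists_coords (res E.sheaf h s)
  rw [E.gen_eq_of_res_eq hV (mem_inf_of_mem hV E.genericPoint_mem_trivOpen) _ _ ha]
  rw [res_res] at ha
  exact (E.gen_eq_of_res_eq (h hV) (mem_inf_of_mem hV E.genericPoint_mem_trivOpen) _ _ ha).symm

theorem gen_add {U : C.X.Opens} (hU : genericPoint C.X ∈ U) (s t : Γ(E.sheaf, U)) :
    E.gen hU (s + t) = E.gen hU s + E.gen hU t := by
  rw [E.gen_eq_of_res_eq hU (mem_inf_of_mem hU E.genericPoint_mem_trivOpen) inf_le_left inf_le_right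
    (a := (E.exists_coords s).choose + (E.exists_coords t).choose)]
  · funext i
    exact map_add _ _ _
  · simp only [map_add, Pi.add_apply, add_smul, Finset.sum_add_distrib]
    rw [← (E.exists_coords s).choose_spec, ← (E.exists_coords t).choose_spec]

theorem gen_smul {U : C.X.Opens} (hU : genericPoint C.X ∈ U) (a : Γ(C.X, U)) (s : Γ(E.sheaf, U)) :
    E.gen hU (a • s) = toField hU a • E.gen hU s := by
  rw [E.gen_eq_of_res_eq hU (mem_inf_of_mem hU E.genericPoint_mem_trivOpen) inf_le_left inf_le_right
    (a := (resFun inf_le_left a : Γ(C.X, U ⊓ E.trivOpen)) • (E.exists_coords s).choose)]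
  · funext i
    refine (map_mul _ _ _).trans ?_
    rw [toField_resFun]
    rfl
  · rw [res_smul]
    refine (congrArg _ (E.exists_coords s).choose_spec).trans ?_
    rw [Finset.smul_sum]
    simp only [smul_smul, Pi.smul_apply, smul_eq_mul]

theorem gen_zero {U : C.X.Opens} (hU : genericPoint C.X ∈ U) : E.gen hU 0 = 0 := by
  have := E.gen_smul hU 0 0
  rwa [zero_smul, map_zero, zero_smul] at this

theorem gen_sum {U : C.X.Opens} (hU : genericPoint C.X ∈ U) {ι : Type*} (t : Finset ι)
    (s : ι → Γ(E.sheaf, U)) :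
    E.gen hU (∑ i ∈ t, s i) = ∑ i ∈ t, E.gen hU (s i) :=
  map_sum (⟨⟨E.gen hU, E.gen_zero hU⟩, E.gen_add hU⟩ : Γ(E.sheaf, U) →+ (Fin E.rank → C.X.functionField)) s t

theorem gen_sum_smul_res {U V : C.X.Opens} (h : V ≤ U) (hV : genericPoint C.X ∈ V) {ι : Type*} [Fintype ι]
    (a : ι → Γ(C.X, V)) (e : ι → Γ(E.sheaf, U)) :
    E.gen hV (∑ i, a i • res E.sheaf h (e i)) = ∑ i, toField hV (a i) • E.gen (h hV) (e i) := by
  simp only [gen_sum, gen_smul, gen_res]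

/-- A section of a vector bundle on an integral curve is determined by its value at the generic
point. -/
theorem eq_zero_of_gen_eq_zero {U : C.X.Opens} (hU : genericPoint C.X ∈ U) {s : Γ(E.sheaf, U)}
    (hs : E.gen hU s = 0) :
    s = 0 := by
  have h0 : res E.sheaf (V := U ⊓ E.trivOpen) inf_le_left s = 0 := by
    obtain ⟨a, ha⟩ := E.exists_coords s
    have h1 := E.gen_eq_of_res_eq hU (mem_inf_of_mem hU E.genericPoint_mem_trivOpen) _ _ ha
    rw [hs] at h1
    have h2 : a = 0 := by
      funext i
      refine toField_injective (mem_inf_of_mem hU E.genericPoint_mem_trivOpen) ?_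
      exact (congrFun h1 i).symm.trans (map_zero _).symm
    rw [ha, h2]
    simp
  refine eq_zero_of_locally _ s fun x hx => ?_
  obtain ⟨V, hxV, e, he⟩ := E.locallyFree x
  refine ⟨U ⊓ V, inf_le_left, mem_inf_of_mem hx hxV, ?_⟩
  obtain ⟨a, ha, -⟩ := he.2 (U ⊓ V) inf_le_right (res E.sheaf inf_le_left s) Submodule.mem_top
  have hη : genericPoint C.X ∈ U ⊓ V ⊓ E.trivOpen :=
    mem_inf_of_mem (mem_inf_of_mem hU (genericPoint_mem hxV)) E.genericPoint_mem_trivOpen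
  have h1 := congrArg (res E.sheaf (V := U ⊓ V ⊓ E.trivOpen) inf_le_left) ha
  rw [res_res, res_sum_smul] at h1
  have h2 : res E.sheaf (V := U ⊓ V ⊓ E.trivOpen) (inf_le_left.trans inf_le_left) s = 0 := by
    rw [← res_res E.sheaf (V := U ⊓ E.trivOpen) inf_le_left (inf_le_inf_right _ inf_le_left), h0, map_zero]
  rw [h2] at h1
  have h3 := he.eq_zero _ h1.symm
  have h4 : a = 0 := by
    funext i
    refine toField_injective (mem_inf_of_mem hU (genericPoint_mem hxV)) ?_
    have := congrArg (toField hη) (congrFun h3 i)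
    rw [toField_resFun] at this
    exact this.trans ((map_zero _).trans (map_zero _).symm)
  rw [ha, h4]
  simp

theorem gen_injective {U : C.X.Opens} (hU : genericPoint C.X ∈ U) : Function.Injective (E.gen hU) := by
  intro s t h
  rw [← sub_eq_zero]
  refine E.eq_zero_of_gen_eq_zero hU ?_
  have h1 := E.gen_add hU (s - t) t
  rw [sub_add_cancel, h] at h1
  exact left_eq_add.1 ((add_comm _ _).trans h1.symm).symm

/-- A frame gives linearly independent vectors in the generic fibre, since the denominators of a
relation over the function field disappear on a smaller open set. -/
theorem linearIndependent_gen {S : ∀ U : C.X.Opens, Submodule Γ(C.X, U) Γ(E.sheaf, U)} {r : ℕ} {U : C.X.Opens}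
    (hU : genericPoint C.X ∈ U) {e : Fin r → Γ(E.sheaf, U)} (he : IsFrame E.sheaf S U e) :
    LinearIndependent C.X.functionField fun i => E.gen hU (e i) := by
  rw [Fintype.linearIndependent_iff]
  intro c hc
  obtain ⟨V, h, hV, a, ha⟩ := exists_toField_eq c hU
  have h1 : E.gen hV (∑ i, a i • res E.sheaf h (e i)) = 0 := by
    rw [E.gen_sum_smul_res h hV, ← hc]
    simp only [ha]
  have h2 := he.eq_zero h (E.eq_zero_of_gen_eq_zero hV h1)
  intro i
  rw [← ha, h2, Pi.zero_apply, map_zero]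

/-- The lattice in the generic fibre consisting of the germs at `x` of sections of `E`. -/
def lattice (x : C.X) : Submodule (C.X.presheaf.stalk x) (Fin E.rank → C.X.functionField) where
  carrier := {v | ∃ (U : C.X.Opens) (hx : x ∈ U) (s : Γ(E.sheaf, U)), E.gen (genericPoint_mem hx) s = v}
  zero_mem' := ⟨⊤, TopologicalSpace.Opens.mem_top x, 0, E.gen_zero _⟩
  add_mem' := by
    rintro _ _ ⟨U, hU, s, rfl⟩ ⟨V, hV, t, rfl⟩
    refine ⟨U ⊓ V, mem_inf_of_mem hU hV, res E.sheaf inf_le_left s + res E.sheaf inf_le_right t, ?_⟩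
    rw [gen_add, gen_res, gen_res]
  smul_mem' := by
    rintro c _ ⟨U, hU, s, rfl⟩
    obtain ⟨V, h, hV, a, ha⟩ := exists_germ_eq (fun _ : Unit => c) hU
    refine ⟨V, hV, a () • res E.sheaf h s, ?_⟩
    rw [gen_smul, gen_res, ← algebraMap_germ hV, ha, algebraMap_smul]

theorem gen_mem_lattice {x : C.X} {U : C.X.Opens} (hx : x ∈ U) (s : Γ(E.sheaf, U)) :
    E.gen (genericPoint_mem hx) s ∈ E.lattice x := ⟨U, hx, s, rfl⟩

end VectorBundle

namespace Subbundle

variable {E : VectorBundle C} (F : Subbundle E)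

/-- The generic fibre of a subbundle. -/
def gen : Submodule C.X.functionField (Fin E.rank → C.X.functionField) where
  carrier := {v | ∃ (U : C.X.Opens) (hU : genericPoint C.X ∈ U) (s : Γ(E.sheaf, U)),
    s ∈ F.sections U ∧ E.gen hU s = v}
  zero_mem' := ⟨⊤, TopologicalSpace.Opens.mem_top _, 0, Submodule.zero_mem _, E.gen_zero _⟩
  add_mem' := by
    rintro _ _ ⟨U, hU, s, hs, rfl⟩ ⟨V, hV, t, ht, rfl⟩
    refine ⟨U ⊓ V, mem_inf_of_mem hU hV, res E.sheaf inf_le_left s + res E.sheaf inf_le_right t,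
      Submodule.add_mem _ (F.res_mem _ _ hs) (F.res_mem _ _ ht), ?_⟩
    rw [E.gen_add, E.gen_res, E.gen_res]
  smul_mem' := by
    rintro c _ ⟨U, hU, s, hs, rfl⟩
    obtain ⟨V, h, hV, a, ha⟩ := exists_toField_eq (fun _ : Unit => c) hU
    refine ⟨V, hV, a () • res E.sheaf h s, Submodule.smul_mem _ _ (F.res_mem _ _ hs), ?_⟩
    rw [E.gen_smul, E.gen_res, ha]

/-- Near every point there is a frame of `E` whose first members form a frame of `F`. -/
theorem exists_adapted_frame (x : C.X) : ∃ (U : C.X.Opens) (_ : x ∈ U) (e : Fin E.rank → Γ(E.sheaf, U)),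
    IsFrame E.sheaf (fun _ => ⊤) U e ∧
      IsFrame E.sheaf F.sections U (fun i => e (Fin.castLE F.rank_le i)) := by
  obtain ⟨U, hx, e, he, hF⟩ := F.locally_split x
  have hset : ∀ (V : C.X.Opens) (h : V ≤ U),
      {t | ∃ i : Fin E.rank, i.val < F.rank ∧ t = res E.sheaf h (e i)} =
      Set.range fun i : Fin F.rank => res E.sheaf h (e (Fin.castLE F.rank_le i)) := by
    intro V h
    ext t
    constructor
    · rintro ⟨i, hi, rfl⟩
      exact ⟨⟨i, hi⟩, rfl⟩
    · rintro ⟨i, rfl⟩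
      exact ⟨_, i.2, rfl⟩
  refine ⟨U, hx, e, he, fun i => ?_, fun V h s hs => ?_⟩
  · rw [hF U le_rfl, hset]
    exact Submodule.subset_span ⟨i, res_self _ _⟩
  · rw [hF V h, hset] at hs
    obtain ⟨a, ha⟩ := (Submodule.mem_span_range_iff_exists_fun _).1 hs
    refine ⟨a, ha.symm, fun b hb => ?_⟩
    have hext : ∀ c : Fin F.rank → Γ(C.X, V), ∑ i, c i • res E.sheaf h (e (Fin.castLE F.rank_le i)) =
        ∑ j, Function.extend (Fin.castLE F.rank_le) c 0 j • res E.sheaf h (e j) := by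
      intro c
      refine Fintype.sum_of_injective (Fin.castLE F.rank_le) (Fin.castLE_injective _) _ _ ?_ ?_
      · intro j hj
        rw [Function.extend_apply' _ _ _ (fun h => hj h), Pi.zero_apply, zero_smul]
      · intro i
        rw [(Fin.castLE_injective F.rank_le).extend_apply]
    have h1 := ha.trans hb
    rw [hext, hext] at h1
    have h2 := he.ext h h1
    funext i
    have h3 := congrFun h2 (Fin.castLE F.rank_le i)
    rw [(Fin.castLE_injective F.rank_le).extend_apply, (Fin.castLE_injective F.rank_le).extend_apply] at h3
    exact h3.symm

/-- A subbundle is saturated: it contains the sections of `E` with values in its generic fibre. -/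
theorem mem_sections_iff {U : C.X.Opens} (hU : genericPoint C.X ∈ U) {s : Γ(E.sheaf, U)} :
    s ∈ F.sections U ↔ E.gen hU s ∈ F.gen := by
  refine ⟨fun hs => ⟨U, hU, s, hs, rfl⟩, ?_⟩
  rintro ⟨U', hU', t, ht, hts⟩
  refine F.mem_of_locally U s fun x hx => ?_
  obtain ⟨V, hxV, e, he, heF⟩ := F.exists_adapted_frame x
  refine ⟨U ⊓ V, inf_le_left, mem_inf_of_mem hx hxV, ?_⟩
  obtain ⟨a, ha, -⟩ := he.2 (U ⊓ V) inf_le_right (res E.sheaf inf_le_left s) Submodule.mem_top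
  obtain ⟨b, hb, -⟩ := heF.2 (U' ⊓ V) inf_le_right (res E.sheaf inf_le_left t) (F.res_mem _ _ ht)
  have hη := mem_inf_of_mem hU (genericPoint_mem hxV)
  have hη' := mem_inf_of_mem hU' (genericPoint_mem hxV)
  have h1 := congrArg (E.gen hη) ha
  have h2 := congrArg (E.gen hη') hb
  rw [E.gen_res, E.gen_sum_smul_res _ hη] at h1
  rw [E.gen_res, E.gen_sum_smul_res _ hη', hts, h1] at h2
  have h3 : ∑ i, toField hη' (b i) • E.gen (genericPoint_mem hxV) (e (Fin.castLE F.rank_le i)) =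
      ∑ j, Function.extend (Fin.castLE F.rank_le) (fun i => toField hη' (b i)) 0 j •
        E.gen (genericPoint_mem hxV) (e j) := by
    refine Fintype.sum_of_injective (Fin.castLE F.rank_le) (Fin.castLE_injective _) _ _ ?_ ?_
    · intro j hj
      rw [Function.extend_apply' _ _ _ (fun h => hj h), Pi.zero_apply, zero_smul]
    · intro i
      rw [(Fin.castLE_injective F.rank_le).extend_apply]
  have h4 := coeff_ext (E.linearIndependent_gen (genericPoint_mem hxV) he) (h2.trans h3)
  rw [ha]
  refine Submodule.sum_mem _ fun j _ => ?_
  by_cases hj : ∃ i, Fin.castLE F.rank_le i = j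
  · obtain ⟨i, rfl⟩ := hj
    exact Submodule.smul_mem _ _ (F.res_mem _ _ (heF.1 i))
  · have h5 := congrFun h4 j
    rw [Function.extend_apply' _ _ _ hj] at h5
    have h6 : a j = 0 := toField_injective hη (h5.trans (map_zero _).symm)
    rw [h6, zero_smul]
    exact Submodule.zero_mem _

/-- The members of a local frame of `F` form a basis of the lattice of germs of sections of `F`. -/
theorem isLatticeBasis_gen {r : ℕ} {U : C.X.Opens} {x : C.X} (hx : x ∈ U) {f : Fin r → Γ(E.sheaf, U)}
    (hf : IsFrame E.sheaf F.sections U f) :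
    IsLatticeBasis (E.lattice x) F.gen fun i => E.gen (genericPoint_mem hx) (f i) where
  linearIndependent := E.linearIndependent_gen _ hf
  span_eq := by
    refine le_antisymm (Submodule.span_le.2 (Set.range_subset_iff.2 fun i => ⟨U, _, f i, hf.1 i, rfl⟩)) ?_
    rintro v ⟨V, hV, s, hs, rfl⟩
    obtain ⟨a, ha, -⟩ := hf.2 (V ⊓ U) inf_le_right (res E.sheaf inf_le_left s) (F.res_mem _ _ hs)
    have h1 := congrArg (E.gen (mem_inf_of_mem hV (genericPoint_mem hx))) ha
    rw [E.gen_res, E.gen_sum_smul_res _ (mem_inf_of_mem hV (genericPoint_mem hx))] at h1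
    rw [h1]
    exact Submodule.sum_mem _ fun i _ => Submodule.smul_mem _ _ (Submodule.subset_span ⟨i, rfl⟩)
  mem_span := by
    rintro v ⟨V, hV, s, rfl⟩ hv
    have hs := (F.mem_sections_iff _).2 hv
    obtain ⟨a, ha, -⟩ := hf.2 (V ⊓ U) inf_le_right (res E.sheaf inf_le_left s) (F.res_mem _ _ hs)
    have h1 := congrArg (E.gen (genericPoint_mem (mem_inf_of_mem hV hx))) ha
    rw [E.gen_res, E.gen_sum_smul_res _ (genericPoint_mem (mem_inf_of_mem hV hx))] at h1
    rw [h1]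
    refine Submodule.sum_mem _ fun i _ => ?_
    rw [← algebraMap_germ (mem_inf_of_mem hV hx), algebraMap_smul]
    exact Submodule.smul_mem _ _ (Submodule.subset_span ⟨i, rfl⟩)
  mem i := E.gen_mem_lattice hx _

theorem exists_isLatticeBasis (x : C.X) : ∃ f : Fin F.rank → Fin E.rank → C.X.functionField,
    IsLatticeBasis (E.lattice x) F.gen f := by
  obtain ⟨U, hx, e, -, he⟩ := F.exists_adapted_frame x
  exact ⟨_, F.isLatticeBasis_gen hx he⟩

theorem finrank_gen : Module.finrank C.X.functionField F.gen = F.rank := by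
  -- at a variable point the module structures over the local ring and over the function field stay apart
  have h : ∀ _ : C.X, Module.finrank C.X.functionField F.gen = F.rank := by
    intro x
    obtain ⟨f, hf⟩ := F.exists_isLatticeBasis x
    rw [hf.finrank_eq_card, Fintype.card_fin]
  exact h (genericPoint C.X)

theorem gen_whole : (whole E).gen = ⊤ := by
  refine Submodule.eq_top_of_finrank_eq ?_
  rw [finrank_gen, Module.finrank_fin_fun]
  rfl

end Subbundle

theorem eq_bot_of_genericPoint_notMem {U : C.X.Opens} (hU : genericPoint C.X ∉ U) : U = ⊥ := by
  rw [← not_ne_iff]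
  intro h
  obtain ⟨x, hx⟩ := (TopologicalSpace.Opens.ne_bot_iff_nonempty _).1 h
  exact hU (genericPoint_mem hx)

theorem subsingleton_of_genericPoint_notMem {U : C.X.Opens} (hU : genericPoint C.X ∉ U) :
    Subsingleton Γ(C.X, U) := by
  rw [eq_bot_of_genericPoint_notMem hU]
  infer_instance

theorem Subbundle.le_iff_gen_le {E : VectorBundle C} {F G : Subbundle E} : F ≤ G ↔ F.gen ≤ G.gen := by
  constructor
  · rintro h _ ⟨U, hU, s, hs, rfl⟩
    exact ⟨U, hU, s, h U hs, rfl⟩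
  · intro h U s hs
    by_cases hU : genericPoint C.X ∈ U
    · exact (G.mem_sections_iff hU).2 (h ((F.mem_sections_iff hU).1 hs))
    · exact G.mem_of_locally U s fun x hx => absurd (genericPoint_mem hx) hU

namespace VectorBundle

variable (E : VectorBundle C)

theorem isLatticeBasis_gen {r : ℕ} {U : C.X.Opens} {x : C.X} (hx : x ∈ U) {f : Fin r → Γ(E.sheaf, U)}
    (hf : IsFrame E.sheaf (fun _ => ⊤) U f) :
    IsLatticeBasis (E.lattice x) (⊤ : Submodule C.X.functionField _) fun i =>
      E.gen (genericPoint_mem hx) (f i) :=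
  Subbundle.gen_whole (E := E) ▸ (Subbundle.whole E).isLatticeBasis_gen hx hf

theorem fg_lattice (x : C.X) : (E.lattice x).FG := by
  obtain ⟨U, hx, e, he⟩ := E.locallyFree x
  have h := E.isLatticeBasis_gen hx he
  have h1 : E.lattice x = Submodule.span _ (Set.range fun i => E.gen (genericPoint_mem hx) (e i)) :=
    le_antisymm (fun v hv => h.mem_span v hv Submodule.mem_top)
      (Submodule.span_le.2 (Set.range_subset_iff.2 h.mem))
  rw [h1]
  exact Submodule.fg_span (Set.finite_range _)

theorem exists_smul_mem_lattice (x : C.X) (v : Fin E.rank → C.X.functionField) :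
    ∃ r : C.X.presheaf.stalk x, r ≠ 0 ∧ r • v ∈ E.lattice x := by
  obtain ⟨U, hx, e, he⟩ := E.locallyFree x
  have h := E.isLatticeBasis_gen hx he
  obtain ⟨a, rfl⟩ := h.exists_coeff_field (v := v) Submodule.mem_top
  obtain ⟨r, hr⟩ := IsLocalization.exist_integer_multiples_of_finite
    (nonZeroDivisors (C.X.presheaf.stalk x)) a
  refine ⟨r, nonZeroDivisors.ne_zero r.2, ?_⟩
  rw [Finset.smul_sum]
  refine Submodule.sum_mem _ fun i _ => ?_
  obtain ⟨c, hc⟩ := hr i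
  rw [← smul_assoc, ← hc, algebraMap_smul]
  exact Submodule.smul_mem _ _ (h.mem i)

/-- At every point, the lattice of a vector bundle has a basis adapted to a flag of two subspaces of
the generic fibre. -/
theorem exists_isLatticeBasis_sum {ι κ : Type} [Fintype ι] [Fintype κ] (x : C.X)
    {I W : Submodule C.X.functionField (Fin E.rank → C.X.functionField)} (hIW : I ≤ W)
    (hι : Fintype.card ι = Module.finrank C.X.functionField I)
    (hκ : Fintype.card ι + Fintype.card κ = Module.finrank C.X.functionField W) :
    ∃ f : ι ⊕ κ → Fin E.rank → C.X.functionField,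
      IsLatticeBasis (E.lattice x) W f ∧ IsLatticeBasis (E.lattice x) I (f ∘ Sum.inl) :=
  OrthBundle.exists_isLatticeBasis_sum (E.fg_lattice x) (E.exists_smul_mem_lattice x) hIW hι hκ

/-- A basis of the lattice at `x` is the germ of a frame near `x`. -/
theorem exists_isFrame_of_isLatticeBasis {x : C.X} {g : Fin E.rank → Fin E.rank → C.X.functionField}
    (hg : IsLatticeBasis (E.lattice x) (⊤ : Submodule C.X.functionField _) g) :
    ∃ (U : C.X.Opens) (hx : x ∈ U) (e : Fin E.rank → Γ(E.sheaf, U)),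
      IsFrame E.sheaf (fun _ => ⊤) U e ∧ ∀ i, E.gen (genericPoint_mem hx) (e i) = g i := by
  obtain ⟨U, hx, e, he⟩ := E.locallyFree x
  have h := E.isLatticeBasis_gen hx he
  choose a ha using fun j => h.exists_coeff (hg.mem j) Submodule.mem_top
  choose b hb using fun j => hg.exists_coeff (h.mem j) Submodule.mem_top
  obtain ⟨V, hVU, hxV, c, hc⟩ := exists_germ_eq
    (Sum.elim (fun p : Fin E.rank × Fin E.rank => a p.1 p.2)
      (fun p : Fin E.rank × Fin E.rank => b p.1 p.2)) hx
  let e' : Fin E.rank → Γ(E.sheaf, V) := fun j => ∑ i, c (Sum.inl (j, i)) • res E.sheaf hVU (e i)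
  have he' : ∀ j, E.gen (genericPoint_mem hxV) (e' j) = g j := by
    intro j
    rw [E.gen_sum_smul_res hVU (genericPoint_mem hxV), ha]
    refine Finset.sum_congr rfl fun i _ => ?_
    rw [← algebraMap_germ hxV, hc, algebraMap_smul]
    rfl
  have hee' : ∀ j, res E.sheaf hVU (e j) = ∑ i, c (Sum.inr (j, i)) • res E.sheaf le_rfl (e' i) := by
    intro j
    refine E.gen_injective (genericPoint_mem hxV) ?_
    rw [E.gen_sum_smul_res le_rfl (genericPoint_mem hxV), E.gen_res]
    refine (hb j).trans (Finset.sum_congr rfl fun i _ => ?_)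
    rw [← algebraMap_germ hxV, hc, algebraMap_smul, he']
    rfl
  refine ⟨V, hxV, e', ⟨fun _ => Submodule.mem_top, fun W hW s _ => ?_⟩, he'⟩
  obtain ⟨d, hd, -⟩ := he.2 W (hW.trans hVU) s Submodule.mem_top
  refine existsUnique_of_exists_of_unique ⟨fun i => ∑ j, d j * resFun hW (c (Sum.inr (j, i))), ?_⟩ ?_
  · have h1 : ∀ j, res E.sheaf (hW.trans hVU) (e j) =
        ∑ i, resFun hW (c (Sum.inr (j, i))) • res E.sheaf hW (e' i) := by
      intro j
      rw [← res_res E.sheaf hVU hW, hee', res_sum_smul]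
    rw [hd]
    simp only [h1, Finset.smul_sum, Finset.sum_smul, smul_smul]
    exact Finset.sum_comm
  · intro p q hp hq
    by_cases hη : genericPoint C.X ∈ W
    · have h1 := congrArg (E.gen hη) (hp.symm.trans hq)
      rw [E.gen_sum_smul_res hW hη, E.gen_sum_smul_res hW hη] at h1
      simp only [he'] at h1
      have h2 := coeff_ext hg.linearIndependent h1
      funext i
      exact toField_injective hη (congrFun h2 i)
    · have := subsingleton_of_genericPoint_notMem hη
      exact Subsingleton.elim _ _

end VectorBundle

/-! ### Subbundles from subspaces of the generic fibre, and their degrees -/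

namespace Subbundle

variable {E : VectorBundle C}

/-- The saturated subsheaf of sections of `E` with values in a subspace of the generic fibre. It is
a subbundle because the local rings of a smooth curve are principal ideal domains. -/
def ofSubspace (W : Submodule C.X.functionField (Fin E.rank → C.X.functionField)) : Subbundle E where
  rank := Module.finrank C.X.functionField W
  rank_le := (Submodule.finrank_le W).trans_eq (Module.finrank_fin_fun _)
  sections U :=
    { carrier := {s | ∀ hU : genericPoint C.X ∈ U, E.gen hU s ∈ W}
      zero_mem' := fun hU => by rw [E.gen_zero]; exact W.zero_mem
      add_mem' := fun hs ht hU => by rw [E.gen_add]; exact W.add_mem (hs hU) (ht hU)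
      smul_mem' := fun a s hs hU => by rw [E.gen_smul]; exact W.smul_mem _ (hs hU) }
  res_mem h s hs hV := by rw [E.gen_res]; exact hs _
  mem_of_locally U s h hU := by
    obtain ⟨V, hVU, hV, hs⟩ := h _ hU
    have := hs hV
    rwa [E.gen_res] at this
  locally_split x := by
    have hle : Module.finrank C.X.functionField W ≤ E.rank :=
      (Submodule.finrank_le W).trans_eq (Module.finrank_fin_fun _)
    obtain ⟨f, hf, hfW⟩ := E.exists_isLatticeBasis_sum x (ι := Fin (Module.finrank C.X.functionField W))
      (κ := Fin (E.rank - Module.finrank C.X.functionField W)) (le_top : W ≤ ⊤) (Fintype.card_fin _)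
      (by rw [Fintype.card_fin, Fintype.card_fin, finrank_top, Module.finrank_fin_fun]; omega)
    let e : Fin E.rank ≃ Fin (Module.finrank C.X.functionField W) ⊕
        Fin (E.rank - Module.finrank C.X.functionField W) :=
      (finCongr (by omega)).trans finSumFinEquiv.symm
    have he1 : ∀ i : Fin E.rank, ∀ hi : i.val < Module.finrank C.X.functionField W, e i =
        Sum.inl ⟨i.val, hi⟩ := by
      intro i hi
      refine (finSumFinEquiv.symm_apply_eq).2 ?_
      rfl
    obtain ⟨U, hx, s, hs, hgen⟩ := E.exists_isFrame_of_isLatticeBasis (hf.comp_equiv e)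
    refine ⟨U, hx, s, hs, fun V h => ?_⟩
    refine le_antisymm ?_ ?_
    · intro t ht
      obtain ⟨a, ha, -⟩ := hs.2 V h t Submodule.mem_top
      rw [ha]
      refine Submodule.sum_mem _ fun i _ => ?_
      by_cases hi : i.val < Module.finrank C.X.functionField W
      · exact Submodule.smul_mem _ _ (Submodule.subset_span ⟨i, hi, rfl⟩)
      · have h0 : a i = 0 := by
          by_cases hη : genericPoint C.X ∈ V
          · have h1 := ht hη
            rw [ha, E.gen_sum_smul_res h hη] at h1
            obtain ⟨b, hb⟩ := hfW.exists_coeff_field h1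
            have h2 : ∑ j, b j • (f ∘ Sum.inl) j = ∑ k, Sum.elim b 0 (e k) • (f ∘ e) k := by
              refine Eq.trans ?_ (Equiv.sum_comp e fun k => (Sum.elim b 0 k : C.X.functionField) • f k).symm
              rw [Fintype.sum_sum_type]
              simp
            rw [h2] at hb
            simp only [hgen] at hb
            have h3 := congrFun (coeff_ext (hf.comp_equiv e).linearIndependent hb) i
            rcases hei : e i with j | j
            · exfalso
              refine hi ?_
              have h4 : i = e.symm (Sum.inl j) := by rw [← hei, Equiv.symm_apply_apply]
              rw [h4]
              exact j.2
            · rw [hei, Sum.elim_inr, Pi.zero_apply] at h3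
              exact toField_injective hη (h3.trans (map_zero _).symm)
          · have := subsingleton_of_genericPoint_notMem hη
            exact Subsingleton.elim _ _
        rw [h0, zero_smul]
        exact Submodule.zero_mem _
    · rw [Submodule.span_le]
      rintro _ ⟨i, hi, rfl⟩ hV
      have h1 : (f ∘ e) i = (f ∘ Sum.inl) ⟨i.val, hi⟩ := congrArg f (he1 i hi)
      rw [E.gen_res, hgen, h1]
      exact hfW.mem_subspace _

@[simp]
theorem gen_ofSubspace (W : Submodule C.X.functionField (Fin E.rank → C.X.functionField)) :
    (ofSubspace W).gen = W := by
  refine Submodule.eq_of_le_of_finrank_eq ?_ (ofSubspace W).finrank_gen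
  rintro _ ⟨U, hU, s, hs, rfl⟩
  exact hs hU

end Subbundle

section Degree

/-- Over a common smaller open set, a frame of `S` over `V` expresses sections of `S` by a matrix. -/
theorem exists_matrix_of_isFrame {M : C.X.Modules} {S : ∀ U : C.X.Opens, Submodule Γ(C.X, U) Γ(M, U)} {r : ℕ}
    {U V W : C.X.Opens} (hU : W ≤ U) (hV : W ≤ V) {e : Fin r → Γ(M, U)} {f : Fin r → Γ(M, V)}
    (he : ∀ i, res M hU (e i) ∈ S W) (hf : IsFrame M S V f) :
    ∃ A : Matrix (Fin r) (Fin r) Γ(C.X, W), ∀ j, res M hU (e j) = ∑ i, A i j • res M hV (f i) := by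
  choose a ha _ using fun j => hf.2 W hV _ (he j)
  exact ⟨fun i j => a j i, ha⟩

namespace Subbundle

variable {E : VectorBundle C} (F : Subbundle E)

theorem gen_eq_sum_of_res_eq {r : ℕ} {U V W : C.X.Opens} (hU : W ≤ U) (hV : W ≤ V) (hη : genericPoint C.X ∈ W)
    {e : Fin r → Γ(E.sheaf, U)} {f : Fin r → Γ(E.sheaf, V)} {A : Matrix (Fin r) (Fin r) Γ(C.X, W)}
    (h : ∀ j, res E.sheaf hU (e j) = ∑ i, A i j • res E.sheaf hV (f i)) (j : Fin r) :
    E.gen (hU hη) (e j) = ∑ i, (A.map (toField hη)) i j • E.gen (hV hη) (f i) := by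
  have := congrArg (E.gen hη) (h j)
  rwa [E.gen_res, E.gen_sum_smul_res hV hη] at this

/-- The order of the determinant at a point does not depend on the basis of the lattice. -/
theorem ord_det_eq {ι : Type*} [Fintype ι] [DecidableEq ι] {x : C.X}
    {W : Submodule C.X.functionField (Fin E.rank → C.X.functionField)}
    {b f f' : ι → Fin E.rank → C.X.functionField} (hb : LinearIndependent C.X.functionField b)
    (hf : IsLatticeBasis (E.lattice x) W f)
    (hf' : IsLatticeBasis (E.lattice x) W f') {A A' : Matrix ι ι C.X.functionField}
    (hA : ∀ j, b j = ∑ i, A i j • f i) (hA' : ∀ j, b j = ∑ i, A' i j • f' i) :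
    Scheme.ord A.det x = Scheme.ord A'.det x := by
  obtain ⟨G, hG⟩ := hf.exists_matrix hf'.mem_subspace
  obtain ⟨u, hu, hu'⟩ := hf.exists_isUnit_det_eq (IsFractionRing.injective _ _) hf' hG
  have h1 : A = G * A' := by
    refine matrix_ext hf.linearIndependent fun j => ?_
    rw [← hA, ← sum_smul_sum_smul hG hA']
  rw [h1, Matrix.det_mul, ← hu', Scheme.ord_mul, C.ord_algebraMap_of_isUnit hu, zero_add]
  · simpa using hu.ne_zero
  · exact det_ne_zero_of_linearIndependent hb hA'

/-- The degree of a rational section of `det F` does not depend on the section, as the quotient of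
two such sections is a rational function. -/
theorem eq_finsum_of_hasDegree {ι : Type*} [Fintype ι] [DecidableEq ι]
    {b : ι → Fin E.rank → C.X.functionField}
    (hb : LinearIndependent C.X.functionField b)
    (hbF : Submodule.span C.X.functionField (Set.range b) = F.gen)
    {f : C.X → ι → Fin E.rank → C.X.functionField} (hf : ∀ x, IsLatticeBasis (E.lattice x) F.gen (f x))
    {A : C.X → Matrix ι ι C.X.functionField} (hA : ∀ x j, b j = ∑ i, A x i j • f x i) {d : ℤ}
    (hd : HasDegree E.sheaf F.sections F.rank d) :
    (Function.support fun x => Scheme.ord (A x).det x).Finite ∧ d = ∑ᶠ x, Scheme.ord (A x).det x := by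
  obtain ⟨U, hU, e, n, he, hn, hfin, rfl⟩ := hd
  have hbe := E.linearIndependent_gen hU he
  have hcard : Fintype.card ι = F.rank := by
    rw [← F.finrank_gen, ← hbF, finrank_span_eq_card hb]
  let σ : ι ≃ Fin F.rank := Fintype.equivFinOfCardEq hcard
  let e' : ι → Fin E.rank → C.X.functionField := fun i => E.gen hU (e (σ i))
  have he' : LinearIndependent C.X.functionField e' := hbe.comp σ σ.injective
  -- the change of basis between the two rational frames
  have hT : ∃ T : Matrix ι ι C.X.functionField, ∀ j, e' j = ∑ i, T i j • b i := by
    have : ∀ j, ∃ a : ι → C.X.functionField, ∑ i, a i • b i = e' j := fun j =>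
      (Submodule.mem_span_range_iff_exists_fun _).1 (hbF ▸ ⟨U, hU, _, he.1 _, rfl⟩)
    choose a ha using this
    exact ⟨fun i j => a j i, fun j => (ha j).symm⟩
  obtain ⟨T, hT⟩ := hT
  have hT0 : T.det ≠ 0 := det_ne_zero_of_linearIndependent he' hT
  have hA0 : ∀ x, (A x).det ≠ 0 := fun x => det_ne_zero_of_linearIndependent hb (hA x)
  have key : ∀ x, Scheme.ord (A x).det x = n x - Scheme.ord T.det x := by
    intro x
    obtain ⟨V, hxV, hη, g, B, hg, hB, hBn⟩ := hn x
    have h1 := gen_eq_sum_of_res_eq inf_le_left inf_le_right hη hB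
    have h2 : ∀ j, e' j = ∑ i, ((B.map (toField hη)).submatrix σ σ) i j • E.gen (hη.2) (g (σ i)) := by
      intro j
      refine (h1 (σ j)).trans ?_
      exact (Equiv.sum_comp σ fun i => (B.map (toField hη)) i (σ j) • E.gen (hη.2) (g i)).symm
    have h3 := ord_det_eq he' (hf x) ((F.isLatticeBasis_gen hxV hg).comp_equiv σ)
      (sum_smul_sum_smul (hA x) hT) h2
    rw [Matrix.det_submatrix_equiv_self, Matrix.det_mul, Scheme.ord_mul (hA0 x) hT0] at h3
    have h4 : (B.map (toField hη)).det = toField hη B.det := ((toField hη).map_det B).symm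
    rw [h4] at h3
    have h5 : Scheme.ord (toField hη B.det) x = n x := hBn
    omega
  obtain ⟨hTfin, hTsum⟩ := C.finite_support_ord_and_finsum_ord hT0
  have hkey : (fun x => Scheme.ord (A x).det x) = fun x => n x - Scheme.ord T.det x := funext key
  rw [hkey]
  refine ⟨(hfin.union hTfin).subset (Function.support_sub _ _), ?_⟩
  rw [finsum_sub_distrib hfin hTfin, hTsum, sub_zero]

/-- The orders of a rational section of `det F` vanish outside a finite set, so that it has a
degree. -/
theorem exists_hasDegree : ∃ d, HasDegree E.sheaf F.sections F.rank d := by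
  obtain ⟨U, hU, e, -, he⟩ := F.exists_adapted_frame (genericPoint C.X)
  choose V hxV f _ hf using F.exists_adapted_frame
  have hA : ∀ x, ∃ A : Matrix (Fin F.rank) (Fin F.rank) Γ(C.X, U ⊓ V x), ∀ j,
      res E.sheaf inf_le_left (e (Fin.castLE F.rank_le j)) =
        ∑ i, A i j • res E.sheaf inf_le_right (f x (Fin.castLE F.rank_le i)) := fun x =>
    exists_matrix_of_isFrame (e := fun j => e (Fin.castLE F.rank_le j)) inf_le_left inf_le_right
      (fun i => F.res_mem _ _ (he.1 i)) (hf x)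
  choose A hA using hA
  have hη : ∀ x, genericPoint C.X ∈ U ⊓ V x := fun x => mem_inf_of_mem hU (genericPoint_mem (hxV x))
  -- `m y x` is the order at `x` of the section, written in the frame chosen around `y`
  let m : C.X → C.X → ℤ := fun y x => Scheme.ord (toField (hη y) (A y).det) x
  refine ⟨_, U, hU, fun j => e (Fin.castLE F.rank_le j), fun x => m x x, he, fun x => ?_, ?_, rfl⟩
  · exact ⟨V x, hxV x, hη x, fun j => f x (Fin.castLE F.rank_le j), A x, hf x, hA x, rfl⟩
  · -- on each of the finitely many sets of a trivializing cover, the orders are those of one function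
    have hgen := fun y => gen_eq_sum_of_res_eq inf_le_left inf_le_right (hη y) (hA y)
    have hlin := E.linearIndependent_gen hU he
    have hm : ∀ y x, x ∈ V y → m x x = m y x := by
      intro y x hx
      have h := ord_det_eq hlin (F.isLatticeBasis_gen (hxV x) (hf x))
          (F.isLatticeBasis_gen hx (hf y)) (hgen x) (hgen y)
      have h1 : ∀ z, ((A z).map (toField (hη z))).det = toField (hη z) (A z).det := fun z =>
        ((toField (hη z)).map_det (A z)).symm
      rw [h1, h1] at h
      exact h
    have hm0 : ∀ y, toField (hη y) (A y).det ≠ 0 := by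
      intro y
      have h := det_ne_zero_of_linearIndependent hlin (hgen y)
      rwa [show ((A y).map (toField (hη y))).det = toField (hη y) (A y).det from
        ((toField (hη y)).map_det (A y)).symm] at h
    have := C.proper
    have : CompactSpace C.X := QuasiCompact.compactSpace_of_compactSpace C.str
    obtain ⟨t, ht⟩ := isCompact_univ.elim_nhds_subcover (fun x => (V x : Set C.X))
      fun x _ => (V x).isOpen.mem_nhds (hxV x)
    refine ((t.finite_toSet.biUnion fun y _ =>
      (C.finite_support_ord_and_finsum_ord (hm0 y)).1)).subset fun x hx => ?_
    obtain ⟨y, hy, hxy⟩ := Set.mem_iUnion₂.1 (ht.2 (Set.mem_univ x))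
    refine Set.mem_biUnion hy ?_
    rw [Function.mem_support] at hx ⊢
    rwa [hm y x hxy] at hx

/-- The degree of `F` is that of the divisor of `b₁ ∧ … ∧ b_r` for any basis `b` of the generic
fibre. -/
theorem degree_eq {ι : Type*} [Fintype ι] [DecidableEq ι] {b : ι → Fin E.rank → C.X.functionField}
    (hb : LinearIndependent C.X.functionField b)
    (hbF : Submodule.span C.X.functionField (Set.range b) = F.gen)
    {f : C.X → ι → Fin E.rank → C.X.functionField} (hf : ∀ x, IsLatticeBasis (E.lattice x) F.gen (f x))
    {A : C.X → Matrix ι ι C.X.functionField} (hA : ∀ x j, b j = ∑ i, A x i j • f x i) :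
    (Function.support fun x => Scheme.ord (A x).det x).Finite ∧ F.degree = ∑ᶠ x, Scheme.ord (A x).det x :=
  F.eq_finsum_of_hasDegree hb hbF hf hA (Classical.epsilon_spec F.exists_hasDegree)

end Subbundle

end Degree

/-! ### Line bundles and the bilinear form on the generic fibre -/

namespace IsFrame

variable {M : C.X.Modules} {r : ℕ} {U : C.X.Opens} {e : Fin r → Γ(M, U)}

/-- The coordinates in a frame. -/
def coords (he : IsFrame M (fun _ => ⊤) U e) {V : C.X.Opens} (h : V ≤ U) :
    Γ(M, V) →ₗ[Γ(C.X, V)] (Fin r → Γ(C.X, V)) where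
  toFun s := (he.2 V h s Submodule.mem_top).choose
  map_add' s t := by
    refine he.ext h ?_
    rw [← (he.2 V h (s + t) Submodule.mem_top).choose_spec.1]
    simp only [Pi.add_apply, add_smul, Finset.sum_add_distrib]
    rw [← (he.2 V h s Submodule.mem_top).choose_spec.1, ← (he.2 V h t Submodule.mem_top).choose_spec.1]
  map_smul' a s := by
    refine he.ext h ?_
    rw [← (he.2 V h (a • s) Submodule.mem_top).choose_spec.1]
    refine (congrArg (a • ·) (he.2 V h s Submodule.mem_top).choose_spec.1).trans ?_
    simp only [Finset.smul_sum, smul_smul, Pi.smul_apply, smul_eq_mul, RingHom.id_apply]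

theorem sum_coords (he : IsFrame M (fun _ => ⊤) U e) {V : C.X.Opens} (h : V ≤ U) (s : Γ(M, V)) :
    s = ∑ i, he.coords h s i • res M h (e i) :=
  (he.2 V h s Submodule.mem_top).choose_spec.1

theorem coords_res (he : IsFrame M (fun _ => ⊤) U e) {V W : C.X.Opens} (h : V ≤ U) (hW : W ≤ V)
    (s : Γ(M, V)) (i : Fin r) :
    he.coords (hW.trans h) (res M hW s) i = resFun hW (he.coords h s i) := by
  refine congrFun (he.ext (hW.trans h) (b := fun i => resFun hW (he.coords h s i)) ?_) i
  rw [← he.sum_coords, ← res_sum_smul M h hW, ← he.sum_coords]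

theorem restrict (he : IsFrame M (fun _ => ⊤) U e) {V : C.X.Opens} (h : V ≤ U) :
    IsFrame M (fun _ => ⊤) V fun i => res M h (e i) := by
  refine ⟨fun _ => Submodule.mem_top, fun W hW s hs => ?_⟩
  simp only [res_res]
  exact he.2 W (hW.trans h) s hs

theorem coords_frame (he : IsFrame M (fun _ => ⊤) U e) {V : C.X.Opens} (h : V ≤ U) (j : Fin r) :
    he.coords h (res M h (e j)) = Pi.single j 1 := by
  refine he.ext h ?_
  rw [← he.sum_coords, Finset.sum_eq_single j]
  · simp
  · intro i _ hi
    simp [hi]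
  · simp

end IsFrame

namespace LineBundle

variable (N : LineBundle C)

/-- The index of the only member of a frame of a line bundle. -/
def idx : Fin N.rank := ⟨0, N.rank_eq_one ▸ Nat.one_pos⟩

theorem eq_idx (i : Fin N.rank) : i = N.idx := by
  have h1 := i.2
  have h2 := N.rank_eq_one
  apply Fin.ext
  change i.1 = 0
  omega

theorem sum_eq {A : Type*} [AddCommMonoid A] (g : Fin N.rank → A) : ∑ i, g i = g N.idx :=
  Fintype.sum_eq_single _ fun i hi => absurd (N.eq_idx i) hi

/-- The rational function by which a section of a line bundle is expressed in its rational frame. -/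
def rat {U : C.X.Opens} (hU : genericPoint C.X ∈ U) (t : Γ(N.sheaf, U)) : C.X.functionField :=
  N.toVectorBundle.gen hU t N.idx

theorem rat_eq_zero_iff {U : C.X.Opens} (hU : genericPoint C.X ∈ U) {t : Γ(N.sheaf, U)} :
    N.rat hU t = 0 ↔ t = 0 := by
  constructor
  · intro h
    refine N.toVectorBundle.eq_zero_of_gen_eq_zero hU (funext fun i => ?_)
    rw [N.eq_idx i]
    exact h
  · rintro rfl
    exact congrFun (N.toVectorBundle.gen_zero hU) _

theorem rat_sum_smul {U : C.X.Opens} (hU : genericPoint C.X ∈ U) {ι : Type*} [Fintype ι]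
    (a : ι → Γ(C.X, U)) (t : ι → Γ(N.sheaf, U)) :
    N.rat hU (∑ i, a i • t i) = ∑ i, toField hU (a i) * N.rat hU (t i) := by
  simp only [rat, VectorBundle.gen_sum, VectorBundle.gen_smul, Finset.sum_apply, Pi.smul_apply, smul_eq_mul]

theorem rat_smul {U : C.X.Opens} (hU : genericPoint C.X ∈ U) (a : Γ(C.X, U)) (t : Γ(N.sheaf, U)) :
    N.rat hU (a • t) = toField hU a * N.rat hU t := by
  simp only [rat, VectorBundle.gen_smul, Pi.smul_apply, smul_eq_mul]

theorem rat_res {U V : C.X.Opens} (h : V ≤ U) (hV : genericPoint C.X ∈ V) (t : Γ(N.sheaf, U)) :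
    N.rat hV (res N.sheaf h t) = N.rat (h hV) t :=
  congrFun (N.toVectorBundle.gen_res h hV t) _

theorem gen_eq_const {U : C.X.Opens} (hU : genericPoint C.X ∈ U) (t : Γ(N.sheaf, U)) :
    N.toVectorBundle.gen hU t = Function.const _ (N.rat hU t) := by
  funext i
  rw [N.eq_idx i]
  rfl

/-- The degree of a line bundle in terms of local generators. -/
theorem degree_eq {ν : C.X → C.X.functionField} (hν0 : ∀ x, ν x ≠ 0)
    (hν : ∀ x, IsLatticeBasis (N.toVectorBundle.lattice x) (⊤ : Submodule C.X.functionField _)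
      (fun _ : Unit => Function.const _ (ν x))) :
    (Function.support fun x => Scheme.ord (ν x) x).Finite ∧ N.degree = - ∑ᶠ x, Scheme.ord (ν x) x := by
  have h1 : LinearIndependent C.X.functionField (fun _ : Unit =>
      (Function.const (Fin N.rank) (1 : C.X.functionField))) := by
    rw [Fintype.linearIndependent_iff]
    intro g hg i
    have := congrFun hg N.idx
    simpa using this
  have h2 : Submodule.span C.X.functionField (Set.range fun _ : Unit =>
      (Function.const (Fin N.rank) (1 : C.X.functionField))) =
      (Subbundle.whole N.toVectorBundle).gen := by
    rw [Subbundle.gen_whole, eq_top_iff]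
    intro v _
    have : v = v N.idx • Function.const (Fin N.rank) (1 : C.X.functionField) := by
      funext i
      rw [N.eq_idx i]
      simp
    rw [this]
    exact Submodule.smul_mem _ _ (Submodule.subset_span ⟨(), rfl⟩)
  have h3 := (Subbundle.whole N.toVectorBundle).degree_eq h1 h2
    (f := fun x (_ : Unit) => Function.const _ (ν x)) (fun x => by rw [Subbundle.gen_whole]; exact hν x)
    (A := fun x => Matrix.of fun _ _ => (ν x)⁻¹) (fun x j => by
      funext i
      simp [hν0 x])
  have h4 : (fun x => Scheme.ord (Matrix.of fun (_ _ : Unit) => (ν x)⁻¹).det x) =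
      fun x => - Scheme.ord (ν x) x := by
    funext x
    rw [Matrix.det_unique]
    exact C.ord_inv (hν0 x) x
  rw [h4, finsum_neg_distrib] at h3
  refine ⟨?_, h3.2⟩
  have h5 := h3.1
  rwa [Function.support_fun_neg] at h5

end LineBundle

namespace SymForm

variable {E : VectorBundle C} {N : LineBundle C} (Q : SymForm E N.toVectorBundle)

/-- The bilinear form induced by `Q` on the generic fibre. -/
def bilin : LinearMap.BilinForm C.X.functionField (Fin E.rank → C.X.functionField) :=
  Matrix.toBilin' (Matrix.of fun i j =>
    N.rat E.genericPoint_mem_trivOpen (Q.form _ (E.ratFrame i) (E.ratFrame j)))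

theorem bilin_comm (v w : Fin E.rank → C.X.functionField) : Q.bilin v w = Q.bilin w v := by
  rw [bilin, Matrix.toBilin'_apply, Matrix.toBilin'_apply, Finset.sum_comm]
  refine Finset.sum_congr rfl fun i _ => Finset.sum_congr rfl fun j _ => ?_
  rw [Matrix.of_apply, Matrix.of_apply, Q.symm]
  ring

/-- The form on the generic fibre extends the values of `Q` on sections. -/
theorem bilin_gen {U : C.X.Opens} (hU : genericPoint C.X ∈ U) (s t : Γ(E.sheaf, U)) :
    Q.bilin (E.gen hU s) (E.gen hU t) = N.rat hU (Q.form U s t) := by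
  have hη := mem_inf_of_mem hU E.genericPoint_mem_trivOpen
  obtain ⟨a, ha⟩ := E.exists_coords s
  obtain ⟨b, hb⟩ := E.exists_coords t
  rw [E.gen_eq_of_res_eq hU hη _ _ ha, E.gen_eq_of_res_eq hU hη _ _ hb, ← N.rat_res inf_le_left hη,
    ← Q.form_res, ha, hb, bilin, Matrix.toBilin'_apply]
  have h1 : Q.form (U ⊓ E.trivOpen) (∑ i, a i • res E.sheaf inf_le_right (E.ratFrame i))
      (∑ i, b i • res E.sheaf inf_le_right (E.ratFrame i)) =
      ∑ i, a i • ∑ j, b j • res N.sheaf inf_le_right (Q.form _ (E.ratFrame i) (E.ratFrame j)) := by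
    rw [LinearMap.map_sum₂]
    refine Finset.sum_congr rfl fun i _ => ?_
    rw [LinearMap.map_smul₂, map_sum]
    refine congrArg _ (Finset.sum_congr rfl fun j _ => ?_)
    rw [map_smul, Q.form_res]
  rw [h1, N.rat_sum_smul hη]
  refine Finset.sum_congr rfl fun i _ => ?_
  rw [N.rat_sum_smul hη, Finset.mul_sum]
  refine Finset.sum_congr rfl fun j _ => ?_
  rw [N.rat_res inf_le_right hη, Matrix.of_apply]
  ring

theorem nonzeroOn_iff {F G : Subbundle E} : Q.NonzeroOn F G ↔ ∃ v ∈ F.gen, ∃ w ∈ G.gen, Q.bilin v w ≠ 0 := by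
  constructor
  · rintro ⟨U, s, t, hs, ht, h⟩
    have hU : genericPoint C.X ∈ U := by
      by_contra hU
      have := subsingleton_of_genericPoint_notMem hU
      have := Module.subsingleton Γ(C.X, U) Γ(N.sheaf, U)
      exact h (Subsingleton.elim _ _)
    refine ⟨_, (F.mem_sections_iff hU).1 hs, _, (G.mem_sections_iff hU).1 ht, ?_⟩
    rw [Q.bilin_gen hU]
    exact fun h0 => h ((N.rat_eq_zero_iff hU).1 h0)
  · rintro ⟨_, ⟨U, hU, s, hs, rfl⟩, _, ⟨V, hV, t, ht, rfl⟩, h⟩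
    have hη := mem_inf_of_mem hU hV
    refine ⟨U ⊓ V, res E.sheaf inf_le_left s, res E.sheaf inf_le_right t, F.res_mem _ _ hs,
      G.res_mem _ _ ht, fun h0 => h ?_⟩
    rw [← E.gen_res inf_le_left hη, ← E.gen_res inf_le_right hη, Q.bilin_gen, h0]
    exact (N.rat_eq_zero_iff hη).2 rfl

/-- The homomorphism `E → N` over `U` that sends the `k`-th member of a frame to the generator `n`
of `N` and the other members to `0`. -/
def dualHom {U : C.X.Opens} {e : Fin E.rank → Γ(E.sheaf, U)} (he : IsFrame E.sheaf (fun _ => ⊤) U e)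
    (n : Γ(N.sheaf, U)) (k : Fin E.rank) :
    LocalHom E N.toVectorBundle U where
  app V hV := (LinearMap.toSpanSingleton _ _ (res N.sheaf hV n)) ∘ₗ (LinearMap.proj k) ∘ₗ he.coords hV
  app_res V W hV hW s := by
    simp only [LinearMap.comp_apply, LinearMap.proj_apply, LinearMap.toSpanSingleton_apply]
    rw [he.coords_res, res_smul, res_res]

/-- At every point, a form inducing an isomorphism has an invertible Gram matrix `g`, up to a local
generator `ν` of `N`. -/
theorem exists_unimodular (hQ : Q.InducesIso) (x : C.X) :
    ∃ (ν : C.X.functionField) (f : Fin E.rank → Fin E.rank → C.X.functionField)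
      (g : Matrix (Fin E.rank) (Fin E.rank) (C.X.presheaf.stalk x)),
      ν ≠ 0 ∧
      IsLatticeBasis (N.toVectorBundle.lattice x)
        (⊤ : Submodule C.X.functionField _) (fun _ : Unit => Function.const _ ν) ∧
      IsLatticeBasis (E.lattice x) (⊤ : Submodule C.X.functionField _) f ∧ IsUnit g.det ∧
      ∀ i j, Q.bilin (f i) (f j) = ν * algebraMap _ C.X.functionField (g i j) := by
  obtain ⟨U₁, hx₁, e₁, he₁⟩ := E.locallyFree x
  obtain ⟨U₂, hx₂, n₂, hn₂⟩ := N.locallyFree x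
  obtain ⟨U, hx, e, he, n, hn⟩ : ∃ (U : C.X.Opens) (_ : x ∈ U) (e : Fin E.rank → Γ(E.sheaf, U))
      (_ : IsFrame E.sheaf (fun _ => ⊤) U e) (n : Fin N.rank → Γ(N.sheaf, U)),
      IsFrame N.sheaf (fun _ => ⊤) U n :=
    ⟨U₁ ⊓ U₂, mem_inf_of_mem hx₁ hx₂, _, he₁.restrict inf_le_left, _, hn₂.restrict inf_le_right⟩
  have hη := genericPoint_mem hx
  have hf := E.isLatticeBasis_gen hx he
  have hν := (N.toVectorBundle.isLatticeBasis_gen hx hn).comp_equiv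
    (Equiv.ofBijective (fun _ : Unit => N.idx) ⟨fun _ _ _ => rfl, fun i => ⟨(), (N.eq_idx i).symm⟩⟩)
  have hν' : ((fun i => N.toVectorBundle.gen hη (n i)) ∘
      (Equiv.ofBijective (fun _ : Unit => N.idx) ⟨fun _ _ _ => rfl, fun i => ⟨(), (N.eq_idx i).symm⟩⟩)) =
      fun _ : Unit => Function.const _ (N.rat hη (n N.idx)) := funext fun _ => N.gen_eq_const hη _
  rw [hν'] at hν
  have hν0 : N.rat hη (n N.idx) ≠ 0 := by
    intro h0
    refine hν.linearIndependent.ne_zero () ?_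
    rw [h0]
    rfl
  let c : Matrix (Fin E.rank) (Fin E.rank) Γ(C.X, U) := fun i j =>
    hn.coords le_rfl (Q.form U (e i) (e j)) N.idx
  let g : Matrix (Fin E.rank) (Fin E.rank) (C.X.presheaf.stalk x) := fun i j =>
      C.X.presheaf.germ U x hx (c i j)
  have hg : ∀ i j, Q.bilin (E.gen hη (e i)) (E.gen hη (e j)) =
      N.rat hη (n N.idx) * algebraMap _ C.X.functionField (g i j) := by
    intro i j
    rw [Q.bilin_gen, algebraMap_germ hx, hn.sum_coords le_rfl (Q.form U (e i) (e j)), N.sum_eq,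
      res_self, N.rat_smul,
      mul_comm]
  -- sections dual to the frame with respect to `Q` give the inverse of the Gram matrix
  choose s hs using fun k => (hQ U).2 (dualHom he (n N.idx) k)
  have hsk : ∀ k i, Q.bilin (E.gen hη (s k)) (E.gen hη (e i)) = N.rat hη (n N.idx) *
      (1 : Matrix (Fin E.rank) (Fin E.rank) C.X.functionField) k i := by
    intro k i
    have h1 : Q.form U (res E.sheaf le_rfl (s k)) (e i) =
        he.coords le_rfl (e i) k • res N.sheaf le_rfl (n N.idx) :=
      congrArg (fun L : LocalHom E N.toVectorBundle U => L.app U le_rfl (e i)) (hs k)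
    have h2 : he.coords le_rfl (e i) = Pi.single i 1 := by
      have := he.coords_frame le_rfl i
      rwa [res_self] at this
    rw [res_self, res_self, h2] at h1
    rw [Q.bilin_gen, h1, N.rat_smul, mul_comm, Matrix.one_apply, Pi.single_apply]
    split_ifs <;> simp
  choose h hh using fun k => hf.exists_coeff (E.gen_mem_lattice hx (s k)) Submodule.mem_top
  have hhg : (Matrix.of h) * g = 1 := by
    ext k i
    refine IsFractionRing.injective (C.X.presheaf.stalk x) C.X.functionField (mul_left_cancel₀ hν0 ?_)
    have h1 := hsk k i
    rw [hh k] at h1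
    simp only [map_sum, LinearMap.sum_apply] at h1
    have h2 : ∀ j, Q.bilin (h k j • E.gen hη (e j)) (E.gen hη (e i)) =
        N.rat hη (n N.idx) * (algebraMap _ C.X.functionField (h k j) *
          algebraMap _ C.X.functionField (g j i)) := by
      intro j
      rw [← algebraMap_smul C.X.functionField (h k j), map_smul, LinearMap.smul_apply, hg, smul_eq_mul]
      ring
    simp only [h2, ← Finset.mul_sum, ← map_mul, ← map_sum] at h1
    rw [Matrix.mul_apply]
    refine h1.trans (congrArg _ ?_)
    rw [Matrix.one_apply, Matrix.one_apply]
    split_ifs <;> simp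
  refine ⟨_, _, g, hν0, hν, hf, ?_, hg⟩
  refine IsUnit.of_mul_eq_one (Matrix.of h).det ?_
  rw [mul_comm, ← Matrix.det_mul, hhg, Matrix.det_one]

end SymForm

/-! ### Degrees of subquotients in perfect pairing -/

namespace VectorBundle

variable (E : VectorBundle C)

/-- The degree of the subbundle with a given generic fibre. -/
def subDegree (W : Submodule C.X.functionField (Fin E.rank → C.X.functionField)) : ℤ :=
    (Subbundle.ofSubspace W).degree

theorem subDegree_eq {W : Submodule C.X.functionField (Fin E.rank → C.X.functionField)}
    {ι : Type*} [Fintype ι] [DecidableEq ι] {b : ι → Fin E.rank → C.X.functionField}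
    (hb : LinearIndependent C.X.functionField b)
    (hbF : Submodule.span C.X.functionField (Set.range b) = W)
    {f : C.X → ι → Fin E.rank → C.X.functionField} (hf : ∀ x, IsLatticeBasis (E.lattice x) W (f x))
    {A : C.X → Matrix ι ι C.X.functionField} (hA : ∀ x j, b j = ∑ i, A x i j • f x i) :
    (Function.support fun x => Scheme.ord (A x).det x).Finite ∧ E.subDegree W =
      ∑ᶠ x, Scheme.ord (A x).det x :=
  (Subbundle.ofSubspace W).degree_eq hb (by rw [hbF, Subbundle.gen_ofSubspace])
    (fun x => by rw [Subbundle.gen_ofSubspace]; exact hf x) hA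

/-- A vector space has a basis adapted to a flag of two subspaces: the case of the lattice `⊤` over
the field itself. -/
theorem exists_basis_sum {ι κ : Type} [Fintype ι] [Fintype κ]
    {I W : Submodule C.X.functionField (Fin E.rank → C.X.functionField)} (hIW : I ≤ W)
    (hι : Fintype.card ι = Module.finrank C.X.functionField I)
    (hκ : Fintype.card ι + Fintype.card κ = Module.finrank C.X.functionField W) :
    ∃ b : ι ⊕ κ → Fin E.rank → C.X.functionField, LinearIndependent C.X.functionField b ∧
      Submodule.span C.X.functionField (Set.range b) = W ∧
      Submodule.span C.X.functionField (Set.range (b ∘ Sum.inl)) = I := by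
  obtain ⟨b, hb, hbI⟩ := OrthBundle.exists_isLatticeBasis_sum
      (R := C.X.functionField) (K := C.X.functionField)
    (L := (⊤ : Submodule C.X.functionField (Fin E.rank → C.X.functionField))) (ι := ι) (κ := κ)
    Module.Finite.fg_top (fun v => ⟨1, one_ne_zero, Submodule.mem_top⟩) hIW hι hκ
  exact ⟨b, hb.linearIndependent, hb.span_eq, hbI.span_eq⟩

end VectorBundle

namespace Subbundle

theorem degree_eq_subDegree {E : VectorBundle C} (F : Subbundle E) : F.degree = E.subDegree F.gen := by
  obtain ⟨b, hb, hbF, -⟩ := E.exists_basis_sum (ι := Fin 0) (κ := Fin F.rank) (bot_le : ⊥ ≤ F.gen) (by simp)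
    (by simp [F.finrank_gen])
  choose f hf _ using fun x => E.exists_isLatticeBasis_sum (ι := Fin 0) (κ := Fin F.rank) x
      (bot_le : ⊥ ≤ F.gen) (by simp)
    (by simp [F.finrank_gen])
  choose A hA using fun x => (hf x).exists_matrix (b := b) (fun j => hbF ▸ Submodule.subset_span ⟨j, rfl⟩)
  rw [(F.degree_eq hb hbF hf hA).2, (E.subDegree_eq hb hbF hf hA).2]

end Subbundle

namespace VectorBundle

variable (E : VectorBundle C)

theorem degree_eq_subDegree_top : E.degree = E.subDegree ⊤ := by
  rw [VectorBundle.degree, Subbundle.degree_eq_subDegree, Subbundle.gen_whole]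

theorem subDegree_bot : E.subDegree ⊥ = 0 := by
  have h := (E.subDegree_eq (W := ⊥) (ι := Fin 0) (b := Fin.elim0) (linearIndependent_empty_type)
      (by simp) (f := fun _ => Fin.elim0)
    (fun x => ⟨linearIndependent_empty_type, by simp, fun v _ hv => by
      rw [(Submodule.mem_bot _).1 hv]; exact Submodule.zero_mem _, fun i => i.elim0⟩)
    (A := fun _ => 1) (fun _ j => j.elim0)).2
  rw [h]
  simp [C.ord_one]

/-- For adapted bases of `I ≤ W`, the degree of `W/I` is computed by the second diagonal blocks. -/
theorem subDegree_sub_subDegree {ι κ : Type*} [Fintype ι] [Fintype κ] [DecidableEq ι] [DecidableEq κ]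
    {I W : Submodule C.X.functionField (Fin E.rank → C.X.functionField)}
    {b : ι ⊕ κ → Fin E.rank → C.X.functionField} (hb : LinearIndependent C.X.functionField b)
    (hbW : Submodule.span C.X.functionField (Set.range b) = W)
    (hbI : Submodule.span C.X.functionField (Set.range (b ∘ Sum.inl)) = I)
    {f : C.X → ι ⊕ κ → Fin E.rank → C.X.functionField} (hf : ∀ x, IsLatticeBasis (E.lattice x) W (f x))
    (hfI : ∀ x, IsLatticeBasis (E.lattice x) I (f x ∘ Sum.inl))
    {A : C.X → Matrix (ι ⊕ κ) (ι ⊕ κ) C.X.functionField} (hA : ∀ x j, b j = ∑ i, A x i j • f x i) :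
    (∀ x, (A x).toBlocks₂₂.det ≠ 0) ∧
    (Function.support fun x => Scheme.ord (A x).toBlocks₂₂.det x).Finite ∧
      E.subDegree W - E.subDegree I = ∑ᶠ x, Scheme.ord (A x).toBlocks₂₂.det x := by
  have h1 := fun x => det_eq_mul_of_adapted (hf x).linearIndependent
    (fun i => (hfI x).span_eq ▸ hbI ▸ Submodule.subset_span ⟨i, rfl⟩) (hA x)
  have h0 := fun x => det_ne_zero_of_linearIndependent hb (hA x)
  have h11 : ∀ x, (A x).toBlocks₁₁.det ≠ 0 := fun x h => h0 x (by rw [(h1 x).1, h, zero_mul])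
  have h22 : ∀ x, (A x).toBlocks₂₂.det ≠ 0 := fun x h => h0 x (by rw [(h1 x).1, h, mul_zero])
  obtain ⟨hW, hW'⟩ := E.subDegree_eq hb hbW hf hA
  obtain ⟨hI, hI'⟩ := E.subDegree_eq (hb.comp _ Sum.inl_injective) hbI hfI (fun x => (h1 x).2)
  have h2 : (fun x => Scheme.ord (A x).toBlocks₂₂.det x) =
      fun x => Scheme.ord (A x).det x - Scheme.ord (A x).toBlocks₁₁.det x := by
    funext x
    rw [(h1 x).1, Scheme.ord_mul (h11 x) (h22 x)]
    ring
  refine ⟨h22, ?_, ?_⟩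
  · rw [h2]
    exact (hW.union hI).subset (Function.support_sub _ _)
  · rw [h2, finsum_sub_distrib hW hI, hW', hI']

end VectorBundle

namespace SymForm

variable {E : VectorBundle C} {N : LineBundle C} (Q : SymForm E N.toVectorBundle)

/-- The form on the generic fibre is nondegenerate. -/
theorem eq_zero_of_bilin_eq_zero (hQ : Q.InducesIso)
    {v : Fin E.rank → C.X.functionField} (hv : ∀ w, Q.bilin v w = 0) :
    v = 0 := by
  -- any point will do; the generic point serves to have one
  have h : ∀ _ : C.X, v = 0 := by
    intro x
    obtain ⟨ν, f, g, hν0, -, hf, hgu, hg⟩ := Q.exists_unimodular hQ x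
    obtain ⟨c, rfl⟩ := hf.exists_coeff_field (v := v) Submodule.mem_top
    have hdet : (g.map (algebraMap _ C.X.functionField)).det ≠ 0 := by
      have h3 := RingHom.map_det (algebraMap (C.X.presheaf.stalk x) C.X.functionField) g
      rw [RingHom.mapMatrix_apply] at h3
      rw [← h3]
      exact (hgu.map _).ne_zero
    have hc : c = 0 := by
      refine Matrix.eq_zero_of_vecMul_eq_zero hdet (funext fun j => mul_left_cancel₀ hν0 ?_)
      have h1 := hv (f j)
      simp only [LinearMap.map_sum₂, LinearMap.map_smul₂, hg, smul_eq_mul] at h1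
      rw [Pi.zero_apply, mul_zero, ← h1, Matrix.vecMul, dotProduct, Finset.mul_sum]
      refine Finset.sum_congr rfl fun i _ => ?_
      rw [Matrix.map_apply]
      ring
    simp [hc]
  exact h (genericPoint C.X)

/-- A perfect pairing of `W₁/I₁` and `W₂/I₂` with values in `N` whose Gram matrices in local bases
are `ν x • G x` expresses the degrees of `W₁/I₁` and `W₂/I₂` by the degree of `N` and the divisor of
the determinants of `G`. -/
theorem subDegree_add_finsum_ord {ι₁ ι₂ κ : Type} [Fintype ι₁] [Fintype ι₂] [Fintype κ]
    [DecidableEq ι₁] [DecidableEq ι₂] [DecidableEq κ]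
    {I₁ W₁ I₂ W₂ : Submodule C.X.functionField (Fin E.rank → C.X.functionField)}
    (hIW₁ : I₁ ≤ W₁) (hIW₂ : I₂ ≤ W₂)
    (hι₁ : Fintype.card ι₁ = Module.finrank C.X.functionField I₁)
    (hκ₁ : Fintype.card ι₁ + Fintype.card κ = Module.finrank C.X.functionField W₁)
    (hι₂ : Fintype.card ι₂ = Module.finrank C.X.functionField I₂)
    (hκ₂ : Fintype.card ι₂ + Fintype.card κ = Module.finrank C.X.functionField W₂)
    (hz₁ : ∀ v ∈ I₁, ∀ w ∈ W₂, Q.bilin v w = 0) (hz₂ : ∀ v ∈ W₁, ∀ w ∈ I₂, Q.bilin v w = 0)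
    (hnd : ∀ v ∈ W₁, (∀ w ∈ W₂, Q.bilin v w = 0) → v ∈ I₁)
    {ν : C.X → C.X.functionField} (hν0 : ∀ x, ν x ≠ 0)
    (hν : ∀ x, IsLatticeBasis (N.toVectorBundle.lattice x) (⊤ : Submodule C.X.functionField _)
      (fun _ : Unit => Function.const _ (ν x)))
    {f₁ : C.X → ι₁ ⊕ κ → Fin E.rank → C.X.functionField} (hf₁ : ∀ x, IsLatticeBasis (E.lattice x) W₁ (f₁ x))
    (hfI₁ : ∀ x, IsLatticeBasis (E.lattice x) I₁ (f₁ x ∘ Sum.inl))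
    {f₂ : C.X → ι₂ ⊕ κ → Fin E.rank → C.X.functionField} (hf₂ : ∀ x, IsLatticeBasis (E.lattice x) W₂ (f₂ x))
    (hfI₂ : ∀ x, IsLatticeBasis (E.lattice x) I₂ (f₂ x ∘ Sum.inl))
    {G : C.X → Matrix κ κ C.X.functionField}
    (hG : ∀ x i j, Q.bilin (f₁ x (Sum.inr i)) (f₂ x (Sum.inr j)) = ν x * G x i j) :
    (E.subDegree W₁ - E.subDegree I₁) + (E.subDegree W₂ - E.subDegree I₂) + ∑ᶠ x, Scheme.ord (G x).det x =
      Fintype.card κ * N.degree := by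
  obtain ⟨b₁, hb₁, hbW₁, hbI₁⟩ := E.exists_basis_sum hIW₁ hι₁ hκ₁
  obtain ⟨b₂, hb₂, hbW₂, hbI₂⟩ := E.exists_basis_sum hIW₂ hι₂ hκ₂
  have hm₁ : ∀ j, b₁ j ∈ W₁ := fun j => hbW₁ ▸ Submodule.subset_span ⟨j, rfl⟩
  have hm₂ : ∀ j, b₂ j ∈ W₂ := fun j => hbW₂ ▸ Submodule.subset_span ⟨j, rfl⟩
  choose A₁ hA₁ using fun x => (hf₁ x).exists_matrix hm₁
  choose A₂ hA₂ using fun x => (hf₂ x).exists_matrix hm₂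
  obtain ⟨h0₁, hfin₁, hd₁⟩ := E.subDegree_sub_subDegree hb₁ hbW₁ hbI₁ hf₁ hfI₁ hA₁
  obtain ⟨h0₂, hfin₂, hd₂⟩ := E.subDegree_sub_subDegree hb₂ hbW₂ hbI₂ hf₂ hfI₂ hA₂
  obtain ⟨hfinN, hdN⟩ := N.degree_eq hν0 hν
  -- the Gram matrix of rational bases of the two subquotients; its determinant is a rational
  -- function on the curve, with a divisor of degree `0`
  let B : Matrix κ κ C.X.functionField := Matrix.of fun j k => Q.bilin (b₁ (Sum.inr j)) (b₂ (Sum.inr k))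
  have hB0 : B.det ≠ 0 := by
    intro h
    obtain ⟨v, hv, hvB⟩ := Matrix.exists_vecMul_eq_zero_iff.2 h
    have hvW : ∑ j, v j • b₁ (Sum.inr j) ∈ W₁ := Submodule.sum_mem _ fun j _ => Submodule.smul_mem _ _ (hm₁ _)
    have hvI := hnd _ hvW fun w hw => by
      rw [← hbW₂] at hw
      obtain ⟨c, rfl⟩ := (Submodule.mem_span_range_iff_exists_fun _).1 hw
      rw [map_sum]
      refine Finset.sum_eq_zero fun k _ => ?_
      rw [map_smul]
      rcases k with k | k
      · rw [hz₂ _ hvW _ (hbI₂ ▸ Submodule.subset_span ⟨k, rfl⟩), smul_zero]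
      · have h1 := congrFun hvB k
        rw [LinearMap.map_sum₂]
        simp only [LinearMap.map_smul₂, smul_eq_mul]
        rw [show ∑ j, v j * Q.bilin (b₁ (Sum.inr j)) (b₂ (Sum.inr k)) = 0 from h1, mul_zero]
    rw [← hbI₁] at hvI
    obtain ⟨c, hc⟩ := (Submodule.mem_span_range_iff_exists_fun _).1 hvI
    have h2 : (Sum.elim c 0 : ι₁ ⊕ κ → C.X.functionField) = Sum.elim (fun _ => 0) v := by
      refine coeff_ext hb₁ ?_
      rw [Fintype.sum_sum_type, Fintype.sum_sum_type]
      simpa using hc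
    exact hv (funext fun k => (congrFun h2 (Sum.inr k)).symm)
  have hgram : ∀ x, B.det = (A₁ x).toBlocks₂₂.det * (ν x ^ Fintype.card κ * (G x).det) *
      (A₂ x).toBlocks₂₂.det := by
    intro x
    have h1 := gram_eq Q.bilin (hA₁ x) (hA₂ x)
      (fun i j => hz₁ _ ((hfI₁ x).mem_subspace i) _ ((hf₂ x).mem_subspace j))
      (fun i j => hz₂ _ ((hf₁ x).mem_subspace i) _ ((hfI₂ x).mem_subspace j))
    have h2 : (Matrix.of fun j k => Q.bilin (f₁ x (Sum.inr j)) (f₂ x (Sum.inr k))) = ν x • G x := by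
      ext i j
      exact hG x i j
    rw [h2] at h1
    rw [show B = _ from h1, Matrix.det_mul, Matrix.det_mul, Matrix.det_transpose, Matrix.det_smul]
  have hG0 : ∀ x, (G x).det ≠ 0 := fun x h => hB0 (by rw [hgram x, h]; ring)
  have hpow : ∀ x (n : ℕ), Scheme.ord (ν x ^ n) x = n * Scheme.ord (ν x) x := by
    intro x n
    induction n with
    | zero => simp [C.ord_one]
    | succ n ih =>
      rw [pow_succ, Scheme.ord_mul (pow_ne_zero _ (hν0 x)) (hν0 x), ih]
      push_cast
      ring
  have hord : (fun x => Scheme.ord (G x).det x) = fun x =>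
      (((Scheme.ord B.det x - Scheme.ord (A₁ x).toBlocks₂₂.det x) -
      Scheme.ord (A₂ x).toBlocks₂₂.det x) - Fintype.card κ * Scheme.ord (ν x) x) := by
    funext x
    rw [hgram x, Scheme.ord_mul (mul_ne_zero (h0₁ x) (mul_ne_zero (pow_ne_zero _ (hν0 x)) (hG0 x))) (h0₂ x),
      Scheme.ord_mul (h0₁ x) (mul_ne_zero (pow_ne_zero _ (hν0 x)) (hG0 x)),
      Scheme.ord_mul (pow_ne_zero _ (hν0 x)) (hG0 x), hpow]
    ring
  obtain ⟨hfinB, hdB⟩ := C.finite_support_ord_and_finsum_ord hB0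
  have hs1 := (hfinB.union hfin₁).subset (Function.support_sub _ _)
  have hs2 := (hs1.union hfin₂).subset (Function.support_sub _ _)
  have hs3 : (Function.support fun x => (Fintype.card κ : ℤ) * Scheme.ord (ν x) x).Finite :=
    hfinN.subset fun x hx => right_ne_zero_of_mul hx
  rw [hord, finsum_sub_distrib hs2 hs3, finsum_sub_distrib hs1 hfin₂,
    finsum_sub_distrib hfinB hfin₁, hdB, ← hd₁, ← hd₂,
    ← mul_finsum, hdN]
  ring

/-- If `W₁/I₁` and `W₂/I₂` are dual to each other with respect to `Q`, of dimension `m`, then their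
degrees add up to at most `m · deg N`. -/
theorem subDegree_sub_add_le (hQ : Q.InducesIso) {m : ℕ}
    {I₁ W₁ I₂ W₂ : Submodule C.X.functionField (Fin E.rank → C.X.functionField)}
    (hIW₁ : I₁ ≤ W₁) (hIW₂ : I₂ ≤ W₂)
    (hκ₁ : Module.finrank C.X.functionField I₁ + m = Module.finrank C.X.functionField W₁)
    (hκ₂ : Module.finrank C.X.functionField I₂ + m = Module.finrank C.X.functionField W₂)
    (hz₁ : ∀ v ∈ I₁, ∀ w ∈ W₂, Q.bilin v w = 0) (hz₂ : ∀ v ∈ W₁, ∀ w ∈ I₂, Q.bilin v w = 0)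
    (hnd : ∀ v ∈ W₁, (∀ w ∈ W₂, Q.bilin v w = 0) → v ∈ I₁) :
    (E.subDegree W₁ - E.subDegree I₁) + (E.subDegree W₂ - E.subDegree I₂) ≤ m * N.degree := by
  choose ν f g hν0 hν hf _ hg using Q.exists_unimodular hQ
  choose f₁ hf₁ hfI₁ using fun x => E.exists_isLatticeBasis_sum
      (ι := Fin (Module.finrank C.X.functionField I₁))
    (κ := Fin m) x hIW₁ (by simp) (by simpa using hκ₁)
  choose f₂ hf₂ hfI₂ using fun x => E.exists_isLatticeBasis_sum
      (ι := Fin (Module.finrank C.X.functionField I₂))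
    (κ := Fin m) x hIW₂ (by simp) (by simpa using hκ₂)
  -- the form takes values in the lattice of `N` on the lattice of `E`, so all Gram matrices are integral
  have hint : ∀ x, ∀ v ∈ E.lattice x, ∀ w ∈ E.lattice x, ∃ c : C.X.presheaf.stalk x,
      Q.bilin v w = ν x * algebraMap _ C.X.functionField c := by
    intro x v hv w hw
    obtain ⟨a, rfl⟩ := (hf x).exists_coeff hv Submodule.mem_top
    obtain ⟨b, rfl⟩ := (hf x).exists_coeff hw Submodule.mem_top
    refine ⟨∑ i, ∑ j, b i * (a j * g x j i), ?_⟩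
    simp only [← algebraMap_smul C.X.functionField (_ : C.X.presheaf.stalk x), map_sum, LinearMap.sum_apply,
      map_smul, LinearMap.smul_apply, hg, smul_eq_mul, map_mul, Finset.mul_sum]
    refine Finset.sum_congr rfl fun i _ => Finset.sum_congr rfl fun j _ => ?_
    ring
  choose G hG using fun x i j => hint x _ ((hf₁ x).mem (Sum.inr i)) _ ((hf₂ x).mem (Sum.inr j))
  have h1 := Q.subDegree_add_finsum_ord hIW₁ hIW₂ (by simp) (by simpa using hκ₁) (by simp)
      (by simpa using hκ₂) hz₁ hz₂ hnd
    hν0 hν hf₁ hfI₁ hf₂ hfI₂ (G := fun x => (Matrix.of (G x)).map (algebraMap _ C.X.functionField)) hG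
  have h2 : 0 ≤ ∑ᶠ x, Scheme.ord ((Matrix.of (G x)).map (algebraMap _ C.X.functionField)).det x := by
    refine finsum_nonneg fun x => ?_
    have h3 := RingHom.map_det (algebraMap (C.X.presheaf.stalk x) C.X.functionField) (Matrix.of (G x))
    rw [RingHom.mapMatrix_apply] at h3
    rw [← h3]
    exact C.ord_algebraMap_nonneg _
  rw [Fintype.card_fin] at h1
  omega

/-- A unimodular form identifies `E` with `E^∨ ⊗ N`, whence `2 deg E = r deg N`. -/
theorem two_mul_degree (hQ : Q.InducesIso) : 2 * E.degree = E.rank * N.degree := by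
  choose ν f g hν0 hν hf hgu hg using Q.exists_unimodular hQ
  let e := Equiv.emptySum (Fin 0) (Fin E.rank)
  have hbot : ∀ x, IsLatticeBasis (E.lattice x) (⊥ : Submodule C.X.functionField _)
      ((f x ∘ e) ∘ Sum.inl) := fun x =>
    ⟨linearIndependent_empty_type, by simp, fun v _ hv => by
      rw [(Submodule.mem_bot _).1 hv]; exact Submodule.zero_mem _, fun i => i.elim0⟩
  have h1 := Q.subDegree_add_finsum_ord (ι₁ := Fin 0) (ι₂ := Fin 0) (κ := Fin E.rank) (I₁ := ⊥)
      (I₂ := ⊥) (W₁ := ⊤) (W₂ := ⊤)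
    bot_le bot_le (by simp) (by simp) (by simp) (by simp)
    (fun v hv w _ => by rw [(Submodule.mem_bot _).1 hv]; simp)
      (fun v _ w hv => by rw [(Submodule.mem_bot _).1 hv]; simp)
    (fun v _ h => (Submodule.mem_bot _).2 (Q.eq_zero_of_bilin_eq_zero hQ fun w => h w Submodule.mem_top))
    hν0 hν (fun x => (hf x).comp_equiv e) hbot (fun x => (hf x).comp_equiv e) hbot
    (G := fun x => (g x).map (algebraMap _ C.X.functionField)) hg
  have h2 : ∀ x, Scheme.ord ((g x).map (algebraMap _ C.X.functionField)).det x = 0 := by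
    intro x
    have h3 := RingHom.map_det (algebraMap (C.X.presheaf.stalk x) C.X.functionField) (g x)
    rw [RingHom.mapMatrix_apply] at h3
    rw [← h3]
    exact C.ord_algebraMap_of_isUnit (hgu x)
  simp only [h2, finsum_zero, E.subDegree_bot, ← E.degree_eq_subDegree_top, Fintype.card_fin] at h1
  linarith

end SymForm

/-! ### Slope defect, weighted filtrations and stability -/

namespace VectorBundle

variable (E : VectorBundle C)

/-- The number `r · deg W - deg E · rk W` attached to a subspace `W` of the generic fibre; its sign
compares the slopes of `W` and of `E`. -/
def slopeDefect (W : Submodule C.X.functionField (Fin E.rank → C.X.functionField)) : ℤ :=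
  E.rank * E.subDegree W - E.degree * Module.finrank C.X.functionField W

theorem slopeDefect_bot : E.slopeDefect ⊥ = 0 := by
  simp [slopeDefect, subDegree_bot]

end VectorBundle

namespace SymForm

variable {E : VectorBundle C} {N : LineBundle C} {Q : SymForm E N.toVectorBundle}

theorem isRefl_bilin : Q.bilin.IsRefl := fun v w h => (Q.bilin_comm w v).trans h

theorem finrank_add_finrank_orthogonal (hQ : Q.InducesIso)
    (W : Submodule C.X.functionField (Fin E.rank → C.X.functionField)) :
    Module.finrank C.X.functionField W + Module.finrank C.X.functionField (Q.bilin.orthogonal W) =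
      E.rank := by
  have hbot : Q.bilin.orthogonal ⊤ = ⊥ := by
    rw [eq_bot_iff]
    intro v hv
    exact (Submodule.mem_bot _).2 (Q.eq_zero_of_bilin_eq_zero hQ fun w =>
      (Q.bilin_comm v w).trans (hv w Submodule.mem_top))
  rw [LinearMap.BilinForm.finrank_add_finrank_orthogonal isRefl_bilin, hbot, inf_bot_eq,
    finrank_bot, add_zero,
    Module.finrank_fin_fun]

/-- Passing to the radical of the restriction of the form does not decrease the slope defect: the
form is a perfect pairing of `W/rad W` with itself. -/
theorem slopeDefect_le_slopeDefect_radical (hQ : Q.InducesIso)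
    (W : Submodule C.X.functionField (Fin E.rank → C.X.functionField)) :
    E.slopeDefect W ≤ E.slopeDefect (W ⊓ Q.bilin.orthogonal W) := by
  have hle := Submodule.finrank_mono (inf_le_left : W ⊓ Q.bilin.orthogonal W ≤ W)
  have h1 := Q.subDegree_sub_add_le hQ (m := Module.finrank C.X.functionField W -
      Module.finrank C.X.functionField (W ⊓ Q.bilin.orthogonal W : Submodule _ _))
    (inf_le_left : W ⊓ Q.bilin.orthogonal W ≤ W) (inf_le_left : W ⊓ Q.bilin.orthogonal W ≤ W)
      (by omega) (by omega)
    (fun v hv w hw => (Q.bilin_comm v w).trans (hv.2 w hw)) (fun v hv w hw => hw.2 v hv)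
    (fun v hv h => ⟨hv, fun w hw => (Q.bilin_comm w v).trans (h w hw)⟩)
  have h2 := Q.two_mul_degree hQ
  have h3 := mul_le_mul_of_nonneg_left h1 (Int.natCast_nonneg E.rank)
  rw [Nat.cast_sub hle] at h3
  unfold VectorBundle.slopeDefect
  have h4 : 2 * (E.rank * E.subDegree W - E.degree * Module.finrank C.X.functionField W) ≤
      2 * (E.rank * E.subDegree (W ⊓ Q.bilin.orthogonal W) -
        E.degree * Module.finrank C.X.functionField (W ⊓ Q.bilin.orthogonal W : Submodule _ _)) := by
    linear_combination h3 - ((Module.finrank C.X.functionField W : ℤ) -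
      Module.finrank C.X.functionField (W ⊓ Q.bilin.orthogonal W : Submodule _ _)) * h2
  linarith

/-- The pairing of `W` with `E/W^⊥` shows that the slope defect of `W^⊥` is at least that of `W`. -/
theorem slopeDefect_le_slopeDefect_orthogonal (hQ : Q.InducesIso)
    (W : Submodule C.X.functionField (Fin E.rank → C.X.functionField)) :
    E.slopeDefect W ≤ E.slopeDefect (Q.bilin.orthogonal W) := by
  have hr := finrank_add_finrank_orthogonal hQ W
  have h1 := Q.subDegree_sub_add_le hQ (m := Module.finrank C.X.functionField W) (I₁ := ⊥) (W₁ := W)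
    (I₂ := Q.bilin.orthogonal W) (W₂ := ⊤) bot_le le_top (by simp)
      (by rw [finrank_top, Module.finrank_fin_fun]; omega)
    (fun v hv w _ => by rw [(Submodule.mem_bot _).1 hv]; simp) (fun v hv w hw => hw v hv)
    (fun v _ h => (Submodule.mem_bot _).2 (Q.eq_zero_of_bilin_eq_zero hQ fun w => h w Submodule.mem_top))
  have h2 := Q.two_mul_degree hQ
  have h3 := mul_le_mul_of_nonneg_left h1 (Int.natCast_nonneg E.rank)
  have hr' : (Module.finrank C.X.functionField W : ℤ) +
      Module.finrank C.X.functionField (Q.bilin.orthogonal W) = E.rank := by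
    exact_mod_cast hr
  rw [E.subDegree_bot, ← E.degree_eq_subDegree_top] at h3
  have h4 : (Module.finrank C.X.functionField (Q.bilin.orthogonal W) : ℤ) =
      E.rank - Module.finrank C.X.functionField W := by
    linarith
  unfold VectorBundle.slopeDefect
  rw [h4]
  nlinarith

end SymForm

namespace QuadricBundle

variable {N : LineBundle C} {B : QuadricBundle N}

/-- Isotropic subbundles are those with totally isotropic generic fibre. -/
theorem isIsotropic_iff {F : Subbundle B.E} : B.IsIsotropic F ↔ F.gen ≤ B.Q.bilin.orthogonal F.gen := by
  rw [IsIsotropic, B.Q.nonzeroOn_iff]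
  push Not
  exact ⟨fun h v hv w hw => h w hw v hv, fun h v hv w hw => h hw v hv⟩

/-- A nonzero isotropic subspace is proper, since its dimension is at most half of `r`. -/
theorem finrank_lt_rank (hB : B.Q.InducesIso)
    {I : Submodule C.X.functionField (Fin B.E.rank → C.X.functionField)}
    (hI : I ≤ B.Q.bilin.orthogonal I) (hI0 : I ≠ ⊥) :
    0 < Module.finrank C.X.functionField I ∧ Module.finrank C.X.functionField I < B.E.rank := by
  have h1 := SymForm.finrank_add_finrank_orthogonal hB I
  have h2 := Submodule.finrank_mono hI
  have h3 : 0 < Module.finrank C.X.functionField I :=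
    Nat.pos_of_ne_zero fun h => hI0 (Submodule.finrank_eq_zero.1 h)
  omega

theorem slopeDefect_nonpos_iff (F : Subbundle B.E) (hF : F.IsProperSub) :
    (F.degree : ℚ) / F.rank ≤ (B.E.degree : ℚ) / B.E.rank ↔ B.E.slopeDefect F.gen ≤ 0 := by
  have h1 : (0 : ℚ) < F.rank := by exact_mod_cast hF.1
  have h2 : (0 : ℚ) < B.E.rank := by exact_mod_cast hF.1.trans hF.2
  rw [div_le_div_iff₀ h1 h2, VectorBundle.slopeDefect, F.finrank_gen, ← F.degree_eq_subDegree,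
    sub_nonpos, mul_comm]
  exact_mod_cast Iff.rfl

theorem slopeDefect_neg_iff (F : Subbundle B.E) (hF : F.IsProperSub) :
    (F.degree : ℚ) / F.rank < (B.E.degree : ℚ) / B.E.rank ↔ B.E.slopeDefect F.gen < 0 := by
  have h1 : (0 : ℚ) < F.rank := by exact_mod_cast hF.1
  have h2 : (0 : ℚ) < B.E.rank := by exact_mod_cast hF.1.trans hF.2
  rw [div_lt_div_iff₀ h1 h2, VectorBundle.slopeDefect, F.finrank_gen, ← F.degree_eq_subDegree,
    sub_neg, mul_comm]
  exact_mod_cast Iff.rfl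

/-- Semistability is a condition on the isotropic subspaces of the generic fibre. -/
theorem isGenRamananSemistable_iff (hB : B.Q.InducesIso) : B.IsGenRamananSemistable ↔
    ∀ I : Submodule C.X.functionField (Fin B.E.rank → C.X.functionField), I ≤ B.Q.bilin.orthogonal I → I ≠ ⊥ →
      B.E.slopeDefect I ≤ 0 := by
  constructor
  · intro h I hI hI0
    have hp : (Subbundle.ofSubspace I).IsProperSub := finrank_lt_rank hB hI hI0
    have := (slopeDefect_nonpos_iff _ hp).1
        (h (Subbundle.ofSubspace I) hp (isIsotropic_iff.2 (by simpa using hI)))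
    rwa [Subbundle.gen_ofSubspace] at this
  · intro h F hp hF
    refine (slopeDefect_nonpos_iff _ hp).2 (h _ (isIsotropic_iff.1 hF) fun h0 => ?_)
    have := F.finrank_gen
    rw [h0, finrank_bot] at this
    exact hp.1.ne this

/-- Stability is a condition on the isotropic subspaces of the generic fibre. -/
theorem isGenRamananStable_iff (hB : B.Q.InducesIso) : B.IsGenRamananStable ↔
    ∀ I : Submodule C.X.functionField (Fin B.E.rank → C.X.functionField), I ≤ B.Q.bilin.orthogonal I → I ≠ ⊥ →
      B.E.slopeDefect I < 0 := by
  constructor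
  · intro h I hI hI0
    have hp : (Subbundle.ofSubspace I).IsProperSub := finrank_lt_rank hB hI hI0
    have := (slopeDefect_neg_iff _ hp).1
        (h (Subbundle.ofSubspace I) hp (isIsotropic_iff.2 (by simpa using hI)))
    rwa [Subbundle.gen_ofSubspace] at this
  · intro h F hp hF
    refine (slopeDefect_neg_iff _ hp).2 (h _ (isIsotropic_iff.1 hF) fun h0 => ?_)
    have := F.finrank_gen
    rw [h0, finrank_bot] at this
    exact hp.1.ne this

theorem P_eq (𝓔 : WeightedFiltration B.E) :
    𝓔.P = - ∑ i, 𝓔.weight i * (B.E.slopeDefect (𝓔.sub i).gen : ℚ) := by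
  rw [WeightedFiltration.P, ← Finset.sum_neg_distrib]
  refine Finset.sum_congr rfl fun i _ => ?_
  rw [VectorBundle.slopeDefect, Subbundle.finrank_gen, ← Subbundle.degree_eq_subDegree]
  push_cast
  ring

theorem mem_pairs {𝓔 : WeightedFiltration B.E} {p : Fin (𝓔.length + 1) × Fin (𝓔.length + 1)} :
    p ∈ B.pairs 𝓔 ↔ B.Q.NonzeroOn (𝓔.extSub p.1) (𝓔.extSub p.2) := by
  simp [pairs]

theorem mu_nonpos {𝓔 : WeightedFiltration B.E}
    (h : ∀ i j, B.Q.NonzeroOn (𝓔.extSub i) (𝓔.extSub j) → 0 ≤ 𝓔.gamma i + 𝓔.gamma j) : B.mu 𝓔 ≤ 0 := by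
  rw [mu, neg_nonpos, Finset.le_inf'_iff]
  intro p hp
  exact h _ _ (mem_pairs.1 hp)

theorem neg_gamma_add_gamma_le_mu {𝓔 : WeightedFiltration B.E} {i j : Fin (𝓔.length + 1)}
    (h : B.Q.NonzeroOn (𝓔.extSub i) (𝓔.extSub j)) : -(𝓔.gamma i + 𝓔.gamma j) ≤ B.mu 𝓔 := by
  rw [mu, neg_le_neg_iff]
  exact Finset.inf'_le (fun p : Fin (𝓔.length + 1) × Fin (𝓔.length + 1) => 𝓔.gamma p.1 + 𝓔.gamma p.2)
    (mem_pairs.2 h : (i, j) ∈ B.pairs 𝓔)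

/-- The filtration `F ⊆ F^⊥` with weights `1` tests the slope of an isotropic subbundle `F` with
generic fibre `I`. If `F = F^⊥`, it is the filtration by `F` alone. -/
theorem exists_weightedFiltration (hB : B.Q.InducesIso)
    {I : Submodule C.X.functionField (Fin B.E.rank → C.X.functionField)}
    (hI : I ≤ B.Q.bilin.orthogonal I) (hI0 : I ≠ ⊥) :
    ∃ (𝓔 : WeightedFiltration B.E) (c : ℚ), 0 < c ∧ B.mu 𝓔 ≤ 0 ∧ 𝓔.P ≤ - (c * B.E.slopeDefect I) := by
  have hr := SymForm.finrank_add_finrank_orthogonal hB I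
  have hp := finrank_lt_rank hB hI hI0
  have hrq : (Module.finrank C.X.functionField I : ℚ) +
      Module.finrank C.X.functionField (B.Q.bilin.orthogonal I) = B.E.rank := by
    exact_mod_cast hr
  have hII : ¬ B.Q.NonzeroOn (Subbundle.ofSubspace I) (Subbundle.ofSubspace I) :=
    isIsotropic_iff.2 (by simpa using hI)
  have hν := SymForm.slopeDefect_le_slopeDefect_orthogonal hB I
  -- for `I = I^⊥` the dimension of `I` is `r / 2` and `γ = (-r/2, r/2)` in blocks
  rcases hI.eq_or_lt with heq | hlt
  · let 𝓔 : WeightedFiltration B.E :=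
      { length := 1
        length_pos := Nat.one_pos
        sub := fun _ => Subbundle.ofSubspace I
        strictMono := Subsingleton.strictMono _
        proper := fun _ => hp
        weight := fun _ => 1
        weight_pos := fun _ => one_pos }
    rw [← heq] at hrq
    have g0 : 𝓔.gamma (0 : Fin 2) = Module.finrank C.X.functionField I - B.E.rank := by
      change ∑ k : Fin 1, (1 : ℚ) *
        (if Module.finrank C.X.functionField I ≤ Module.finrank C.X.functionField I then _ else _) = _
      simp [𝓔, Subbundle.ofSubspace]
    have g1 : 𝓔.gamma (1 : Fin 2) = Module.finrank C.X.functionField I := by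
      change ∑ k : Fin 1, (1 : ℚ) * (if B.E.rank ≤ Module.finrank C.X.functionField I then _ else _) = _
      rw [if_neg (by omega)]
      simp [𝓔, Subbundle.ofSubspace]
    refine ⟨𝓔, 1, one_pos, mu_nonpos ?_, ?_⟩
    · change ∀ i j : Fin 2, _
      intro i j h
      fin_cases i <;> fin_cases j
      · exact absurd h hII
      · change 0 ≤ 𝓔.gamma (0 : Fin 2) + 𝓔.gamma (1 : Fin 2)
        rw [g0, g1]; linarith
      · change 0 ≤ 𝓔.gamma (1 : Fin 2) + 𝓔.gamma (0 : Fin 2)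
        rw [g0, g1]; linarith
      · change 0 ≤ 𝓔.gamma (1 : Fin 2) + 𝓔.gamma (1 : Fin 2)
        rw [g1]; positivity
    · rw [P_eq]
      change -∑ k : Fin 1, (1 : ℚ) * (B.E.slopeDefect (Subbundle.ofSubspace I).gen : ℚ) ≤ _
      simp
  · have hk := Submodule.finrank_lt_finrank_of_lt hlt
    -- the vector `γ` is `-r` on `I`, `0` on `I^⊥ / I` and `r` on `E / I^⊥`
    let 𝓔 : WeightedFiltration B.E :=
      { length := 2
        length_pos := Nat.two_pos
        sub := ![Subbundle.ofSubspace I, Subbundle.ofSubspace (B.Q.bilin.orthogonal I)]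
        strictMono := by
          refine Fin.strictMono_iff_lt_succ.2 fun i => ?_
          fin_cases i
          refine lt_of_le_not_ge (Subbundle.le_iff_gen_le.2 ?_) fun h => ?_
          · simpa using hI
          · have := Subbundle.le_iff_gen_le.1 h
            simp only [Fin.zero_eta, Fin.isValue, Fin.succ_zero_eq_one, Matrix.cons_val_one,
              Matrix.cons_val_fin_one, Subbundle.gen_ofSubspace, Fin.castSucc_zero,
                Matrix.cons_val_zero] at this
            exact not_le_of_gt hlt this
        proper := fun i => by
          fin_cases i
          · exact hp
          · change 0 < Module.finrank C.X.functionField (B.Q.bilin.orthogonal I) ∧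
              Module.finrank C.X.functionField (B.Q.bilin.orthogonal I) < B.E.rank
            omega
        weight := fun _ => 1
        weight_pos := fun _ => one_pos }
    have hγ : ∀ p : ℕ, 𝓔.gammaVec p =
        (if p ≤ Module.finrank C.X.functionField I then (Module.finrank C.X.functionField I : ℚ) - B.E.rank
          else (Module.finrank C.X.functionField I : ℚ)) +
        (if p ≤ Module.finrank C.X.functionField (B.Q.bilin.orthogonal I) then
          (Module.finrank C.X.functionField (B.Q.bilin.orthogonal I) : ℚ) - B.E.rank
          else (Module.finrank C.X.functionField (B.Q.bilin.orthogonal I) : ℚ)) := by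
      intro p
      refine (Fin.sum_univ_two _).trans ?_
      exact congrArg₂ (· + ·) (one_mul _) (one_mul _)
    have g0 : 𝓔.gamma (0 : Fin 3) = -B.E.rank := by
      refine (hγ (Module.finrank C.X.functionField I)).trans ?_
      rw [if_pos le_rfl, if_pos (by omega)]
      linarith
    have g1 : 𝓔.gamma (1 : Fin 3) = 0 := by
      refine (hγ (Module.finrank C.X.functionField (B.Q.bilin.orthogonal I))).trans ?_
      rw [if_pos le_rfl, if_neg (by omega)]
      linarith
    have g2 : 𝓔.gamma (2 : Fin 3) = B.E.rank := by
      refine (hγ B.E.rank).trans ?_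
      rw [if_neg (by omega), if_neg (by omega)]
      exact hrq
    have hr0 : (0 : ℚ) ≤ B.E.rank := Nat.cast_nonneg _
    have hIperp : ¬ B.Q.NonzeroOn (Subbundle.ofSubspace I)
        (Subbundle.ofSubspace (B.Q.bilin.orthogonal I)) := by
      rw [B.Q.nonzeroOn_iff, Subbundle.gen_ofSubspace, Subbundle.gen_ofSubspace]
      push Not
      exact fun v hv w hw => hw v hv
    have hperpI : ¬ B.Q.NonzeroOn (Subbundle.ofSubspace (B.Q.bilin.orthogonal I))
        (Subbundle.ofSubspace I) := by
      rw [B.Q.nonzeroOn_iff, Subbundle.gen_ofSubspace, Subbundle.gen_ofSubspace]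
      push Not
      exact fun v hv w hw => (B.Q.bilin_comm v w).trans (hv w hw)
    refine ⟨𝓔, 2, two_pos, mu_nonpos ?_, ?_⟩
    · have key : ∀ i j : Fin 3, B.Q.NonzeroOn (𝓔.extSub i) (𝓔.extSub j) → 0 ≤ 𝓔.gamma i + 𝓔.gamma j := by
        intro i j h
        match i, j with
        | 0, 0 => exact absurd h hII
        | 0, 1 => exact absurd h hIperp
        | 0, 2 => rw [g0, g2]; linarith
        | 1, 0 => exact absurd h hperpI
        | 1, 1 => rw [g1, add_zero]
        | 1, 2 => rw [g1, g2]; linarith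
        | 2, 0 => rw [g0, g2]; linarith
        | 2, 1 => rw [g1, g2]; linarith
        | 2, 2 => rw [g2]; linarith
      exact key
    · have h1 : 𝓔.P = -((B.E.slopeDefect I : ℚ) + B.E.slopeDefect (B.Q.bilin.orthogonal I)) := by
        rw [P_eq]
        refine congrArg Neg.neg ((Fin.sum_univ_two _).trans (congrArg₂ (· + ·) ?_ ?_))
        · exact (one_mul _).trans (congrArg (fun W => (B.E.slopeDefect W : ℚ)) (Subbundle.gen_ofSubspace _))
        · exact (one_mul _).trans (congrArg (fun W => (B.E.slopeDefect W : ℚ)) (Subbundle.gen_ofSubspace _))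
      have h2 : (B.E.slopeDefect I : ℚ) ≤ B.E.slopeDefect (B.Q.bilin.orthogonal I) := by exact_mod_cast hν
      linarith

theorem extSub_castSucc (𝓔 : WeightedFiltration B.E) (k : Fin 𝓔.length) : 𝓔.extSub k.castSucc = 𝓔.sub k := by
  simp [WeightedFiltration.extSub]

theorem extSub_last (𝓔 : WeightedFiltration B.E) : 𝓔.extSub (Fin.last _) = Subbundle.whole B.E := by
  simp [WeightedFiltration.extSub]

/-- Subbundles whose ranks add up to more than the rank of `E` are not orthogonal to each other. -/
theorem nonzeroOn_of_rank_lt (hB : B.Q.InducesIso) {F G : Subbundle B.E} (h : B.E.rank < F.rank + G.rank) :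
    B.Q.NonzeroOn F G := by
  rw [B.Q.nonzeroOn_iff]
  by_contra! h0
  have h1 : G.gen ≤ B.Q.bilin.orthogonal F.gen := fun w hw v hv => h0 v hv w hw
  have h2 := Submodule.finrank_mono h1
  have h3 := SymForm.finrank_add_finrank_orthogonal hB F.gen
  rw [F.finrank_gen] at h3
  rw [G.finrank_gen] at h2
  omega

/-- The entries of `γ` are the weights of a one-parameter subgroup of the special linear group. -/
theorem sum_gammaVec (𝓔 : WeightedFiltration B.E) : ∑ p ∈ Finset.Icc 1 B.E.rank, 𝓔.gammaVec p = 0 := by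
  simp only [WeightedFiltration.gammaVec]
  rw [Finset.sum_comm]
  refine Finset.sum_eq_zero fun k _ => ?_
  rw [← Finset.mul_sum]
  have hk := (𝓔.proper k).2
  have h1 : ((Finset.Icc 1 B.E.rank).filter fun p => p ≤ (𝓔.sub k).rank) = Finset.Icc 1 (𝓔.sub k).rank := by
    ext p
    simp only [Finset.mem_filter, Finset.mem_Icc]
    omega
  have h2 : ∀ p : ℕ, (if p ≤ (𝓔.sub k).rank then ((𝓔.sub k).rank : ℚ) - B.E.rank else ((𝓔.sub k).rank : ℚ)) =
      (𝓔.sub k).rank - if p ≤ (𝓔.sub k).rank then (B.E.rank : ℚ) else 0 := by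
    intro p
    split_ifs <;> ring
  simp only [h2, Finset.sum_sub_distrib, ← Finset.sum_filter, h1, Finset.sum_const, Nat.card_Icc,
    nsmul_eq_mul,
    Nat.add_sub_cancel]
  ring

/-- Every entry of the vector `γ` is attached to a term of the filtration of at least the
corresponding rank. -/
theorem exists_gamma_eq_gammaVec (𝓔 : WeightedFiltration B.E) {p : ℕ} (hp : p ≤ B.E.rank) :
    ∃ i, p ≤ (𝓔.extSub i).rank ∧ 𝓔.gamma i = 𝓔.gammaVec p := by
  obtain ⟨i, hi, hmin⟩ := Finset.exists_min_image (Finset.univ.filter fun i => p ≤ (𝓔.extSub i).rank)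
    (fun i => (𝓔.extSub i).rank) ⟨Fin.last _,
      Finset.mem_filter.2 ⟨Finset.mem_univ _, by rw [extSub_last]; exact hp⟩⟩
  have hi' := (Finset.mem_filter.1 hi).2
  refine ⟨i, hi', ?_⟩
  rw [WeightedFiltration.gamma, WeightedFiltration.gammaVec, WeightedFiltration.gammaVec]
  refine Finset.sum_congr rfl fun k _ => ?_
  have : (𝓔.extSub i).rank ≤ (𝓔.sub k).rank ↔ p ≤ (𝓔.sub k).rank := by
    refine ⟨fun h => hi'.trans h, fun h => ?_⟩
    have := hmin k.castSucc (Finset.mem_filter.2 ⟨Finset.mem_univ _, by rwa [extSub_castSucc]⟩)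
    rwa [extSub_castSucc] at this
  simp only [this]

/-- Since the entries of `γ` add up to `0`, two entries in opposite positions have a nonpositive
sum; they belong to terms of the filtration that are too large to be orthogonal to each other. -/
theorem mu_nonneg (hB : B.Q.InducesIso) (𝓔 : WeightedFiltration B.E) : 0 ≤ B.mu 𝓔 := by
  have hr : 0 < B.E.rank := (𝓔.proper ⟨0, 𝓔.length_pos⟩).1.trans (𝓔.proper ⟨0, 𝓔.length_pos⟩).2
  have h0 : ∑ p ∈ Finset.Icc 1 B.E.rank, (𝓔.gammaVec p + 𝓔.gammaVec (B.E.rank + 1 - p)) = 0 := by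
    rw [Finset.sum_add_distrib, sum_gammaVec, zero_add, ← sum_gammaVec 𝓔]
    -- the reflection `p ↦ r + 1 - p` of the set of positions
    refine Finset.sum_nbij' (fun p => B.E.rank + 1 - p) (fun p => B.E.rank + 1 - p) ?_ ?_ ?_ ?_ ?_ <;>
      simp only [Finset.mem_Icc] <;> intros <;> first | omega | trivial
  obtain ⟨p, hp, hle⟩ : ∃ p ∈ Finset.Icc 1 B.E.rank, 𝓔.gammaVec p + 𝓔.gammaVec (B.E.rank + 1 - p) ≤ 0 := by
    by_contra! h
    exact (Finset.sum_pos h ⟨1, Finset.mem_Icc.2 ⟨le_rfl, hr⟩⟩).ne' h0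
  rw [Finset.mem_Icc] at hp
  obtain ⟨i, hi, hi'⟩ := exists_gamma_eq_gammaVec 𝓔 hp.2
  obtain ⟨j, hj, hj'⟩ := exists_gamma_eq_gammaVec 𝓔 (p := B.E.rank + 1 - p) (by omega)
  have := neg_gamma_add_gamma_le_mu (nonzeroOn_of_rank_lt hB (F := 𝓔.extSub i) (G := 𝓔.extSub j) (by omega))
  rw [hi', hj'] at this
  linarith

/-- Semistability with respect to isotropic subbundles bounds the slopes of all subbundles, as the
radical of a subspace is isotropic. -/
theorem slopeDefect_nonpos_of_isGenRamananSemistable (hB : B.Q.InducesIso) (h : B.IsGenRamananSemistable)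
    (W : Submodule C.X.functionField (Fin B.E.rank → C.X.functionField)) : B.E.slopeDefect W ≤ 0 := by
  refine (SymForm.slopeDefect_le_slopeDefect_radical hB W).trans ?_
  by_cases h0 : W ⊓ B.Q.bilin.orthogonal W = ⊥
  · rw [h0, B.E.slopeDefect_bot]
  · exact (isGenRamananSemistable_iff hB).1 h _
      (fun v hv w hw => hv.2 w hw.1) h0

theorem P_nonneg (hB : B.Q.InducesIso) (h : B.IsGenRamananSemistable) (𝓔 : WeightedFiltration B.E) :
    0 ≤ 𝓔.P := by
  rw [P_eq, neg_nonneg]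
  refine Finset.sum_nonpos fun i _ => mul_nonpos_of_nonneg_of_nonpos (𝓔.weight_pos i).le ?_
  exact_mod_cast slopeDefect_nonpos_of_isGenRamananSemistable hB h _

theorem isGenRamananSemistable_iff_isDeltaSemistable (hB : B.Q.InducesIso) {δ : ℚ} (hδ : 0 < δ) :
    B.IsGenRamananSemistable ↔ B.IsDeltaSemistable δ := by
  constructor
  · intro h 𝓔
    exact add_nonneg (P_nonneg hB h 𝓔) (mul_nonneg hδ.le (mu_nonneg hB 𝓔))
  · intro h
    rw [isGenRamananSemistable_iff hB]
    intro I hI hI0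
    obtain ⟨𝓔, c, hc, hmu, hP⟩ := exists_weightedFiltration hB hI hI0
    have h1 := h 𝓔
    have h2 := mul_nonpos_of_nonneg_of_nonpos hδ.le hmu
    have : (B.E.slopeDefect I : ℚ) ≤ 0 := nonpos_of_mul_nonpos_right (by linarith) hc
    exact_mod_cast this

theorem isGenRamananStable_iff_isDeltaStable (hB : B.Q.InducesIso) {δ : ℚ} (hδ : 0 < δ) :
    B.IsGenRamananStable ↔ B.IsDeltaStable δ := by
  constructor
  · intro h 𝓔
    have hss : B.IsGenRamananSemistable := fun F hF hF' => (h F hF hF').le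
    have hP := P_nonneg hB hss 𝓔
    have hmu := mul_nonneg hδ.le (mu_nonneg hB 𝓔)
    -- the term of smallest rank is part of all others, and its entry of `γ` is smallest
    obtain ⟨k, -, hk⟩ := Finset.exists_min_image Finset.univ (fun i => (𝓔.sub i).rank)
      ⟨⟨0, 𝓔.length_pos⟩, Finset.mem_univ _⟩
    by_cases hrad : (𝓔.sub k).gen ⊓ B.Q.bilin.orthogonal (𝓔.sub k).gen = ⊥
    · -- the form does not vanish on the smallest term, whose entry of `γ` is negative
      have hne : B.Q.NonzeroOn (𝓔.extSub k.castSucc) (𝓔.extSub k.castSucc) := by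
        rw [extSub_castSucc]
        by_contra h0
        have h1 := isIsotropic_iff.1 h0
        rw [inf_of_le_left h1] at hrad
        have h2 := (𝓔.sub k).finrank_gen
        rw [hrad, finrank_bot] at h2
        exact (𝓔.proper k).1.ne h2
      have hγ : 𝓔.gamma k.castSucc < 0 := by
        rw [WeightedFiltration.gamma, extSub_castSucc, WeightedFiltration.gammaVec]
        refine Finset.sum_neg (fun i _ => mul_neg_of_pos_of_neg (𝓔.weight_pos i) ?_) ⟨k, Finset.mem_univ _⟩
        rw [if_pos (hk i (Finset.mem_univ _)), sub_neg]
        exact_mod_cast (𝓔.proper i).2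
      have h1 := neg_gamma_add_gamma_le_mu hne
      have h2 : 0 < B.mu 𝓔 := by linarith
      have := mul_pos hδ h2
      linarith
    · -- the radical of a term is isotropic
      have h1 : B.E.slopeDefect (𝓔.sub k).gen < 0 :=
        (SymForm.slopeDefect_le_slopeDefect_radical hB _).trans_lt
          ((isGenRamananStable_iff hB).1 h _ (fun v hv w hw => hv.2 w hw.1) hrad)
      have h2 : 0 < 𝓔.P := by
        rw [P_eq, neg_pos]
        refine Finset.sum_neg' (fun i _ => mul_nonpos_of_nonneg_of_nonpos (𝓔.weight_pos i).le ?_)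
          ⟨k, Finset.mem_univ _, mul_neg_of_pos_of_neg (𝓔.weight_pos k) (by exact_mod_cast h1)⟩
        exact_mod_cast slopeDefect_nonpos_of_isGenRamananSemistable hB hss _
      linarith
  · intro h
    rw [isGenRamananStable_iff hB]
    intro I hI hI0
    obtain ⟨𝓔, c, hc, hmu, hP⟩ := exists_weightedFiltration hB hI hI0
    have h1 := h 𝓔
    have h2 := mul_nonpos_of_nonneg_of_nonpos hδ.le hmu
    have : (B.E.slopeDefect I : ℚ) < 0 := neg_of_mul_neg_right (by linarith) hc.le
    exact_mod_cast this

end QuadricBundle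

/-! ### Orthogonal bundles -/

/-- The constant section `1` is a frame of the structure sheaf. -/
theorem isFrame_structureSheaf (C : SmoothProjectiveCurve) :
    IsFrame (structureSheaf C).sheaf (fun _ => ⊤) (r := (structureSheaf C).rank) ⊤
      (fun _ => (1 : Γ(C.X, ⊤))) := by
  refine ⟨fun _ => Submodule.mem_top, fun V h s _ => ?_⟩
  have h1 : res (unitSheaf C.X) h (1 : Γ(C.X, ⊤)) = (1 : Γ(C.X, V)) :=
    map_one (C.X.presheaf.map (homOfLE h).op).hom
  have h2 : ∀ b : Γ(C.X, V), b • res (unitSheaf C.X) h (1 : Γ(C.X, ⊤)) = (b : Γ(C.X, V)) := by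
    intro b
    rw [h1]
    exact mul_one b
  refine ⟨fun _ => (s : Γ(C.X, V)), ((Fin.sum_univ_one _).trans (h2 s)).symm, fun a ha => ?_⟩
  funext i
  have h3 := ha.trans (Fin.sum_univ_one _)
  rw [(structureSheaf C).eq_idx i]
  exact (h3.trans (h2 (a (structureSheaf C).idx))).symm

/-- The section `1` of `𝒪_X` generates it everywhere, so `deg 𝒪_X` is the degree of the divisor of
one rational function. -/
theorem degree_structureSheaf (C : SmoothProjectiveCurve) : (structureSheaf C).degree = 0 := by
  let N := structureSheaf C
  have hη := TopologicalSpace.Opens.mem_top (genericPoint C.X)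
  have hf := fun x : C.X => (N.toVectorBundle.isLatticeBasis_gen (TopologicalSpace.Opens.mem_top x)
    (isFrame_structureSheaf C)).comp_equiv
      (Equiv.ofBijective (fun _ : Unit => N.idx) ⟨fun _ _ _ => rfl, fun i => ⟨(), (N.eq_idx i).symm⟩⟩)
  have hν : ∀ x : C.X, IsLatticeBasis (N.toVectorBundle.lattice x) (⊤ : Submodule C.X.functionField _)
      (fun _ : Unit => Function.const _ (N.rat hη (1 : Γ(C.X, ⊤)))) := by
    intro x
    have h := hf x
    have h' : ((fun _ : Fin N.rank => N.toVectorBundle.gen hη (1 : Γ(C.X, ⊤))) ∘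
        (Equiv.ofBijective (fun _ : Unit => N.idx) ⟨fun _ _ _ => rfl, fun i => ⟨(), (N.eq_idx i).symm⟩⟩)) =
        fun _ : Unit => Function.const _ (N.rat hη (1 : Γ(C.X, ⊤))) := funext fun _ => N.gen_eq_const hη _
    exact h' ▸ h
  have h0 : N.rat hη (1 : Γ(C.X, ⊤)) ≠ 0 := by
    -- any point will do; the generic point serves to have one
    have h0' : ∀ _ : C.X, N.rat hη (1 : Γ(C.X, ⊤)) ≠ 0 := fun x h0 => by
      refine (hν x).linearIndependent.ne_zero () ?_
      rw [h0]
      rfl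
    exact h0' (genericPoint C.X)
  rw [(N.degree_eq (fun _ => h0) hν).2, (C.finite_support_ord_and_finsum_ord h0).2, neg_zero]

namespace QuadricBundle

variable {B : QuadricBundle (structureSheaf C)}

theorem degree_eq_zero_of_isOrthogonal (hB : B.IsOrthogonal) : B.E.degree = 0 := by
  have := B.Q.two_mul_degree hB
  rw [degree_structureSheaf, mul_zero] at this
  omega

theorem isRamananSemistable_iff_isGenRamananSemistable (hB : B.IsOrthogonal) :
    B.IsRamananSemistable ↔ B.IsGenRamananSemistable := by
  refine forall_congr' fun F => forall_congr' fun hF => forall_congr' fun _ => ?_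
  rw [degree_eq_zero_of_isOrthogonal hB, Int.cast_zero, zero_div,
    div_le_iff₀ (by exact_mod_cast hF.1), zero_mul]
  exact_mod_cast Iff.rfl

theorem isRamananStable_iff_isGenRamananStable (hB : B.IsOrthogonal) :
    B.IsRamananStable ↔ B.IsGenRamananStable := by
  refine forall_congr' fun F => forall_congr' fun hF => forall_congr' fun _ => ?_
  rw [degree_eq_zero_of_isOrthogonal hB, Int.cast_zero, zero_div,
    div_lt_iff₀ (by exact_mod_cast hF.1), zero_mul]
  exact_mod_cast Iff.rfl

end QuadricBundle

end OrthBundle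

end

theorem mainTheorem4 (C : OrthBundle.SmoothProjectiveCurve) (δ : ℚ) (hδ : 0 < δ) :
    (∀ B : OrthBundle.QuadricBundle (OrthBundle.structureSheaf C), B.IsOrthogonal →
      (B.IsRamananSemistable ↔ B.IsDeltaSemistable δ) ∧
      (B.IsRamananStable ↔ B.IsDeltaStable δ)) ∧
    (∀ (N : OrthBundle.LineBundle C) (B : OrthBundle.QuadricBundle N), B.IsGeneralizedOrthogonal →
      (B.IsGenRamananSemistable ↔ B.IsDeltaSemistable δ) ∧
      (B.IsGenRamananStable ↔ B.IsDeltaStable δ)) := by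
  refine ⟨fun B hB => ⟨?_, ?_⟩, fun N B hB => ⟨?_, ?_⟩⟩
  · rw [OrthBundle.QuadricBundle.isRamananSemistable_iff_isGenRamananSemistable hB]
    exact OrthBundle.QuadricBundle.isGenRamananSemistable_iff_isDeltaSemistable hB hδ
  · rw [OrthBundle.QuadricBundle.isRamananStable_iff_isGenRamananStable hB]
    exact OrthBundle.QuadricBundle.isGenRamananStable_iff_isDeltaStable hB hδ
  · exact OrthBundle.QuadricBundle.isGenRamananSemistable_iff_isDeltaSemistable hB hδ
  · exact OrthBundle.QuadricBundle.isGenRamananStable_iff_isDeltaStable hB hδ
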